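/- \textbf{Theorem (polynomial-time active learning of monophonic halfspaces).} Let $G=(V,E)$ be a finite, simple, undirected, connected graph. The monophonic interval $I_m(u,v)$ is the set of vertices lying on induced $(u,v)$-paths; $A\subseteq V$ is m-convex if $I_m(u,v)\subseteq A$ for all $u,v\in A$; the m-hull of $S$ is the smallest m-convex set containing $S$; $\mathcal H_m(G)$ is the set of m-halfspaces, i.e. of all $H\subseteq V$ such that $H$ and $V\setminus H$ are m-convex. Let $\mathrm{hull}(G)$ be the least size of a set whose m-hull is $V$, $\mathrm{diam}(G)$ the diameter, $\omega(G)$ the clique number, and $d$ the VC-dimension of $\mathcal H_m(G)$. The query complexity $\mathrm{qc}(\mathcal H)$ of a family $\mathcal H\subseteq 2^V$ is the minimum, over all deterministic adaptive algorithms $A$ that query vertices $x$ (learning whether $x\in H$) and output $H$ for every $H\in\mathcal H$, of the maximum over $H\in\mathcal H$ of the number of queries that $A$ makes. Put $\log 0=0$ for the one-vertex graph. Then \[\mathrm{qc}(\mathcal H_m(G))=\mathcal O\bigl(\mathrm{hull}(G)+\log\mathrm{diam}(G)+\log\omega(G)+d\bigr),\] that is, there is an absolute constant $C$ with $\mathrm{qc}(\mathcal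 H_m(G))\le C\,(\mathrm{hull}(G)+\log\mathrm{diam}(G)+\log\omega(G)+d)$ for all such $G$. Moreover, this is achieved in polynomial time: there are a single program $P$ (for a random-access machine with unit-cost addition and subtraction, access to the adjacency matrix of $G$, and a label-query instruction) and a polynomial $p$ such that, for every connected graph $G$ on $\{0,\dots,n-1\}$ and every $H\in\mathcal H_m(G)$, $P$ run on $G$ with labels given by $H$ halts within $p(n)$ steps, outputs $H$, and makes at most $C\,(\mathrm{hull}(G)+\log\mathrm{diam}(G)+\log\omega(G)+d)$ label queries. -/

import Mathlib

/-! ## Monophonic convexity -/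

namespace MonophonicLearning

section Convexity

variable {V : Type*}

/-- A walk is an induced path of `G` if it is a path and the only edges of `G` between its
vertices are its own edges. -/
def IsInducedPath (G : SimpleGraph V) {u v : V} (p : G.Walk u v) : Prop :=
  p.IsPath ∧ ∀ x ∈ p.support, ∀ y ∈ p.support, G.Adj x y → s(x, y) ∈ p.edges

/-- The monophonic interval: all vertices that lie on induced `(u, v)`-paths. -/
def mInterval (G : SimpleGraph V) (u v : V) : Set V :=
  {w | ∃ p : G.Walk u v, IsInducedPath G p ∧ w ∈ p.support}

/-- Monophonically convex vertex sets. -/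
def IsMConvex (G : SimpleGraph V) (A : Set V) : Prop :=
  ∀ u ∈ A, ∀ v ∈ A, mInterval G u v ⊆ A

/-- The monophonic convex hull: the intersection of all m-convex sets containing `S`. -/
def mHull (G : SimpleGraph V) (S : Set V) : Set V :=
  ⋂₀ {A | IsMConvex G A ∧ S ⊆ A}

/-- The (monophonic) hull number: the least size of a set whose m-hull is the vertex set. -/
noncomputable def hullNumber (G : SimpleGraph V) : ℕ :=
  sInf {k | ∃ S : Finset V, mHull G (S : Set V) = Set.univ ∧ S.card = k}

open Classical in
/-- The hypothesis space of all monophonic halfspaces: m-convex sets with m-convex complement. -/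
noncomputable def mHalfspaces [Fintype V] (G : SimpleGraph V) : Finset (Finset V) :=
  Finset.univ.filter fun H : Finset V => IsMConvex G (H : Set V) ∧ IsMConvex G (H : Set V)ᶜ

end Convexity

/-! ## Active learning: adaptive query strategies and query complexity -/

/-- A deterministic adaptive query algorithm on the vertex set `V`: it either outputs a set, or
queries the label of a vertex and continues according to the answer. -/
inductive Strategy (V : Type*) where
  | output (S : Finset V) : Strategy V
  | query (x : V) (ifMem ifNotMem : Strategy V) : Strategy V

namespace Strategy

variable {V : Type*}

open Classical in
/-- The set that is output when the labels are given by `H`. -/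
noncomputable def result (H : Finset V) : Strategy V → Finset V
  | output S => S
  | query x A B => if x ∈ H then A.result H else B.result H

open Classical in
/-- The number of queries that are made when the labels are given by `H`. -/
noncomputable def numQueries (H : Finset V) : Strategy V → ℕ
  | output _ => 0
  | query x A B => (if x ∈ H then A.numQueries H else B.numQueries H) + 1

/-- The algorithm exactly identifies every hypothesis of the space `ℋ`. -/
def Identifies (A : Strategy V) (ℋ : Finset (Finset V)) : Prop :=
  ∀ H ∈ ℋ, A.result H = H

/-- The query complexity of an algorithm: the maximum number of queries over `ℋ`. -/
noncomputable def queryComplexity (A : Strategy V) (ℋ : Finset (Finset V)) : ℕ :=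
  ℋ.sup fun H => A.numQueries H

end Strategy

/-- The query complexity of a hypothesis space: the minimum over all algorithms that exactly
identify every hypothesis. -/
noncomputable def queryComplexity {V : Type*} (ℋ : Finset (Finset V)) : ℕ :=
  sInf {k | ∃ A : Strategy V, A.Identifies ℋ ∧ A.queryComplexity ℋ = k}

/-- On a finite vertex set the minimum in `queryComplexity` is over a nonempty set (query every
vertex). -/
theorem exists_identifies {V : Type*} [Fintype V] (ℋ : Finset (Finset V)) :
    ∃ A : Strategy V, A.Identifies ℋ := by
  classical
  have key : ∀ l : List V, ∀ S : Finset V, ∃ A : Strategy V,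
      ∀ H : Finset V, A.result H = S ∪ H.filter (· ∈ l) := by
    intro l
    induction l with
    | nil => intro S; exact ⟨.output S, fun H => by simp [Strategy.result]⟩
    | cons x l ih =>
      intro S
      obtain ⟨A, hA⟩ := ih (insert x S)
      obtain ⟨B, hB⟩ := ih S
      refine ⟨.query x A B, fun H => ?_⟩
      by_cases hx : x ∈ H
      · simp only [Strategy.result, hx, if_true, hA]
        ext y
        by_cases hy : y = x
        · subst hy; simp [hx]
        · simp [hy]
      · simp only [Strategy.result, hx, if_false, hB]
        ext y
        by_cases hy : y = x
        · subst hy; simp [hx]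
        · simp [hy]
  obtain ⟨A, hA⟩ := key Finset.univ.toList ∅
  exact ⟨A, fun H _ => by simp [hA]⟩

/-! ## Running time: random-access machines with query instruction

A uniform machine model for active learning algorithms on graphs.  A machine has registers and a
random-access memory, all holding natural numbers.  It accesses the input graph on
`{0, …, n - 1}` through its adjacency matrix and the unknown halfspace through label queries.  The
only arithmetic operations are addition and truncated subtraction, so that running time under unit
cost is polynomially equivalent to Turing machine time. -/

/-- Structured programs.  Arguments named `i j k` are register indices. -/
inductive Prog where
  /-- do nothing -/
  | skip : Prog
  /-- `R[i] := c` -/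
  | const (i c : ℕ) : Prog
  /-- `R[i] := R[j] + R[k]` -/
  | add (i j k : ℕ) : Prog
  /-- `R[i] := R[j] - R[k]` (truncated) -/
  | sub (i j k : ℕ) : Prog
  /-- `R[i] := M[R[j]]` -/
  | load (i j : ℕ) : Prog
  /-- `M[R[i]] := R[j]` -/
  | store (i j : ℕ) : Prog
  /-- `R[i] := 1` if the vertices `R[j]` and `R[k]` are adjacent, else `R[i] := 0` -/
  | adj (i j k : ℕ) : Prog
  /-- query the label of vertex `R[j]`: `R[i] := 1` if `R[j]` is in the halfspace, else
  `R[i] := 0` -/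
  | query (i j : ℕ) : Prog
  /-- sequential composition -/
  | seq (P Q : Prog) : Prog
  /-- run `P` if `R[i] ≠ 0`, else run `Q` -/
  | ite (i : ℕ) (P Q : Prog) : Prog
  /-- repeat `P` as long as `R[i] ≠ 0` -/
  | while (i : ℕ) (P : Prog) : Prog

/-- Machine states. -/
structure State where
  /-- the registers -/
  reg : ℕ → ℕ
  /-- the random-access memory -/
  mem : ℕ → ℕ

/-- Assignment to a register. -/
def State.setReg (s : State) (i x : ℕ) : State :=
  { s with reg := Function.update s.reg i x }

/-- Assignment to a memory cell. -/
def State.setMem (s : State) (a x : ℕ) : State :=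
  { s with mem := Function.update s.mem a x }

/-- The initial state: register `0` holds the number `n` of vertices, all else is `0`. -/
def State.init (n : ℕ) : State where
  reg := fun i => if i = 0 then n else 0
  mem := fun _ => 0

open Classical in
/-- Entries of the adjacency matrix (`0` outside the range of vertices). -/
noncomputable def adjBit {n : ℕ} (G : SimpleGraph (Fin n)) (a b : ℕ) : ℕ :=
  if ∃ (ha : a < n) (hb : b < n), G.Adj ⟨a, ha⟩ ⟨b, hb⟩ then 1 else 0

open Classical in
/-- Answers to label queries (`0` outside the range of vertices). -/
noncomputable def labelBit {n : ℕ} (H : Finset (Fin n)) (a : ℕ) : ℕ :=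
  if ∃ ha : a < n, (⟨a, ha⟩ : Fin n) ∈ H then 1 else 0

/-- `Exec G H P s s' t q`: on the graph `G` with labels given by `H`, the program `P`, started in
state `s`, halts in state `s'` after `t` steps, of which `q` are label queries. -/
inductive Exec {n : ℕ} (G : SimpleGraph (Fin n)) (H : Finset (Fin n)) :
    Prog → State → State → ℕ → ℕ → Prop where
  | skip (s : State) : Exec G H .skip s s 1 0
  | const (s : State) (i c : ℕ) : Exec G H (.const i c) s (s.setReg i c) 1 0
  | add (s : State) (i j k : ℕ) :
      Exec G H (.add i j k) s (s.setReg i (s.reg j + s.reg k)) 1 0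
  | sub (s : State) (i j k : ℕ) :
      Exec G H (.sub i j k) s (s.setReg i (s.reg j - s.reg k)) 1 0
  | load (s : State) (i j : ℕ) :
      Exec G H (.load i j) s (s.setReg i (s.mem (s.reg j))) 1 0
  | store (s : State) (i j : ℕ) :
      Exec G H (.store i j) s (s.setMem (s.reg i) (s.reg j)) 1 0
  | adj (s : State) (i j k : ℕ) :
      Exec G H (.adj i j k) s (s.setReg i (adjBit G (s.reg j) (s.reg k))) 1 0
  | query (s : State) (i j : ℕ) :
      Exec G H (.query i j) s (s.setReg i (labelBit H (s.reg j))) 1 1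
  | seq {P Q : Prog} {s s' s'' : State} {t t' q q' : ℕ}
      (hP : Exec G H P s s' t q) (hQ : Exec G H Q s' s'' t' q') :
      Exec G H (.seq P Q) s s'' (t + t') (q + q')
  | iteTrue {i : ℕ} {P Q : Prog} {s s' : State} {t q : ℕ} (hi : s.reg i ≠ 0)
      (hP : Exec G H P s s' t q) : Exec G H (.ite i P Q) s s' (t + 1) q
  | iteFalse {i : ℕ} {P Q : Prog} {s s' : State} {t q : ℕ} (hi : s.reg i = 0)
      (hQ : Exec G H Q s s' t q) : Exec G H (.ite i P Q) s s' (t + 1) q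
  | whileTrue {i : ℕ} {P : Prog} {s s' s'' : State} {t t' q q' : ℕ} (hi : s.reg i ≠ 0)
      (hP : Exec G H P s s' t q) (hW : Exec G H (.while i P) s' s'' t' q') :
      Exec G H (.while i P) s s'' (t + t' + 1) (q + q')
  | whileFalse {i : ℕ} {P : Prog} {s : State} (hi : s.reg i = 0) :
      Exec G H (.while i P) s s 1 0

/-- `Outputs G H P S t q`: run on the graph `G` with labels given by `H`, the program `P` halts
after `t` steps, of which `q` are label queries, and outputs the vertex set `S`, namely the set of
all vertices `v` whose memory cell `M[v]` is nonzero at the end. -/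
def Outputs {n : ℕ} (G : SimpleGraph (Fin n)) (H : Finset (Fin n)) (P : Prog)
    (S : Finset (Fin n)) (t q : ℕ) : Prop :=
  ∃ s : State, Exec G H P (State.init n) s t q ∧ ∀ v : Fin n, v ∈ S ↔ s.mem v ≠ 0

end MonophonicLearning

/-!
# Learning monophonic halfspaces with few queries

In a connected graph the m-halfspaces are the sets `H` such that the inner boundaries of `H` and of
its complement are cliques (`isMConvex_and_compl_iff`).  The learner works in three stages.

*A positive and a negative vertex.*  A set whose m-hull is everything meets each halfspace other
than `∅` and `V`.  A set with this property that is minimal under inclusion is at most twice as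
large as a smallest one (`card_le_two_mul_of_minimal`): otherwise three halfspaces that witness
minimality share a vertex, pairwise cross, hence have the same cut vertices, and their majority is
a halfspace that the set misses.  A minimal set is found by greedy removal.  Its labels and that
of one more vertex have both values unless the halfspace is `∅` or `V`.

*A cut edge.*  Binary search along shortest paths between a positive and a negative vertex takes
`⌈log₂ diam⌉` queries.

*The common neighbours of the cut edge `ab`.*  A halfspace that cuts `ab` is determined by its
labels on the common neighbours of `a` and `b` (`Separating.eq_of_agree`), of which there are at
most `2 ω`, and the halfspaces that cut `ab` are closed under majority, since the conditions on them
form a 2-SAT instance.  The number of private neighbours of `a` adjacent to `z` minus the number of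
those of `b` is the *key* of `z`.  Keys decrease along the cut: positive vertices have keys at least
as large as negative ones (`Separating.key_le`).  Binary search by keys, with `⌈log₂ (2 ω + 1)⌉`
queries, leads to a state in which every key has a vertex with a determined label.  Then the
undetermined vertices have at most two keys.  If both labels occur on one key, then changes of the
labels on this key are not restricted by private neighbours (`Separating.flip_mem`), so that
halfspaces that differ only there are closed under sums of three (`Separating.xor_mem`).  Together
with majority this shows that pairwise inequivalent undetermined vertices with one key are
shattered, up to one of them.  Hence there are at most `2 d + 2` such vertices in total, and every
further query removes one (`GoodQuery.potential_insert_lt`).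

All this needs a test whether given labels, of which one edge has both, extend to a halfspace.  As
for 2-SAT, propagation of labels with limited backtracking is such a test (`Extends.decideVertex`).

For the running time the algorithm is written in a small language of programs whose loops run over
all vertices.  A program compiles to a random-access machine that halts in polynomial time
(`Code.exec_compile`), and it is also a query strategy (`Code.strategy_spec`), so that one analysis
(`run_learn`) yields both bounds.  The arrays of the learning program are used as follows: `0` for
the output, `1` and `2` for the input of the consistency test, `3` to `6` for its labels, `7` and
`8` for the known positive and negative vertices, `9` for the minimal set, `10` to `12` for
distances and keys, `13` and `14` for undetermined vertices.  Variables `0` to `6` hold results,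
variables from `10` on are counters of loops, and those from `20` on are bound in terms.
-/

namespace MonophonicLearning

/-! ### Halfspaces as cuts with clique boundaries -/

section Halfspaces

variable {V : Type*} {G : SimpleGraph V}

/-- The inner boundary of `H` is a clique. -/
def CliqueBoundary (G : SimpleGraph V) (H : Set V) : Prop :=
  ∀ x ∈ H, ∀ y ∈ H, ∀ x' ∉ H, ∀ y' ∉ H, G.Adj x x' → G.Adj y y' → x ≠ y → G.Adj x y

/-- Both sides of the cut `(H, Hᶜ)` have a clique as inner boundary.  In a connected graph these
are exactly the m-halfspaces, see `isMConvex_and_compl_iff`. -/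
def IsHalfspace (G : SimpleGraph V) (H : Set V) : Prop :=
  CliqueBoundary G H ∧ CliqueBoundary G Hᶜ

theorem IsHalfspace.compl {H : Set V} (h : IsHalfspace G H) : IsHalfspace G Hᶜ :=
  ⟨h.2, by rw [compl_compl]; exact h.1⟩

/-- A shortest walk inside the support of `p` is an induced path. -/
theorem exists_isInducedPath {u v : V} (p : G.Walk u v) :
    ∃ q : G.Walk u v, IsInducedPath G q ∧ ∀ x ∈ q.support, x ∈ p.support := by
  classical
  obtain ⟨q, hq, hmin⟩ := exists_minimal_of_wellFoundedLT
    (fun l : ℕ => ∃ q : G.Walk u v, q.length = l ∧ ∀ x ∈ q.support, x ∈ p.support)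
    ⟨_, p, rfl, fun x hx => hx⟩
  obtain ⟨q, rfl, hqs⟩ := hq
  have hle : ∀ r : G.Walk u v, (∀ x ∈ r.support, x ∈ q.support) → q.length ≤ r.length := by
    intro r hr
    by_contra hlt
    have := hmin ⟨r, rfl, fun x hx => hqs x (hr x hx)⟩ (by omega)
    omega
  have htk : ∀ i, ∀ x ∈ (q.take i).support, x ∈ q.support := fun i x hx =>
    (q.isSubwalk_take i).support_subset hx
  have hdr : ∀ i, ∀ x ∈ (q.drop i).support, x ∈ q.support := fun i x hx =>
    (q.isSubwalk_drop i).support_subset hx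
  have hne : ∀ i j, i < j → j ≤ q.length → q.getVert i ≠ q.getVert j := by
    intro i j hij hj he
    have := hle ((q.take i).append ((q.drop j).copy he.symm rfl)) (by
      intro x hx
      rw [SimpleGraph.Walk.mem_support_append_iff, SimpleGraph.Walk.support_copy] at hx
      exact hx.elim (htk _ _) (hdr _ _))
    simp at this
    omega
  have hadj : ∀ i j, i < j → j ≤ q.length → G.Adj (q.getVert i) (q.getVert j) →
      s(q.getVert i, q.getVert j) ∈ q.edges := by
    intro i j hij hj ha
    have := hle ((q.take i).append (SimpleGraph.Walk.cons ha (q.drop j))) (by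
      intro x hx
      rw [SimpleGraph.Walk.mem_support_append_iff, SimpleGraph.Walk.support_cons,
        List.mem_cons] at hx
      rcases hx with hx | rfl | hx
      exacts [htk _ _ hx, q.getVert_mem_support i, hdr _ _ hx])
    simp at this
    obtain rfl : j = i + 1 := by omega
    rw [SimpleGraph.Walk.mk_mem_edges_iff_exists]
    exact ⟨i, by omega, by simp⟩
  refine ⟨q, ⟨?_, ?_⟩, hqs⟩
  · rw [← SimpleGraph.Walk.IsPath.getVert_injOn_iff]
    intro i hi j hj he
    rcases lt_trichotomy i j with h | h | h
    exacts [absurd he (hne _ _ h hj), h, absurd he.symm (hne _ _ h hi)]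
  · intro x hx y hy ha
    rw [SimpleGraph.Walk.mem_support_iff_exists_getVert] at hx hy
    obtain ⟨i, rfl, hi⟩ := hx
    obtain ⟨j, rfl, hj⟩ := hy
    rcases lt_trichotomy i j with h | h | h
    · exact hadj _ _ h hj ha
    · subst h; exact absurd ha (G.irrefl)
    · rw [Sym2.eq_swap]; exact hadj _ _ h hi ha.symm

/-- A path that leaves `H` and returns crosses the boundary twice, and the edge between the two
boundary vertices is a chord. -/
theorem CliqueBoundary.isMConvex {H : Set V} (h : CliqueBoundary G H) : IsMConvex G H := by
  rintro u hu v hv w ⟨p, ⟨hp, hind⟩, hw⟩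
  by_contra hwH
  rw [SimpleGraph.Walk.mem_support_iff_exists_getVert] at hw
  obtain ⟨k, rfl, hk⟩ := hw
  -- the last vertex of `H` before position `k` and the first one after it
  have hleft : ∃ i < k, p.getVert i ∈ H ∧ p.getVert (i + 1) ∉ H := by
    by_contra! hc
    have : ∀ i ≤ k, p.getVert i ∈ H := by
      intro i
      induction i with
      | zero => intro _; simpa using hu
      | succ i ih => intro hi; exact hc i (by omega) (ih (by omega))
    exact hwH (this k le_rfl)
  have hright : ∃ j, k ≤ j ∧ j < p.length ∧ p.getVert j ∉ H ∧ p.getVert (j + 1) ∈ H := by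
    by_contra! hc
    have : ∀ i, k + i ≤ p.length → p.getVert (k + i) ∉ H := by
      intro i
      induction i with
      | zero => intro _; simpa using hwH
      | succ i ih => intro hi; exact hc (k + i) (by omega) (by omega) (ih (by omega))
    have h2 := this (p.length - k) (by omega)
    rw [show k + (p.length - k) = p.length by omega] at h2
    exact h2 (by simpa using hv)
  obtain ⟨i, hik, hi, hi'⟩ := hleft
  obtain ⟨j, hkj, hjl, hj', hj⟩ := hright
  have hinj := hp.getVert_injOn
  have hne : p.getVert i ≠ p.getVert (j + 1) := by
    intro he
    have : i = j + 1 := hinj (show i ≤ p.length by omega) (show j + 1 ≤ p.length by omega) he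
    omega
  have hadj := h _ hi _ hj _ hi' _ hj' (p.adj_getVert_succ (by omega))
    (p.adj_getVert_succ hjl).symm hne
  have hmem := hind _ (p.getVert_mem_support i) _ (p.getVert_mem_support (j + 1)) hadj
  rw [SimpleGraph.Walk.mk_mem_edges_iff_exists] at hmem
  obtain ⟨m, hm, he⟩ := hmem
  rw [Sym2.eq_iff] at he
  rcases he with ⟨h1, h2⟩ | ⟨h1, h2⟩
  · have e1 : m = i := hinj (show m ≤ p.length by omega) (show i ≤ p.length by omega) (by simp_all)
    have e2 : m + 1 = j + 1 := hinj (show m + 1 ≤ p.length by omega)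
      (show j + 1 ≤ p.length by omega) (by simp_all)
    omega
  · have e1 : m = j + 1 := hinj (show m ≤ p.length by omega)
      (show j + 1 ≤ p.length by omega) (by simp_all)
    have e2 : m + 1 = i := hinj (show m + 1 ≤ p.length by omega)
      (show i ≤ p.length by omega) (by simp_all)
    omega

theorem IsMConvex.exists_walk (hG : G.Connected) {A : Set V} (hA : IsMConvex G A) {u v : V}
    (hu : u ∈ A) (hv : v ∈ A) : ∃ p : G.Walk u v, ∀ x ∈ p.support, x ∈ A := by
  obtain ⟨p⟩ := hG.preconnected u v
  obtain ⟨q, hq, -⟩ := exists_isInducedPath p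
  exact ⟨q, fun x hx => hA u hu v hv ⟨q, hq, hx⟩⟩

/-- Two nonadjacent boundary vertices of `H` would be joined by an induced path through `Hᶜ`. -/
theorem IsMConvex.cliqueBoundary (hG : G.Connected) {H : Set V} (h : IsMConvex G H)
    (hc : IsMConvex G Hᶜ) : CliqueBoundary G H := by
  intro x hx y hy x' hx' y' hy' hxx' hyy' hne
  by_contra hadj
  obtain ⟨p, hp⟩ := hc.exists_walk hG hx' hy'
  -- an induced path from `x` to `y` through the complement
  obtain ⟨q, hq, hqs⟩ := exists_isInducedPath
    (SimpleGraph.Walk.cons hxx' (p.append (SimpleGraph.Walk.cons hyy'.symm .nil)))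
  have hsub : ∀ z ∈ q.support, z = x ∨ z = y := by
    intro z hz
    have h1 := h x hx y hy ⟨q, hq, hz⟩
    have h2 := hqs z hz
    simp only [SimpleGraph.Walk.support_cons, List.mem_cons,
      SimpleGraph.Walk.mem_support_append_iff, SimpleGraph.Walk.support_nil,
      List.not_mem_nil, or_false] at h2
    rcases h2 with h2 | h2 | h2 | h2
    · exact .inl h2
    · exact absurd h1 (hp z h2)
    · exact absurd h1 (h2 ▸ hy')
    · exact .inr h2
  obtain ⟨d, hd, h1, h2⟩ := q.exists_boundary_dart {x} rfl (by simpa using hne.symm)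
  rcases hsub _ (q.dart_snd_mem_support_of_mem_darts hd) with h3 | h3
  · exact h2 h3
  · have := d.adj
    rw [h3, show d.fst = x from h1] at this
    exact hadj this

theorem isMConvex_and_compl_iff (hG : G.Connected) {H : Set V} :
    IsMConvex G H ∧ IsMConvex G Hᶜ ↔ IsHalfspace G H :=
  ⟨fun h => ⟨h.1.cliqueBoundary hG h.2, h.2.cliqueBoundary hG (by rw [compl_compl]; exact h.1)⟩,
    fun h => ⟨h.1.isMConvex, h.2.isMConvex⟩⟩

theorem mem_mHalfspaces_iff [Fintype V] (hG : G.Connected) {H : Finset V} :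
    H ∈ mHalfspaces G ↔ IsHalfspace G (H : Set V) := by
  simp [mHalfspaces, isMConvex_and_compl_iff hG]

theorem exists_adj_mem_notMem (hG : G.Connected) {H : Set V} {u v : V} (hu : u ∈ H) (hv : v ∉ H) :
    ∃ a b, G.Adj a b ∧ a ∈ H ∧ b ∉ H := by
  obtain ⟨p⟩ := hG.preconnected u v
  obtain ⟨d, -, h1, h2⟩ := p.exists_boundary_dart H hu hv
  exact ⟨_, _, d.adj, h1, h2⟩

/-- `S` meets every halfspace other than `∅` and the whole vertex set. -/
def HitsHalfspaces (G : SimpleGraph V) (S : Set V) : Prop :=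
  ∀ H : Set V, IsHalfspace G H → H.Nonempty → H ≠ Set.univ → (S ∩ H).Nonempty

theorem hitsHalfspaces_of_mHull_eq_univ {S : Set V} (h : mHull G S = Set.univ) :
    HitsHalfspaces G S := by
  intro H hH hne hnu
  by_contra hc
  rw [Set.not_nonempty_iff_eq_empty] at hc
  have : mHull G S ⊆ Hᶜ := Set.sInter_subset_of_mem
    ⟨hH.2.isMConvex, fun x hx hxH => (Set.eq_empty_iff_forall_notMem.1 hc x) ⟨hx, hxH⟩⟩
  rw [h, Set.univ_subset_iff, Set.compl_univ_iff] at this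
  exact hne.ne_empty this

theorem exists_hitsHalfspaces_card_eq_hullNumber [Fintype V] (G : SimpleGraph V) :
    ∃ S : Finset V, HitsHalfspaces G (S : Set V) ∧ S.card = hullNumber G := by
  have hne : {k | ∃ S : Finset V, mHull G (S : Set V) = Set.univ ∧ S.card = k}.Nonempty := by
    refine ⟨_, Finset.univ, ?_, rfl⟩
    rw [Set.eq_univ_iff_forall]
    rintro x A ⟨-, hA⟩
    exact hA (by simp)
  obtain ⟨S, hS, hc⟩ := Nat.sInf_mem hne
  exact ⟨S, hitsHalfspaces_of_mHull_eq_univ hS, hc⟩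

theorem one_le_hullNumber [Fintype V] [Nonempty V] (G : SimpleGraph V) : 1 ≤ hullNumber G := by
  have hne : {k | ∃ S : Finset V, mHull G (S : Set V) = Set.univ ∧ S.card = k}.Nonempty := by
    refine ⟨_, Finset.univ, ?_, rfl⟩
    rw [Set.eq_univ_iff_forall]
    rintro x A ⟨-, hA⟩
    exact hA (by simp)
  obtain ⟨S, hS, hc⟩ := Nat.sInf_mem hne
  rw [hullNumber, ← hc, Nat.one_le_iff_ne_zero]
  intro h0
  rw [Finset.card_eq_zero] at h0
  subst h0
  have : mHull G (∅ : Set V) ⊆ ∅ := Set.sInter_subset_of_mem ⟨by simp [IsMConvex], by simp⟩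
  rw [Finset.coe_empty] at hS
  rw [hS] at this
  obtain ⟨x⟩ := ‹Nonempty V›
  exact this (Set.mem_univ x)

/-! ### Minimal sets that meet all halfspaces -/

/-- The vertices that are incident with an edge across the cut `(H, Hᶜ)`. -/
def cutVertices (G : SimpleGraph V) (H : Set V) : Set V :=
  {x | ∃ y, G.Adj x y ∧ (x ∈ H ↔ y ∉ H)}

theorem cutVertices_compl (H : Set V) : cutVertices G Hᶜ = cutVertices G H := by
  ext x
  simp only [cutVertices, Set.mem_compl_iff, Set.mem_ofPred_eq]
  exact exists_congr fun y => and_congr_right fun _ => by tauto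

theorem IsHalfspace.adj_of_mem_cutVertices {H : Set V} (h : IsHalfspace G H) {x y : V}
    (hx : x ∈ cutVertices G H) (hy : y ∈ cutVertices G H) (hxy : x ∈ H ↔ y ∈ H) (hne : x ≠ y) :
    G.Adj x y := by
  obtain ⟨x', hxa, hxx⟩ := hx
  obtain ⟨y', hya, hyy⟩ := hy
  by_cases hxH : x ∈ H
  · exact h.1 x hxH y (hxy.1 hxH) x' (hxx.1 hxH) y' (hyy.1 (hxy.1 hxH)) hxa hya hne
  · have hyH : y ∉ H := fun h => hxH (hxy.2 h)
    exact h.2 x hxH y hyH x' (by simpa using (not_congr hxx).1 hxH)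
      y' (by simpa using (not_congr hyy).1 hyH) hxa hya hne

/-- The four quadrants of `H₁` and `H₂` are nonempty. -/
def Crossing (H₁ H₂ : Set V) : Prop :=
  (H₁ ∩ H₂).Nonempty ∧ (H₁ \ H₂).Nonempty ∧ (H₂ \ H₁).Nonempty ∧ (H₁ ∪ H₂)ᶜ.Nonempty

theorem Crossing.symm {H₁ H₂ : Set V} (h : Crossing H₁ H₂) : Crossing H₂ H₁ :=
  ⟨by rw [Set.inter_comm]; exact h.1, h.2.2.1, h.2.1, by rw [Set.union_comm]; exact h.2.2.2⟩

theorem Crossing.compl_left {H₁ H₂ : Set V} (h : Crossing H₁ H₂) : Crossing H₁ᶜ H₂ := by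
  obtain ⟨⟨a, ha⟩, ⟨b, hb⟩, ⟨c, hc⟩, ⟨d, hd⟩⟩ := h
  simp only [Set.mem_compl_iff, Set.mem_union, not_or] at hd
  exact ⟨⟨c, hc.2, hc.1⟩, ⟨d, hd⟩, ⟨a, ha.2, by simpa using ha.1⟩, ⟨b, by simpa using hb⟩⟩

theorem Crossing.compl_right {H₁ H₂ : Set V} (h : Crossing H₁ H₂) : Crossing H₁ H₂ᶜ :=
  h.symm.compl_left.symm

/-- Crossing halfspaces have the same cut vertices: a cut vertex `x` of `H₁` in `H₁ \ H₂` is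
adjacent to every cut vertex of `H₁` in `H₁ ∩ H₂`, and such a vertex exists because `H₂` is
connected. -/
theorem Crossing.cutVertices_subset (hG : G.Connected) {H₁ H₂ : Set V} (h₁ : IsHalfspace G H₁)
    (h₂ : IsHalfspace G H₂) (h : Crossing H₁ H₂) : cutVertices G H₁ ⊆ cutVertices G H₂ := by
  have key : ∀ {H₁ H₂ : Set V}, IsHalfspace G H₁ → IsHalfspace G H₂ → Crossing H₁ H₂ →
      ∀ x ∈ cutVertices G H₁, x ∈ H₁ → x ∉ H₂ → x ∈ cutVertices G H₂ := by
    intro H₁ H₂ h₁ h₂ h x hx hx1 hx2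
    obtain ⟨⟨b, hb1, hb2⟩, -, ⟨c, hc2, hc1⟩, -⟩ := h
    obtain ⟨p, hp⟩ := h₂.1.isMConvex.exists_walk hG hb2 hc2
    obtain ⟨d, hd, hd1, hd2⟩ := p.exists_boundary_dart H₁ hb1 hc1
    have hdH := hp _ (p.dart_fst_mem_support_of_mem_darts hd)
    have hadj : G.Adj x d.fst := h₁.adj_of_mem_cutVertices hx
      ⟨d.snd, d.adj, iff_of_true hd1 hd2⟩ (iff_of_true hx1 hd1) (by rintro rfl; exact hx2 hdH)
    exact ⟨d.fst, hadj, iff_of_false hx2 (not_not.2 hdH)⟩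
  intro x hx
  by_cases hx1 : x ∈ H₁ <;> by_cases hx2 : x ∈ H₂
  · rw [← cutVertices_compl]
    exact key h₁ h₂.compl h.compl_right x hx hx1 (by simpa using hx2)
  · exact key h₁ h₂ h x hx hx1 hx2
  · rw [← cutVertices_compl]
    rw [← cutVertices_compl] at hx
    exact key h₁.compl h₂.compl h.compl_left.compl_right x hx hx1 (by simpa using hx2)
  · rw [← cutVertices_compl] at hx
    exact key h₁.compl h₂ h.compl_left x hx hx1 hx2

/-- The vertices that belong to at least two of three sets. -/
def maj (H₁ H₂ H₃ : Set V) : Set V :=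
  {x | x ∈ H₁ ∧ x ∈ H₂ ∨ x ∈ H₂ ∧ x ∈ H₃ ∨ x ∈ H₁ ∧ x ∈ H₃}

theorem maj_compl (H₁ H₂ H₃ : Set V) : maj H₁ᶜ H₂ᶜ H₃ᶜ = (maj H₁ H₂ H₃)ᶜ := by
  ext x
  simp only [maj, Set.mem_compl_iff, Set.mem_ofPred_eq]
  tauto

theorem isHalfspace_maj_of_cutVertices_eq {H₁ H₂ H₃ : Set V} (h₁ : IsHalfspace G H₁)
    (h₂ : IsHalfspace G H₂) (h₃ : IsHalfspace G H₃)
    (h₁₂ : cutVertices G H₁ = cutVertices G H₂) (h₁₃ : cutVertices G H₁ = cutVertices G H₃) :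
    IsHalfspace G (maj H₁ H₂ H₃) := by
  have key : ∀ {H₁ H₂ H₃ : Set V}, IsHalfspace G H₁ → IsHalfspace G H₂ → IsHalfspace G H₃ →
      cutVertices G H₁ = cutVertices G H₂ → cutVertices G H₁ = cutVertices G H₃ →
      CliqueBoundary G (maj H₁ H₂ H₃) := by
    intro H₁ H₂ H₃ h₁ h₂ h₃ h₁₂ h₁₃ x hx y hy x' hx' y' hy' hxx' hyy' hne
    have hcut : ∀ x ∈ maj H₁ H₂ H₃, ∀ x' ∉ maj H₁ H₂ H₃, G.Adj x x' → x ∈ cutVertices G H₁ := by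
      intro x hx x' hx' hxx'
      have : x ∈ H₁ ∧ x' ∉ H₁ ∨ x ∈ H₂ ∧ x' ∉ H₂ ∨ x ∈ H₃ ∧ x' ∉ H₃ := by
        simp only [maj, Set.mem_ofPred_eq] at hx hx'; tauto
      rcases this with h | h | h
      · exact ⟨x', hxx', iff_of_true h.1 h.2⟩
      · rw [h₁₂]; exact ⟨x', hxx', iff_of_true h.1 h.2⟩
      · rw [h₁₃]; exact ⟨x', hxx', iff_of_true h.1 h.2⟩
    have hxc := hcut x hx x' hx' hxx'
    have hyc := hcut y hy y' hy' hyy'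
    -- two sets of at least two indices out of three share an index
    have : x ∈ H₁ ∧ y ∈ H₁ ∨ x ∈ H₂ ∧ y ∈ H₂ ∨ x ∈ H₃ ∧ y ∈ H₃ := by
      simp only [maj, Set.mem_ofPred_eq] at hx hy; tauto
    rcases this with h | h | h
    · exact h₁.adj_of_mem_cutVertices hxc hyc (iff_of_true h.1 h.2) hne
    · rw [h₁₂] at hxc hyc
      exact h₂.adj_of_mem_cutVertices hxc hyc (iff_of_true h.1 h.2) hne
    · rw [h₁₃] at hxc hyc
      exact h₃.adj_of_mem_cutVertices hxc hyc (iff_of_true h.1 h.2) hne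
  refine ⟨key h₁ h₂ h₃ h₁₂ h₁₃, ?_⟩
  rw [← maj_compl]
  exact key h₁.compl h₂.compl h₃.compl (by simp only [cutVertices_compl, h₁₂])
    (by simp only [cutVertices_compl, h₁₃])

/-- An inclusion-minimal set that meets all halfspaces is at most twice as large as any other such
set.  For every `q ∈ Q` there is a halfspace `H q` with `H q ∩ Q = {q}`; if three of them shared a
vertex `s`, their majority would be a halfspace that contains `s` but misses `Q`. -/
theorem card_le_two_mul_of_minimal (hG : G.Connected) {Q S : Finset V}
    (hQ : HitsHalfspaces G (Q : Set V)) (hmin : ∀ q ∈ Q, ¬ HitsHalfspaces G ((Q : Set V) \ {q}))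
    (hS : HitsHalfspaces G (S : Set V)) : Q.card ≤ 2 * S.card := by
  classical
  have hH : ∀ q, ∃ H : Set V, q ∈ Q → IsHalfspace G H ∧ H ≠ Set.univ ∧ q ∈ H ∧
      ∀ x ∈ Q, x ∈ H → x = q := by
    intro q
    by_cases hq : q ∈ Q
    · have := hmin q hq
      unfold HitsHalfspaces at this
      push Not at this
      obtain ⟨H, hH, hne, hnu, hemp⟩ := this
      have huniq : ∀ x ∈ Q, x ∈ H → x = q := by
        intro x hx hxH
        by_contra hxq
        exact Set.eq_empty_iff_forall_notMem.1 hemp x ⟨⟨hx, hxq⟩, hxH⟩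
      obtain ⟨x, hxQ, hxH⟩ := hQ H hH hne hnu
      exact ⟨H, fun _ => ⟨hH, hnu, huniq x hxQ hxH ▸ hxH, huniq⟩⟩
    · exact ⟨∅, fun h => absurd h hq⟩
  choose H hH using hH
  have hs : ∀ q, ∃ s, q ∈ Q → s ∈ S ∧ s ∈ H q := by
    intro q
    by_cases hq : q ∈ Q
    · obtain ⟨h1, h2, h3, -⟩ := hH q hq
      obtain ⟨s, hs1, hs2⟩ := hS (H q) h1 ⟨q, h3⟩ h2
      exact ⟨s, fun _ => ⟨hs1, hs2⟩⟩
    · exact ⟨q, fun h => absurd h hq⟩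
  choose s hs using hs
  refine Finset.card_le_mul_card_image_of_maps_to (f := s) (fun q hq => (hs q hq).1) 2 ?_
  intro t _
  by_contra! hlt
  obtain ⟨p, q, r, hp, hq, hr, hpq, hpr, hqr⟩ := Finset.two_lt_card_iff.1 hlt
  simp only [Finset.mem_filter] at hp hq hr
  have hcross : ∀ a b c, a ∈ Q → b ∈ Q → c ∈ Q → s a = t → s b = t → a ≠ b → a ≠ c → b ≠ c →
      Crossing (H a) (H b) := by
    intro a b c ha hb hc hsa hsb hab hac hbc
    refine ⟨⟨t, hsa ▸ (hs a ha).2, hsb ▸ (hs b hb).2⟩,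
      ⟨a, (hH a ha).2.2.1, fun h => hab ((hH b hb).2.2.2 a ha h)⟩,
      ⟨b, (hH b hb).2.2.1, fun h => hab ((hH a ha).2.2.2 b hb h).symm⟩, ⟨c, ?_⟩⟩
    rintro (h | h)
    exacts [hac ((hH a ha).2.2.2 c hc h).symm, hbc ((hH b hb).2.2.2 c hc h).symm]
  have hcut : ∀ a b c, a ∈ Q → b ∈ Q → c ∈ Q → s a = t → s b = t → a ≠ b → a ≠ c → b ≠ c →
      cutVertices G (H a) = cutVertices G (H b) := by
    intro a b c ha hb hc hsa hsb hab hac hbc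
    have := hcross a b c ha hb hc hsa hsb hab hac hbc
    exact (this.cutVertices_subset hG (hH a ha).1 (hH b hb).1).antisymm
      (this.symm.cutVertices_subset hG (hH b hb).1 (hH a ha).1)
  have hM := isHalfspace_maj_of_cutVertices_eq (hH p hp.1).1 (hH q hq.1).1 (hH r hr.1).1
    (hcut p q r hp.1 hq.1 hr.1 hp.2 hq.2 hpq hpr hqr)
    (hcut p r q hp.1 hr.1 hq.1 hp.2 hr.2 hpr hpq hqr.symm)
  have hmiss : ∀ x ∈ Q, x ∉ maj (H p) (H q) (H r) := by
    intro x hx hxm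
    have h1 := (hH p hp.1).2.2.2 x hx
    have h2 := (hH q hq.1).2.2.2 x hx
    have h3 := (hH r hr.1).2.2.2 x hx
    rcases hxm with h | h | h
    · exact hpq ((h1 h.1).symm.trans (h2 h.2))
    · exact hqr ((h2 h.1).symm.trans (h3 h.2))
    · exact hpr ((h1 h.1).symm.trans (h3 h.2))
  obtain ⟨x, hxQ, hxM⟩ := hQ _ hM
    ⟨t, .inl ⟨hp.2 ▸ (hs p hp.1).2, hq.2 ▸ (hs q hq.1).2⟩⟩
    (fun h => hmiss p hp.1 (h ▸ Set.mem_univ p))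
  exact hmiss x hxQ hxM

end Halfspaces

section CutEdge

variable {V : Type*} {G : SimpleGraph V} {a b : V}

/-! ### Halfspaces that cut a given edge -/

/-- `H` is a halfspace that contains `a` but not `b`. -/
def Separating (G : SimpleGraph V) (a b : V) (H : Set V) : Prop :=
  IsHalfspace G H ∧ a ∈ H ∧ b ∉ H

theorem Separating.compl {H : Set V} (h : Separating G a b H) : Separating G b a Hᶜ :=
  ⟨h.1.compl, h.2.2, not_not.2 h.2.1⟩

theorem Separating.mem_of_adj {H : Set V} (h : Separating G a b H) (hab : G.Adj a b) {u : V}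
    (hua : G.Adj u a) (hub : ¬ G.Adj u b) (hne : u ≠ b) : u ∈ H := by
  by_contra hu
  exact hub (h.1.2 u hu b h.2.2 a (not_not.2 h.2.1) a (not_not.2 h.2.1) hua hab.symm hne)

theorem Separating.adj_left {H : Set V} (h : Separating G a b H) (hab : G.Adj a b) {x x' : V}
    (hx : x ∈ H) (hx' : x' ∉ H) (hadj : G.Adj x x') (hne : x ≠ a) : G.Adj x a :=
  h.1.1 x hx a h.2.1 x' hx' b h.2.2 hadj hab hne

theorem Separating.adj_right {H : Set V} (h : Separating G a b H) (hab : G.Adj a b) {x x' : V}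
    (hx : x ∉ H) (hx' : x' ∈ H) (hadj : G.Adj x x') (hne : x ≠ b) : G.Adj x b :=
  (Separating.compl h).adj_left hab.symm (H := Hᶜ) hx (not_not.2 hx') hadj hne

/-- A vertex that is far from the edge `ab` has the label of its neighbours. -/
theorem Separating.mem_iff_of_far {H : Set V} (h : Separating G a b H) (hab : G.Adj a b)
    {w x : V} (hwa : ¬ G.Adj w a) (hwb : ¬ G.Adj w b) (hwa' : w ≠ a) (hwb' : w ≠ b)
    (hadj : G.Adj w x) : w ∈ H ↔ x ∈ H := by
  constructor
  · intro hw
    by_contra hx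
    exact hwa (h.adj_left hab hw hx hadj hwa')
  · intro hx
    by_contra hw
    exact hwb (h.adj_right hab hw hx hadj hwb')

/-- The common neighbours of `a` and `b`. -/
def commonNbrs (G : SimpleGraph V) (a b : V) : Set V := {x | G.Adj x a ∧ G.Adj x b}

theorem commonNbrs_comm : commonNbrs G a b = commonNbrs G b a := by
  ext x; exact and_comm

theorem Separating.adj_of_mem {H : Set V} (h : Separating G a b H) {x y : V}
    (hx : x ∈ commonNbrs G a b) (hy : y ∈ commonNbrs G a b) (hxy : x ∈ H ↔ y ∈ H) (hne : x ≠ y) :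
    G.Adj x y := by
  by_cases hxH : x ∈ H
  · exact h.1.1 x hxH y (hxy.1 hxH) b h.2.2 b h.2.2 hx.2 hy.2 hne
  · exact h.1.2 x hxH y (fun h => hxH (hxy.2 h)) a (not_not.2 h.2.1) a (not_not.2 h.2.1)
      hx.1 hy.1 hne

/-- A halfspace that cuts `ab` is determined by its labels on the common neighbours. -/
theorem Separating.eq_of_agree (hG : G.Connected) (hab : G.Adj a b) {H H' : Set V}
    (h : Separating G a b H) (h' : Separating G a b H')
    (hD : ∀ x ∈ commonNbrs G a b, x ∈ H ↔ x ∈ H') : H = H' := by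
  have hstep : ∀ x y, G.Adj x y → (x ∈ H ↔ x ∈ H') → (y ∈ H ↔ y ∈ H') := by
    intro x y hxy hx
    by_cases hya : y = a
    · subst hya; exact iff_of_true h.2.1 h'.2.1
    by_cases hyb : y = b
    · subst hyb; exact iff_of_false h.2.2 h'.2.2
    by_cases hna : G.Adj y a <;> by_cases hnb : G.Adj y b
    · exact hD y ⟨hna, hnb⟩
    · exact iff_of_true (h.mem_of_adj hab hna hnb hyb) (h'.mem_of_adj hab hna hnb hyb)
    · exact iff_of_false (h.compl.mem_of_adj hab.symm hnb hna hya)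
        (h'.compl.mem_of_adj hab.symm hnb hna hya)
    · rw [h.mem_iff_of_far hab hna hnb hya hyb hxy.symm,
        h'.mem_iff_of_far hab hna hnb hya hyb hxy.symm, hx]
  have hwalk : ∀ {u v : V}, G.Walk u v → (u ∈ H ↔ u ∈ H') → (v ∈ H ↔ v ∈ H') := by
    intro u v p
    induction p with
    | nil => exact id
    | cons hadj _ ih => exact fun hu => ih (hstep _ _ hadj hu)
  ext x
  obtain ⟨p⟩ := hG.preconnected a x
  exact hwalk p (iff_of_true h.2.1 h'.2.1)

/-- The halfspaces that cut `ab` are closed under majority: they are the solutions of a 2-SAT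
instance. -/
theorem Separating.maj_mem (hab : G.Adj a b) {H₁ H₂ H₃ : Set V} (h₁ : Separating G a b H₁)
    (h₂ : Separating G a b H₂) (h₃ : Separating G a b H₃) :
    Separating G a b (maj H₁ H₂ H₃) := by
  have key : ∀ {a b : V} {H₁ H₂ H₃ : Set V}, G.Adj a b → Separating G a b H₁ →
      Separating G a b H₂ → Separating G a b H₃ → CliqueBoundary G (maj H₁ H₂ H₃) := by
    intro a b H₁ H₂ H₃ hab h₁ h₂ h₃
    -- a cut vertex of the majority is adjacent to `a`
    have hcut : ∀ x ∈ maj H₁ H₂ H₃, ∀ x' ∉ maj H₁ H₂ H₃, G.Adj x x' → x ≠ a → G.Adj x a := by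
      intro x hx x' hx' hxx' hne
      have : x ∈ H₁ ∧ x' ∉ H₁ ∨ x ∈ H₂ ∧ x' ∉ H₂ ∨ x ∈ H₃ ∧ x' ∉ H₃ := by
        simp only [maj, Set.mem_ofPred_eq] at hx hx'; tauto
      rcases this with h | h | h
      exacts [h₁.adj_left hab h.1 h.2 hxx' hne, h₂.adj_left hab h.1 h.2 hxx' hne,
        h₃.adj_left hab h.1 h.2 hxx' hne]
    have hb : b ∉ maj H₁ H₂ H₃ := by
      simp [maj, h₁.2.2, h₂.2.2, h₃.2.2]
    -- the witness outside can be replaced by `b` unless the vertex is in all three sets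
    have hwit : ∀ x ∈ maj H₁ H₂ H₃, ∀ x' ∉ maj H₁ H₂ H₃, G.Adj x x' → x ≠ a →
        ∃ x'' ∉ maj H₁ H₂ H₃, G.Adj x x'' ∧ (x'' = b ∨ (x ∈ H₁ ∧ x ∈ H₂ ∧ x ∈ H₃)) := by
      intro x hx x' hx' hxx' hne
      by_cases hxb : G.Adj x b
      · exact ⟨b, hb, hxb, .inl rfl⟩
      · have hxa := hcut x hx x' hx' hxx' hne
        have hxb' : x ≠ b := by rintro rfl; exact hb hx
        exact ⟨x', hx', hxx', .inr ⟨h₁.mem_of_adj hab hxa hxb hxb',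
          h₂.mem_of_adj hab hxa hxb hxb', h₃.mem_of_adj hab hxa hxb hxb'⟩⟩
    intro x hx y hy x' hx' y' hy' hxx' hyy' hne
    by_cases hxa : x = a
    · subst hxa; exact (hcut y hy y' hy' hyy' hne.symm).symm
    by_cases hya : y = a
    · subst hya; exact hcut x hx x' hx' hxx' hne
    obtain ⟨x'', hx'', hxx'', hx3⟩ := hwit x hx x' hx' hxx' hxa
    obtain ⟨y'', hy'', hyy'', hy3⟩ := hwit y hy y' hy' hyy' hya
    have hb1 := h₁.2.2
    have hb2 := h₂.2.2
    have hb3 := h₃.2.2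
    have : x ∈ H₁ ∧ y ∈ H₁ ∧ x'' ∉ H₁ ∧ y'' ∉ H₁ ∨ x ∈ H₂ ∧ y ∈ H₂ ∧ x'' ∉ H₂ ∧ y'' ∉ H₂ ∨
        x ∈ H₃ ∧ y ∈ H₃ ∧ x'' ∉ H₃ ∧ y'' ∉ H₃ := by
      simp only [maj, Set.mem_ofPred_eq] at hx hy hx'' hy''
      clear hxx' hyy' hxx'' hyy'' hne hxa hya hcut hwit hb hx' hy'
      rcases hx3 with rfl | hx3 <;> rcases hy3 with rfl | hy3 <;> grind
    rcases this with h | h | h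
    exacts [h₁.1.1 x h.1 y h.2.1 _ h.2.2.1 _ h.2.2.2 hxx'' hyy'' hne,
      h₂.1.1 x h.1 y h.2.1 _ h.2.2.1 _ h.2.2.2 hxx'' hyy'' hne,
      h₃.1.1 x h.1 y h.2.1 _ h.2.2.1 _ h.2.2.2 hxx'' hyy'' hne]
  refine ⟨⟨key hab h₁ h₂ h₃, ?_⟩, .inl ⟨h₁.2.1, h₂.2.1⟩, ?_⟩
  · rw [← maj_compl]
    exact key hab.symm h₁.compl h₂.compl h₃.compl
  · simp [maj, h₁.2.2, h₂.2.2, h₃.2.2]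

/-- Two vertices have the same neighbours among the private neighbours of `a` and of `b`. -/
def SameProfile (G : SimpleGraph V) (a b x y : V) : Prop :=
  ∀ u, ((G.Adj u a ∧ ¬ G.Adj u b) ∨ (G.Adj u b ∧ ¬ G.Adj u a)) → (G.Adj u x ↔ G.Adj u y)

theorem SameProfile.swap {x y : V} (h : SameProfile G a b x y) : SameProfile G b a x y :=
  fun u hu => h u hu.symm

theorem SameProfile.symm {x y : V} (h : SameProfile G a b x y) : SameProfile G a b y x :=
  fun u hu => (h u hu).symm

theorem SameProfile.trans {x y z : V} (h : SameProfile G a b x y) (h' : SameProfile G a b y z) :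
    SameProfile G a b x z :=
  fun u hu => (h u hu).trans (h' u hu)

/-- A set that arises from a halfspace `H` cutting `ab` by changing labels of common neighbours
with one and the same profile, of which both labels occur in `H`, is again a halfspace as soon as
it satisfies the constraints that do not involve private neighbours. -/
theorem Separating.flip_mem (hab : G.Adj a b) {H T : Set V} (hH : Separating G a b H)
    {x₀ y₀ : V} (hx₀ : x₀ ∈ commonNbrs G a b) (hx₀H : x₀ ∈ H) (hy₀ : y₀ ∈ commonNbrs G a b)
    (hy₀H : y₀ ∉ H) (haT : a ∈ T) (hbT : b ∉ T)
    (hUa : ∀ u, G.Adj u a → ¬ G.Adj u b → u ≠ b → u ∈ T)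
    (hUb : ∀ u, G.Adj u b → ¬ G.Adj u a → u ≠ a → u ∉ T)
    (hfar : ∀ w x, ¬ G.Adj w a → ¬ G.Adj w b → w ≠ a → w ≠ b → G.Adj w x → (w ∈ T ↔ x ∈ T))
    (hD : ∀ x ∈ commonNbrs G a b, ∀ y ∈ commonNbrs G a b, (x ∈ T ↔ y ∈ T) → x ≠ y → G.Adj x y)
    (hflip : ∀ z ∈ commonNbrs G a b, ¬ (z ∈ T ↔ z ∈ H) →
      SameProfile G a b z x₀ ∧ SameProfile G a b z y₀) :
    Separating G a b T := by
  have key : ∀ {a b : V} {H T : Set V} {x₀ y₀ : V}, G.Adj a b → Separating G a b H →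
      x₀ ∈ commonNbrs G a b → x₀ ∈ H → y₀ ∈ commonNbrs G a b → y₀ ∉ H → a ∈ T → b ∉ T →
      (∀ u, G.Adj u a → ¬ G.Adj u b → u ≠ b → u ∈ T) →
      (∀ u, G.Adj u b → ¬ G.Adj u a → u ≠ a → u ∉ T) →
      (∀ w x, ¬ G.Adj w a → ¬ G.Adj w b → w ≠ a → w ≠ b → G.Adj w x → (w ∈ T ↔ x ∈ T)) →
      (∀ x ∈ commonNbrs G a b, ∀ y ∈ commonNbrs G a b, (x ∈ T ↔ y ∈ T) → x ≠ y → G.Adj x y) →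
      (∀ z ∈ commonNbrs G a b, ¬ (z ∈ T ↔ z ∈ H) →
        SameProfile G a b z x₀ ∧ SameProfile G a b z y₀) →
      CliqueBoundary G T := by
    intro a b H T x₀ y₀ hab hH hx₀ hx₀H hy₀ hy₀H haT hbT hUa hUb hfar hD hflip
    -- a cut vertex of `T` is `a`, a common neighbour, or a private neighbour of `a`
    have hcut : ∀ x ∈ T, ∀ x' ∉ T, G.Adj x x' → x ≠ a → G.Adj x a := by
      intro x hx x' hx' hxx' hne
      by_contra hxa
      by_cases hxb : G.Adj x b
      · exact hUb x hxb hxa hne hx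
      · exact hx' ((hfar x x' hxa hxb hne (by rintro rfl; exact hbT hx) hxx').1 hx)
    -- a private neighbour of `a` that is a cut vertex of `T` is a cut vertex of `H`
    have hpriv : ∀ x ∈ T, ∀ x' ∉ T, G.Adj x x' → G.Adj x a → ¬ G.Adj x b →
        x ∈ H ∧ ∃ x'' ∉ H, G.Adj x x'' := by
      intro x hx x' hx' hxx' hxa hxb
      have hxne : x ≠ b := by rintro rfl; exact hbT hx
      refine ⟨hH.mem_of_adj hab hxa hxb hxne, ?_⟩
      by_cases hx'H : x' ∈ H
      swap
      · exact ⟨x', hx'H, hxx'⟩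
      by_cases hx'D : x' ∈ commonNbrs G a b
      · refine ⟨y₀, hy₀H, ?_⟩
        exact ((hflip x' hx'D (by tauto)).2 x (.inl ⟨hxa, hxb⟩)).1 hxx'
      · exfalso
        have hx'a : x' ≠ a := by rintro rfl; exact hx' haT
        have hx'b : x' ≠ b := by rintro rfl; exact hH.2.2 hx'H
        by_cases h1 : G.Adj x' a <;> by_cases h2 : G.Adj x' b
        · exact hx'D ⟨h1, h2⟩
        · exact hx' (hUa x' h1 h2 hx'b)
        · exact (hH.compl.mem_of_adj hab.symm h2 h1 hx'a) hx'H
        · exact hx' ((hfar x' x h1 h2 hx'a hx'b hxx'.symm).2 hx)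
    have hmix : ∀ x ∈ T, ∀ x' ∉ T, G.Adj x x' → G.Adj x a → ¬ G.Adj x b →
        ∀ y ∈ T, G.Adj y a → G.Adj y b → G.Adj x y := by
      intro x hx x' hx' hxx' hxa hxb y hy hya hyb
      obtain ⟨hxH, x'', hx'', hxx''⟩ := hpriv x hx x' hx' hxx' hxa hxb
      have hne : x ≠ y := by rintro rfl; exact hxb hyb
      by_cases hyH : y ∈ H
      · exact hH.1.1 x hxH y hyH x'' hx'' b hH.2.2 hxx'' hyb hne
      · have := hH.1.1 x hxH x₀ hx₀H x'' hx'' b hH.2.2 hxx'' hx₀.2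
          (by rintro rfl; exact hxb hx₀.2)
        exact ((hflip y ⟨hya, hyb⟩ (by tauto)).1 x (.inl ⟨hxa, hxb⟩)).2 this
    intro x hx y hy x' hx' y' hy' hxx' hyy' hne
    by_cases hxa : x = a
    · subst hxa; exact (hcut y hy y' hy' hyy' hne.symm).symm
    by_cases hya : y = a
    · subst hya; exact hcut x hx x' hx' hxx' hne
    have hxa' := hcut x hx x' hx' hxx' hxa
    have hya' := hcut y hy y' hy' hyy' hya
    by_cases hxb : G.Adj x b <;> by_cases hyb : G.Adj y b
    · exact hD x ⟨hxa', hxb⟩ y ⟨hya', hyb⟩ (iff_of_true hx hy) hne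
    · exact (hmix y hy y' hy' hyy' hya' hyb x hx hxa' hxb).symm
    · exact hmix x hx x' hx' hxx' hxa' hxb y hy hya' hyb
    · obtain ⟨hxH, x'', hx'', hxx''⟩ := hpriv x hx x' hx' hxx' hxa' hxb
      obtain ⟨hyH, y'', hy'', hyy''⟩ := hpriv y hy y' hy' hyy' hya' hyb
      exact hH.1.1 x hxH y hyH x'' hx'' y'' hy'' hxx'' hyy'' hne
  refine ⟨⟨key hab hH hx₀ hx₀H hy₀ hy₀H haT hbT hUa hUb hfar hD hflip, ?_⟩, haT, hbT⟩
  refine key (T := Tᶜ) hab.symm hH.compl (commonNbrs_comm ▸ hy₀) hy₀H (commonNbrs_comm ▸ hx₀)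
    (not_not.2 hx₀H) hbT (not_not.2 haT) hUb
    (fun u h1 h2 h3 h4 => h4 (hUa u h1 h2 h3))
    (fun w x h1 h2 h3 h4 h5 => not_congr (hfar w x h2 h1 h4 h3 h5))
    (fun x hx y hy hxy => hD x (commonNbrs_comm ▸ hx) y (commonNbrs_comm ▸ hy)
      (not_iff_not.1 hxy)) ?_
  intro z hz hzT
  have := hflip z (commonNbrs_comm ▸ hz) (fun h => hzT (not_congr h))
  exact ⟨this.2.swap, this.1.swap⟩

/-! ### The order on the common neighbours -/

section Key

variable [Fintype V]

open Classical in
/-- The number of private neighbours of `a` minus the number of private neighbours of `b` that are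
adjacent to `z`. -/
noncomputable def key (G : SimpleGraph V) (a b z : V) : ℤ :=
  ((Finset.univ.filter fun u => G.Adj u a ∧ ¬ G.Adj u b ∧ G.Adj u z).card : ℤ) -
    ((Finset.univ.filter fun u => G.Adj u b ∧ ¬ G.Adj u a ∧ G.Adj u z).card : ℤ)

theorem key_swap (z : V) : key G b a z = - key G a b z := by
  simp [key]

/-- Along a halfspace that cuts `ab` the keys decrease, and equal keys of differently labelled
vertices come from equal profiles. -/
theorem Separating.key_le {H : Set V} (h : Separating G a b H) (hab : G.Adj a b) {x y : V}
    (hx : x ∈ commonNbrs G a b) (hxH : x ∈ H) (hy : y ∈ commonNbrs G a b) (hyH : y ∉ H) :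
    key G a b y ≤ key G a b x ∧ (key G a b y = key G a b x → SameProfile G a b x y) := by
  classical
  have hsub : ∀ {a b x y : V} {H : Set V}, Separating G a b H → G.Adj a b →
      x ∈ commonNbrs G a b → x ∈ H →
      y ∈ commonNbrs G a b → y ∉ H → (Finset.univ.filter fun u => G.Adj u a ∧ ¬ G.Adj u b ∧
        G.Adj u y) ⊆ (Finset.univ.filter fun u => G.Adj u a ∧ ¬ G.Adj u b ∧ G.Adj u x) := by
    intro a b x y H h hab hx hxH hy hyH u hu
    simp only [Finset.mem_filter, Finset.mem_univ, true_and] at hu ⊢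
    refine ⟨hu.1, hu.2.1, ?_⟩
    by_cases hub : u = b
    · subst hub; exact hx.2.symm
    · exact h.1.1 u (h.mem_of_adj hab hu.1 hu.2.1 hub) x hxH y hyH b h.2.2 hu.2.2 hx.2
        (by rintro rfl; exact hu.2.1 hx.2)
  have s1 := hsub h hab hx hxH hy hyH
  have s2 := hsub h.compl hab.symm (commonNbrs_comm ▸ hy) hyH (commonNbrs_comm ▸ hx)
    (not_not.2 hxH)
  have c1 := Finset.card_le_card s1
  have c2 := Finset.card_le_card s2
  refine ⟨by unfold key; omega, fun heq => ?_⟩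
  have e1 := Finset.eq_of_subset_of_card_le s1 (by unfold key at heq; omega)
  have e2 := Finset.eq_of_subset_of_card_le s2 (by unfold key at heq; omega)
  intro u hu
  rcases hu with hu | hu
  · have := congrArg (u ∈ ·) e1
    simp only [Finset.mem_filter, Finset.mem_univ, true_and, hu, not_false_eq_true,
      eq_iff_iff] at this
    exact this.symm
  · have := congrArg (u ∈ ·) e2
    simp only [Finset.mem_filter, Finset.mem_univ, true_and, hu, not_false_eq_true,
      eq_iff_iff] at this
    exact this

end Key

end CutEdge

/-! ### Undetermined vertices and shattering -/

section VersionSpace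

variable {V : Type*} {G : SimpleGraph V} {a b : V}

/-- The sum modulo 2 of three sets. -/
def xor₃ (H₁ H₂ H₃ : Set V) : Set V := {x | x ∈ H₁ ↔ (x ∈ H₂ ↔ x ∈ H₃)}

/-- Halfspaces that differ only on common neighbours of one key are closed under sums of three,
provided that some halfspace has both labels on that key. -/
theorem Separating.xor_mem [Fintype V] (hab : G.Adj a b) {k : ℤ} {H H₁ H₂ H₃ : Set V} {x₀ y₀ : V}
    (hH : Separating G a b H)
    (hx₀ : x₀ ∈ commonNbrs G a b) (hx₀H : x₀ ∈ H) (hx₀k : key G a b x₀ = k)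
    (hy₀ : y₀ ∈ commonNbrs G a b) (hy₀H : y₀ ∉ H) (hy₀k : key G a b y₀ = k)
    (h₁ : Separating G a b H₁) (h₂ : Separating G a b H₂) (h₃ : Separating G a b H₃)
    (hup : ∀ w ∈ commonNbrs G a b, k < key G a b w → w ∈ H₁ ∧ w ∈ H₂ ∧ w ∈ H₃)
    (hlow : ∀ w ∈ commonNbrs G a b, key G a b w < k → w ∉ H₁ ∧ w ∉ H₂ ∧ w ∉ H₃) :
    Separating G a b (xor₃ H₁ H₂ H₃) := by
  refine hH.flip_mem hab hx₀ hx₀H hy₀ hy₀H ?_ ?_ ?_ ?_ ?_ ?_ ?_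
  · simp [xor₃, h₁.2.1, h₂.2.1, h₃.2.1]
  · simp [xor₃, h₁.2.2, h₂.2.2, h₃.2.2]
  · intro u hua hub hne
    simp [xor₃, h₁.mem_of_adj hab hua hub hne, h₂.mem_of_adj hab hua hub hne,
      h₃.mem_of_adj hab hua hub hne]
  · intro u hub hua hne
    have e1 : u ∉ H₁ := h₁.compl.mem_of_adj hab.symm hub hua hne
    have e2 : u ∉ H₂ := h₂.compl.mem_of_adj hab.symm hub hua hne
    have e3 : u ∉ H₃ := h₃.compl.mem_of_adj hab.symm hub hua hne
    simp [xor₃, e1, e2, e3]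
  · intro w x hwa hwb hwa' hwb' hwx
    simp only [xor₃, Set.mem_ofPred_eq, h₁.mem_iff_of_far hab hwa hwb hwa' hwb' hwx,
      h₂.mem_iff_of_far hab hwa hwb hwa' hwb' hwx, h₃.mem_iff_of_far hab hwa hwb hwa' hwb' hwx]
  · intro x hx y hy hxy hne
    by_contra hadj
    have e1 : ¬ (x ∈ H₁ ↔ y ∈ H₁) := fun h => hadj (h₁.adj_of_mem hx hy h hne)
    have e2 : ¬ (x ∈ H₂ ↔ y ∈ H₂) := fun h => hadj (h₂.adj_of_mem hx hy h hne)
    have e3 : ¬ (x ∈ H₃ ↔ y ∈ H₃) := fun h => hadj (h₃.adj_of_mem hx hy h hne)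
    simp only [xor₃, Set.mem_ofPred_eq] at hxy
    tauto
  · intro z hz hzT
    have hzk : key G a b z = k := by
      rcases lt_trichotomy (key G a b z) k with hlt | heq | hgt
      · obtain ⟨e1, e2, e3⟩ := hlow z hz hlt
        have hzH : z ∈ H := by
          by_contra hzH
          exact hzT (iff_of_false (by simp [xor₃, e1, e2, e3]) hzH)
        have := (hH.key_le hab hz hzH hy₀ hy₀H).1
        omega
      · exact heq
      · obtain ⟨e1, e2, e3⟩ := hup z hz hgt
        have hzH : z ∉ H := fun hzH => hzT (iff_of_true (by simp [xor₃, e1, e2, e3]) hzH)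
        have := (hH.key_le hab hx₀ hx₀H hz hzH).1
        omega
    have hxy : SameProfile G a b x₀ y₀ := (hH.key_le hab hx₀ hx₀H hy₀ hy₀H).2 (by omega)
    by_cases hzH : z ∈ H
    · have := (hH.key_le hab hz hzH hy₀ hy₀H).2 (by omega)
      exact ⟨this.trans hxy.symm, this⟩
    · have := (hH.key_le hab hx₀ hx₀H hz hzH).2 (by omega)
      exact ⟨this.symm, this.symm.trans hxy⟩

theorem mem_maj_of_left {A B : Set V} (C : Set V) {x : V} {s : Prop} (hA : x ∈ A ↔ s)
    (hB : x ∈ B ↔ s) : x ∈ maj A B C ↔ s := by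
  simp only [maj, Set.mem_ofPred_eq]; tauto

theorem mem_maj_of_right (A : Set V) {B C : Set V} {x : V} {s : Prop} (hB : x ∈ B ↔ s)
    (hC : x ∈ C ↔ s) : x ∈ maj A B C ↔ s := by
  simp only [maj, Set.mem_ofPred_eq]; tauto

theorem mem_maj_of_outer {A : Set V} (B : Set V) {C : Set V} {x : V} {s : Prop} (hA : x ∈ A ↔ s)
    (hC : x ∈ C ↔ s) : x ∈ maj A B C ↔ s := by
  simp only [maj, Set.mem_ofPred_eq]; tauto

theorem mem_xor₃_of_left {A B C : Set V} {x : V} {s : Prop} (hA : x ∈ A ↔ s)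
    (hB : ¬ (x ∈ B ↔ s)) (hC : ¬ (x ∈ C ↔ s)) : x ∈ xor₃ A B C ↔ s := by
  simp only [xor₃, Set.mem_ofPred_eq]; tauto

theorem mem_xor₃_of_middle {A B C : Set V} {x : V} {s : Prop} (hA : ¬ (x ∈ A ↔ s))
    (hB : x ∈ B ↔ s) (hC : ¬ (x ∈ C ↔ s)) : x ∈ xor₃ A B C ↔ s := by
  simp only [xor₃, Set.mem_ofPred_eq]; tauto

/-- In a family of sets that is closed under majority, labels that can be prescribed on any two
points can be prescribed on any finite set of points. -/
theorem exists_of_maj_closed {W : Set V → Prop}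
    (hmaj : ∀ H₁ H₂ H₃, W H₁ → W H₂ → W H₃ → W (maj H₁ H₂ H₃)) {σ : Set V} {Z : Finset V}
    (hne : ∃ H, W H)
    (h2 : ∀ z ∈ Z, ∀ z' ∈ Z, ∃ H, W H ∧ (z ∈ H ↔ z ∈ σ) ∧ (z' ∈ H ↔ z' ∈ σ)) :
    ∃ H, W H ∧ ∀ z ∈ Z, z ∈ H ↔ z ∈ σ := by
  classical
  induction hc : Z.card using Nat.strong_induction_on generalizing Z with
  | _ c ih =>
    by_cases h3 : 2 < Z.card
    · obtain ⟨x, y, z, hx, hy, hz, hxy, hxz, hyz⟩ := Finset.two_lt_card_iff.1 h3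
      have herase : ∀ w ∈ Z, ∃ H, W H ∧ ∀ v ∈ Z, v ≠ w → (v ∈ H ↔ v ∈ σ) := by
        intro w hw
        obtain ⟨H, hH, hHv⟩ := ih (Z.erase w).card
          (by rw [Finset.card_erase_of_mem hw]; have := Finset.card_pos.2 ⟨w, hw⟩; omega)
          (fun v hv v' hv' => h2 v (Finset.mem_of_mem_erase hv) v' (Finset.mem_of_mem_erase hv'))
          rfl
        exact ⟨H, hH, fun v hv hvw => hHv v (Finset.mem_erase.2 ⟨hvw, hv⟩)⟩
      obtain ⟨A, hA, hA'⟩ := herase x hx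
      obtain ⟨B, hB, hB'⟩ := herase y hy
      obtain ⟨C, hC, hC'⟩ := herase z hz
      refine ⟨maj A B C, hmaj A B C hA hB hC, fun v hv => ?_⟩
      by_cases e1 : v = x
      · subst e1; exact mem_maj_of_right A (hB' v hv hxy) (hC' v hv hxz)
      by_cases e2 : v = y
      · subst e2; exact mem_maj_of_outer B (hA' v hv e1) (hC' v hv hyz)
      · exact mem_maj_of_left C (hA' v hv e1) (hB' v hv e2)
    · rcases Z.eq_empty_or_nonempty with rfl | ⟨z, hz⟩
      · obtain ⟨H, hH⟩ := hne
        exact ⟨H, hH, by simp⟩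
      · by_cases h1 : ∃ z' ∈ Z, z' ≠ z
        · obtain ⟨z', hz', hne'⟩ := h1
          obtain ⟨H, hH, e, e'⟩ := h2 z hz z' hz'
          refine ⟨H, hH, fun v hv => ?_⟩
          by_contra hv'
          exact h3 (Finset.two_lt_card_iff.2 ⟨z, z', v, hz, hz', hv, hne'.symm,
            by rintro rfl; exact hv' e, by rintro rfl; exact hv' e'⟩)
        · push Not at h1
          obtain ⟨H, hH, e, -⟩ := h2 z hz z hz
          exact ⟨H, hH, fun v hv => by rw [h1 v hv]; exact e⟩

/-- `H` is a halfspace cutting `ab` that agrees with the positive labels `P` and the negative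
labels `N`. -/
def Consistent (G : SimpleGraph V) (a b : V) (P N H : Set V) : Prop :=
  Separating G a b H ∧ P ⊆ H ∧ ∀ x ∈ N, x ∉ H

variable {P N : Set V}

theorem Consistent.compl {H : Set V} (h : Consistent G a b P N H) : Consistent G b a N P Hᶜ :=
  ⟨h.1.compl, h.2.2, fun _ hx => not_not.2 (h.2.1 hx)⟩

theorem Consistent.maj (hab : G.Adj a b) {H₁ H₂ H₃ : Set V} (h₁ : Consistent G a b P N H₁)
    (h₂ : Consistent G a b P N H₂) (h₃ : Consistent G a b P N H₃) :
    Consistent G a b P N (maj H₁ H₂ H₃) :=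
  ⟨h₁.1.maj_mem hab h₂.1 h₃.1, fun x hx => .inl ⟨h₁.2.1 hx, h₂.2.1 hx⟩, fun x hx => by
    simp [MonophonicLearning.maj, h₁.2.2 x hx, h₂.2.2 x hx, h₃.2.2 x hx]⟩

/-- The common neighbours of `a` and `b` whose labels are not implied by the known labels. -/
def undetermined (G : SimpleGraph V) (a b : V) (P N : Set V) : Set V :=
  {z | z ∈ commonNbrs G a b ∧ (∃ H, Consistent G a b P N H ∧ z ∈ H) ∧
    ∃ H, Consistent G a b P N H ∧ z ∉ H}

/-- The labels of `z` and `z'` are neither always equal nor always different. -/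
def Inequivalent (G : SimpleGraph V) (a b : V) (P N : Set V) (z z' : V) : Prop :=
  (∃ H, Consistent G a b P N H ∧ (z ∈ H ↔ z' ∈ H)) ∧
    ∃ H, Consistent G a b P N H ∧ ¬ (z ∈ H ↔ z' ∈ H)

theorem undetermined_swap : undetermined G b a N P = undetermined G a b P N := by
  have : ∀ {a b : V} {P N : Set V}, undetermined G b a N P ⊆ undetermined G a b P N := by
    rintro a b P N z ⟨hz, ⟨H, hH, hzH⟩, H', hH', hzH'⟩
    exact ⟨commonNbrs_comm ▸ hz, ⟨_, hH'.compl, hzH'⟩, _, hH.compl, not_not.2 hzH⟩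
  exact this.antisymm this

theorem Inequivalent.swap {z z' : V} (h : Inequivalent G a b P N z z') :
    Inequivalent G b a N P z z' := by
  obtain ⟨⟨H, hH, h1⟩, H', hH', h2⟩ := h
  exact ⟨⟨_, hH.compl, not_congr h1⟩, _, hH'.compl, fun h => h2 (not_iff_not.1 h)⟩

/-- `d` bounds the size of every set that is shattered by halfspaces. -/
def ShatterBound (G : SimpleGraph V) (d : ℕ) : Prop :=
  ∀ Z : Finset V, (∀ σ : Set V, ∃ H, IsHalfspace G H ∧ ∀ z ∈ Z, z ∈ H ↔ z ∈ σ) → Z.card ≤ d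

/-- Pairwise inequivalent undetermined vertices with the key of a vertex `y` that is known to be
positive: all but one of them are shattered. -/
theorem card_le_of_key_eq_of_mem [Fintype V] (hab : G.Adj a b) {d : ℕ} (hd : ShatterBound G d)
    {y : V} (hy : y ∈ commonNbrs G a b) (hyH : ∀ H, Consistent G a b P N H → y ∈ H)
    {Z : Finset V} (hZ : ∀ z ∈ Z, z ∈ undetermined G a b P N)
    (hZk : ∀ z ∈ Z, key G a b z = key G a b y)
    (hZi : ∀ z ∈ Z, ∀ z' ∈ Z, z ≠ z' → Inequivalent G a b P N z z') : Z.card ≤ d + 1 := by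
  classical
  let W : Set V → Prop := fun H => Consistent G a b P N H ∧
    ∀ w ∈ commonNbrs G a b, key G a b w < key G a b y → w ∉ H
  have hW : ∀ H, Consistent G a b P N H → ∀ z ∈ Z, z ∉ H → W H := by
    intro H hH z hz hzH
    refine ⟨hH, fun w hw hwy hwH => ?_⟩
    have := (hH.1.key_le hab hw hwH (hZ z hz).1 hzH).1
    have := hZk z hz
    omega
  have hWup : ∀ H, W H → ∀ w ∈ commonNbrs G a b, key G a b y < key G a b w → w ∈ H := by
    intro H hH w hw hyw
    by_contra hwH
    have := (hH.1.1.key_le hab hy (hyH H hH.1) hw hwH).1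
    omega
  have hWmaj : ∀ H₁ H₂ H₃, Consistent G a b P N H₁ → W H₂ → W H₃ → W (maj H₁ H₂ H₃) := by
    intro H₁ H₂ H₃ h₁ h₂ h₃
    refine ⟨h₁.maj hab h₂.1 h₃.1, fun w hw hwy => ?_⟩
    simp [maj, h₂.2 w hw hwy, h₃.2 w hw hwy]
  -- the members of `Z` that can be positive together with a negative vertex of the same key
  let Z' := Z.filter fun z => ∃ H, W H ∧ z ∈ H
  have hrig : (Z \ Z').card ≤ 1 := by
    rw [Finset.card_le_one]
    intro z hz z' hz'
    by_contra hne
    simp only [Z', Finset.mem_sdiff, Finset.mem_filter, not_and, not_exists] at hz hz'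
    obtain ⟨H, hH, hzz⟩ := (hZi z hz.1 z' hz'.1 hne).2
    by_cases hzH : z ∈ H
    · exact hz.2 hz.1 H (hW H hH z' hz'.1 fun h => hzz (iff_of_true hzH h)) hzH
    · exact hz'.2 hz'.1 H (hW H hH z hz.1 hzH) (by_contra fun h => hzz (iff_of_false hzH h))
  have hshat : Z'.card ≤ d := by
    apply hd
    intro σ
    have hZ'Z : ∀ z ∈ Z', z ∈ Z := fun z hz => (Finset.mem_filter.1 hz).1
    have hpos : ∀ z ∈ Z', ∃ H, W H ∧ z ∈ H := fun z hz => (Finset.mem_filter.1 hz).2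
    have hneg : ∀ z ∈ Z', ∃ H, W H ∧ z ∉ H := by
      intro z hz
      obtain ⟨-, -, H, hH, hzH⟩ := hZ z (hZ'Z z hz)
      exact ⟨H, hW H hH z (hZ'Z z hz) hzH, hzH⟩
    rcases Z'.eq_empty_or_nonempty with hemp | ⟨z₀, hz₀⟩
    · rw [hemp]
      exact ⟨∅, ⟨by simp [CliqueBoundary], by simp [CliqueBoundary]⟩, by simp⟩
    obtain ⟨H₀, hH₀, hz₀H⟩ := hneg z₀ hz₀
    have hWxor : ∀ H₁ H₂ H₃, W H₁ → W H₂ → W H₃ → W (xor₃ H₁ H₂ H₃) := by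
      intro H₁ H₂ H₃ h₁ h₂ h₃
      refine ⟨⟨hH₀.1.1.xor_mem hab hy (hyH _ hH₀.1) rfl (hZ z₀ (hZ'Z z₀ hz₀)).1 hz₀H
        (hZk z₀ (hZ'Z z₀ hz₀)) h₁.1.1 h₂.1.1 h₃.1.1
        (fun w hw hk => ⟨hWup _ h₁ w hw hk, hWup _ h₂ w hw hk, hWup _ h₃ w hw hk⟩)
        (fun w hw hk => ⟨h₁.2 w hw hk, h₂.2 w hw hk, h₃.2 w hw hk⟩), ?_, ?_⟩, ?_⟩
      · intro x hx
        simp [xor₃, h₁.1.2.1 hx, h₂.1.2.1 hx, h₃.1.2.1 hx]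
      · intro x hx
        simp [xor₃, h₁.1.2.2 x hx, h₂.1.2.2 x hx, h₃.1.2.2 x hx]
      · intro w hw hk
        simp [xor₃, h₁.2 w hw hk, h₂.2 w hw hk, h₃.2 w hw hk]
    have agree : ∀ {p q s t : Prop}, ¬ (p ↔ q) → ¬ (s ↔ t) → (p ↔ s) → (q ↔ t) := by tauto
    have hpair : ∀ z ∈ Z', ∀ z' ∈ Z', ∃ H, W H ∧ (z ∈ H ↔ z ∈ σ) ∧ (z' ∈ H ↔ z' ∈ σ) := by
      intro z hz z' hz'
      have hone : ∀ z ∈ Z', ∃ H, W H ∧ (z ∈ H ↔ z ∈ σ) := by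
        intro z hz
        by_cases hzσ : z ∈ σ
        · obtain ⟨H, hH, h⟩ := hpos z hz
          exact ⟨H, hH, iff_of_true h hzσ⟩
        · obtain ⟨H, hH, h⟩ := hneg z hz
          exact ⟨H, hH, iff_of_false h hzσ⟩
      obtain ⟨A, hA, eA⟩ := hone z hz
      by_cases hne : z = z'
      · subst hne; exact ⟨A, hA, eA, eA⟩
      obtain ⟨B, hB, eB⟩ := hone z' hz'
      obtain ⟨⟨E, hE, eE⟩, F, hF, eF⟩ := hZi z (hZ'Z z hz) z' (hZ'Z z' hz') hne
      have hF' : W F := by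
        by_cases hzF : z ∈ F
        · exact hW F hF z' (hZ'Z z' hz') fun h => eF (iff_of_true hzF h)
        · exact hW F hF z (hZ'Z z hz) hzF
      have hE' : ∃ E, W E ∧ (z ∈ E ↔ z' ∈ E) := by
        by_cases hzE : z ∈ E
        · obtain ⟨C, hC, eC⟩ := hpos z hz
          obtain ⟨C', hC', eC'⟩ := hpos z' hz'
          exact ⟨_, hWmaj E C C' hE hC hC', iff_of_true (.inl ⟨hzE, eC⟩)
            (.inr (.inr ⟨eE.1 hzE, eC'⟩))⟩
        · exact ⟨E, hW E hE z (hZ'Z z hz) hzE, eE⟩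
      obtain ⟨E, hE, eE⟩ := hE'
      -- three of the four label pairs occur, and their sum is the fourth
      by_cases h1 : z' ∈ A ↔ z' ∈ σ
      · exact ⟨A, hA, eA, h1⟩
      by_cases h2 : z ∈ B ↔ z ∈ σ
      · exact ⟨B, hB, h2, eB⟩
      by_cases h3 : z ∈ σ ↔ z' ∈ σ
      · by_cases h4 : z ∈ E ↔ z ∈ σ
        · exact ⟨E, hE, h4, eE.symm.trans (h4.trans h3)⟩
        · exact ⟨_, hWxor A B E hA hB hE, mem_xor₃_of_left eA h2 h4,
            mem_xor₃_of_middle h1 eB fun h => h4 (eE.trans (h.trans h3.symm))⟩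
      · by_cases h4 : z ∈ F ↔ z ∈ σ
        · exact ⟨F, hF', h4, agree eF h3 h4⟩
        · exact ⟨_, hWxor A B F hA hB hF', mem_xor₃_of_left eA h2 h4,
            mem_xor₃_of_middle h1 eB fun h => h4 (agree (fun e => eF e.symm)
              (fun e => h3 e.symm) h)⟩
    obtain ⟨H, hH, h⟩ := exists_of_maj_closed
      (fun H₁ H₂ H₃ h₁ h₂ h₃ => hWmaj H₁ H₂ H₃ h₁.1 h₂ h₃) ⟨H₀, hH₀⟩ hpair
    exact ⟨H, hH.1.1.1, h⟩
  have hsub : Z' ⊆ Z := Finset.filter_subset _ _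
  have := Finset.card_sdiff_add_card_eq_card hsub
  omega

/-- The mirror image of `card_le_of_key_eq_of_mem`, by exchanging `a` and `b`. -/
theorem card_le_of_key_eq_of_notMem [Fintype V] (hab : G.Adj a b) {d : ℕ} (hd : ShatterBound G d)
    {y : V} (hy : y ∈ commonNbrs G a b) (hyH : ∀ H, Consistent G a b P N H → y ∉ H)
    {Z : Finset V} (hZ : ∀ z ∈ Z, z ∈ undetermined G a b P N)
    (hZk : ∀ z ∈ Z, key G a b z = key G a b y)
    (hZi : ∀ z ∈ Z, ∀ z' ∈ Z, z ≠ z' → Inequivalent G a b P N z z') : Z.card ≤ d + 1 := by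
  refine card_le_of_key_eq_of_mem (a := b) (b := a) (P := N) (N := P) hab.symm hd
    (commonNbrs_comm ▸ hy) ?_ (fun z hz => undetermined_swap ▸ hZ z hz) ?_
    (fun z hz z' hz' h => (hZi z hz z' hz' h).swap)
  · intro H hH
    by_contra h
    exact hyH _ hH.compl h
  · intro z hz
    rw [key_swap z, key_swap y, hZk z hz]

/-- The undetermined vertices such that all vertices with the same key are undetermined. -/
def freshKeys [Fintype V] (G : SimpleGraph V) (a b : V) (P N : Set V) : Set V :=
  {z | z ∈ undetermined G a b P N ∧
    ∀ w ∈ commonNbrs G a b, key G a b w = key G a b z → w ∈ undetermined G a b P N}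

/-- Once every key has a determined vertex, undetermined vertices have at most two keys. -/
theorem card_le_of_freshKeys_eq_empty [Fintype V] (hab : G.Adj a b) {d : ℕ}
    (hd : ShatterBound G d) (hX : freshKeys G a b P N = ∅)
    {Z : Finset V} (hZ : ∀ z ∈ Z, z ∈ undetermined G a b P N)
    (hZi : ∀ z ∈ Z, ∀ z' ∈ Z, z ≠ z' → Inequivalent G a b P N z z') : Z.card ≤ 2 * d + 2 := by
  classical
  have hdet : ∀ z ∈ Z, (∃ y ∈ commonNbrs G a b, key G a b y = key G a b z ∧
      ∀ H, Consistent G a b P N H → y ∈ H) ∨ ∃ y ∈ commonNbrs G a b, key G a b y = key G a b z ∧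
      ∀ H, Consistent G a b P N H → y ∉ H := by
    intro z hz
    by_contra hc
    push Not at hc
    refine Set.eq_empty_iff_forall_notMem.1 hX z ⟨hZ z hz, fun w hw hwk => ⟨hw, ?_, ?_⟩⟩
    · exact hc.2 w hw hwk
    · exact hc.1 w hw hwk
  let Z₁ := Z.filter fun z => ∃ y ∈ commonNbrs G a b, key G a b y = key G a b z ∧
    ∀ H, Consistent G a b P N H → y ∈ H
  have hsub : Z₁ ⊆ Z := Finset.filter_subset _ _
  have h1 : Z₁.card ≤ d + 1 := by
    rcases Z₁.eq_empty_or_nonempty with hemp | ⟨z₀, hz₀⟩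
    · simp [hemp]
    obtain ⟨y, hy, hyk, hyH⟩ := (Finset.mem_filter.1 hz₀).2
    have hle : ∀ z ∈ Z₁, ∀ z' ∈ Z₁, key G a b z' ≤ key G a b z := by
      intro z hz z' hz'
      obtain ⟨y, hy, hyk, hyH⟩ := (Finset.mem_filter.1 hz).2
      obtain ⟨hzD, -, H, hH, hzH⟩ := hZ z' (hsub hz')
      rw [← hyk]
      exact (hH.1.key_le hab hy (hyH H hH) hzD hzH).1
    exact card_le_of_key_eq_of_mem hab hd hy hyH (fun z hz => hZ z (hsub hz))
      (fun z hz => hyk ▸ (hle _ hz₀ _ hz).antisymm (hle _ hz _ hz₀))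
      (fun z hz z' hz' => hZi z (hsub hz) z' (hsub hz'))
  have h2 : (Z \ Z₁).card ≤ d + 1 := by
    have hmem : ∀ z ∈ Z \ Z₁, z ∈ Z ∧ ∃ y ∈ commonNbrs G a b, key G a b y = key G a b z ∧
        ∀ H, Consistent G a b P N H → y ∉ H := by
      intro z hz
      rw [Finset.mem_sdiff, Finset.mem_filter, not_and] at hz
      exact ⟨hz.1, (hdet z hz.1).resolve_left (hz.2 hz.1)⟩
    rcases (Z \ Z₁).eq_empty_or_nonempty with hemp | ⟨z₀, hz₀⟩
    · simp [hemp]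
    obtain ⟨-, y, hy, hyk, hyH⟩ := hmem z₀ hz₀
    have hle : ∀ z ∈ Z \ Z₁, ∀ z' ∈ Z \ Z₁, key G a b z ≤ key G a b z' := by
      intro z hz z' hz'
      obtain ⟨-, y, hy, hyk, hyH⟩ := hmem z hz
      obtain ⟨hzD, ⟨H, hH, hzH⟩, -⟩ := hZ z' (hmem z' hz').1
      rw [← hyk]
      exact (hH.1.key_le hab hzD hzH hy (hyH H hH)).1
    exact card_le_of_key_eq_of_notMem hab hd hy hyH (fun z hz => hZ z (hmem z hz).1)
      (fun z hz => hyk ▸ (hle _ hz _ hz₀).antisymm (hle _ hz₀ _ hz))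
      (fun z hz z' hz' => hZi z (hmem z hz).1 z' (hmem z' hz').1)
  have := Finset.card_sdiff_add_card_eq_card hsub
  omega

end VersionSpace

section Potential

variable {V : Type*} {G : SimpleGraph V} {a b : V} {P N : Set V}

/-! ### The number of label queries that identify a halfspace that cuts a given edge -/

theorem Consistent.of_insert {z : V} {H : Set V} (h : Consistent G a b (insert z P) N H) :
    Consistent G a b P N H :=
  ⟨h.1, (Set.subset_insert _ _).trans h.2.1, h.2.2⟩

theorem undetermined_insert_subset {z : V} :
    undetermined G a b (insert z P) N ⊆ undetermined G a b P N := by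
  rintro v ⟨hv, ⟨H, hH, h⟩, H', hH', h'⟩
  exact ⟨hv, ⟨H, hH.of_insert, h⟩, H', hH'.of_insert, h'⟩

theorem notMem_undetermined_insert {z : V} : z ∉ undetermined G a b (insert z P) N := by
  rintro ⟨-, -, H, hH, h⟩
  exact h (hH.2.1 (Set.mem_insert _ _))

/-- Without undetermined vertices there is only one consistent halfspace. -/
theorem Consistent.eq_of_undetermined_eq_empty (hG : G.Connected) (hab : G.Adj a b)
    (hX : undetermined G a b P N = ∅) {H H' : Set V} (h : Consistent G a b P N H)
    (h' : Consistent G a b P N H') : H = H' := by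
  refine h.1.eq_of_agree hG hab h'.1 fun x hx => ?_
  by_contra hne
  refine Set.eq_empty_iff_forall_notMem.1 hX x ⟨hx, ?_⟩
  by_cases hxH : x ∈ H
  · exact ⟨⟨H, h, hxH⟩, H', h', fun h => hne (iff_of_true hxH h)⟩
  · exact ⟨⟨H', h', by_contra fun h => hne (iff_of_false hxH h)⟩, H, h, hxH⟩

variable [Fintype V]

open Classical in
/-- The largest number of pairwise inequivalent undetermined vertices. -/
noncomputable def inequivalentNum (G : SimpleGraph V) (a b : V) (P N : Set V) : ℕ :=
  (Finset.univ.filter fun Z : Finset V => (∀ z ∈ Z, z ∈ undetermined G a b P N) ∧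
    ∀ z ∈ Z, ∀ z' ∈ Z, z ≠ z' → Inequivalent G a b P N z z').sup Finset.card

theorem card_le_inequivalentNum {Z : Finset V} (hZ : ∀ z ∈ Z, z ∈ undetermined G a b P N)
    (hZi : ∀ z ∈ Z, ∀ z' ∈ Z, z ≠ z' → Inequivalent G a b P N z z') :
    Z.card ≤ inequivalentNum G a b P N := by
  classical
  exact Finset.le_sup (f := Finset.card) (by simpa using ⟨hZ, hZi⟩)

theorem inequivalentNum_le {m : ℕ} (h : ∀ Z : Finset V, (∀ z ∈ Z, z ∈ undetermined G a b P N) →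
    (∀ z ∈ Z, ∀ z' ∈ Z, z ≠ z' → Inequivalent G a b P N z z') → Z.card ≤ m) :
    inequivalentNum G a b P N ≤ m := by
  classical
  refine Finset.sup_le fun Z hZ => ?_
  simp only [Finset.mem_filter, Finset.mem_univ, true_and] at hZ
  exact h Z hZ.1 hZ.2

theorem inequivalentNum_swap : inequivalentNum G b a N P = inequivalentNum G a b P N := by
  have : ∀ {a b : V} {P N : Set V}, inequivalentNum G b a N P ≤ inequivalentNum G a b P N :=
    fun {a b P N} => inequivalentNum_le fun Z hZ hZi => card_le_inequivalentNum
      (fun z hz => undetermined_swap ▸ hZ z hz) fun z hz z' hz' h => (hZi z hz z' hz' h).swap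
  exact this.antisymm this

theorem freshKeys_swap : freshKeys G b a N P = freshKeys G a b P N := by
  simp only [freshKeys, undetermined_swap (a := a), commonNbrs_comm (a := b), key_swap (a := a),
    neg_inj]

theorem freshKeys_insert_subset {z : V} :
    freshKeys G a b (insert z P) N ⊆ freshKeys G a b P N := fun _ hv =>
  ⟨undetermined_insert_subset hv.1, fun w hw hk => undetermined_insert_subset (hv.2 w hw hk)⟩

theorem inequivalentNum_insert_lt {z : V} (hz : z ∈ undetermined G a b P N) :
    inequivalentNum G a b (insert z P) N + 1 ≤ inequivalentNum G a b P N := by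
  classical
  have hle : inequivalentNum G a b (insert z P) N ≤ inequivalentNum G a b P N - 1 := by
    refine inequivalentNum_le fun Z hZ hZi => ?_
    have hzZ : z ∉ Z := fun h => notMem_undetermined_insert (hZ z h)
    have hnew : ∀ w ∈ Z, Inequivalent G a b P N z w := by
      intro w hw
      obtain ⟨-, ⟨H, hH, h⟩, H', hH', h'⟩ := hZ w hw
      exact ⟨⟨H, hH.of_insert, iff_of_true (hH.2.1 (Set.mem_insert _ _)) h⟩,
        H', hH'.of_insert, fun e => h' (e.1 (hH'.2.1 (Set.mem_insert _ _)))⟩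
    have hsymm : ∀ {u w}, Inequivalent G a b P N u w → Inequivalent G a b P N w u := by
      rintro u w ⟨⟨H, hH, h⟩, H', hH', h'⟩
      exact ⟨⟨H, hH, h.symm⟩, H', hH', fun e => h' e.symm⟩
    have := card_le_inequivalentNum (G := G) (a := a) (b := b) (P := P) (N := N)
      (Z := insert z Z) (by
        intro w hw
        rcases Finset.mem_insert.1 hw with rfl | hw
        exacts [hz, undetermined_insert_subset (hZ w hw)]) (by
        intro w hw w' hw' hne
        rcases Finset.mem_insert.1 hw with e | hw1 <;>
          rcases Finset.mem_insert.1 hw' with e' | hw1'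
        · exact absurd (e.trans e'.symm) hne
        · exact e ▸ hnew w' hw1'
        · exact e' ▸ hsymm (hnew w hw1)
        · obtain ⟨⟨H, hH, h⟩, H', hH', h'⟩ := hZi w hw1 w' hw1' hne
          exact ⟨⟨H, hH.of_insert, h⟩, H', hH'.of_insert, h'⟩)
    rw [Finset.card_insert_of_notMem hzZ] at this
    omega
  have := card_le_inequivalentNum (G := G) (a := a) (b := b) (P := P) (N := N) (Z := {z})
    (by simpa using hz) (by
      intro w hw w' hw' hne
      rw [Finset.mem_singleton] at hw hw'
      exact absurd (hw.trans hw'.symm) hne)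
  rw [Finset.card_singleton] at this
  omega

open Classical in
/-- A bound for the number of queries still needed: binary search on the fresh keys, followed by
the pairwise inequivalent undetermined vertices. -/
noncomputable def potential (G : SimpleGraph V) (a b : V) (d : ℕ) (P N : Set V) : ℕ :=
  Nat.clog 2 ((freshKeys G a b P N).ncard + 1) +
    if freshKeys G a b P N = ∅ then inequivalentNum G a b P N else 2 * d + 2

theorem potential_swap (d : ℕ) : potential G b a d N P = potential G a b d P N := by
  simp only [potential, freshKeys_swap (a := a), inequivalentNum_swap (a := a)]

/-- The query rule: a median fresh key if there are fresh keys, else any undetermined vertex. -/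
def GoodQuery (G : SimpleGraph V) (a b : V) (P N : Set V) (z : V) : Prop :=
  z ∈ undetermined G a b P N ∧
    (freshKeys G a b P N = ∅ ∨ z ∈ freshKeys G a b P N ∧
      2 * {v ∈ freshKeys G a b P N | key G a b z < key G a b v}.ncard ≤
        (freshKeys G a b P N).ncard ∧
      2 * {v ∈ freshKeys G a b P N | key G a b v < key G a b z}.ncard ≤
        (freshKeys G a b P N).ncard)

theorem GoodQuery.swap {z : V} (h : GoodQuery G a b P N z) : GoodQuery G b a N P z := by
  simp only [GoodQuery, freshKeys_swap (a := a), undetermined_swap (a := a), key_swap (a := a),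
    neg_lt_neg_iff]
  exact ⟨h.1, h.2.imp id fun h => ⟨h.1, h.2.2, h.2.1⟩⟩

theorem clog_succ_of_two_mul_le {m m' : ℕ} (hm : 1 ≤ m) (h : 2 * m' ≤ m) :
    Nat.clog 2 (m' + 1) + 1 ≤ Nat.clog 2 (m + 1) := by
  rw [Nat.clog_of_two_le one_lt_two (show 2 ≤ m + 1 by omega)]
  exact Nat.succ_le_succ (Nat.clog_mono_right 2 (by omega))

/-- A positive answer to a good query decreases the potential; negative answers reduce to this by
`GoodQuery.swap`. -/
theorem GoodQuery.potential_insert_lt (hab : G.Adj a b) {d : ℕ} (hd : ShatterBound G d) {z : V}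
    (h : GoodQuery G a b P N z) :
    potential G a b d (insert z P) N + 1 ≤ potential G a b d P N := by
  obtain ⟨hz, h | ⟨hzf, -, hlow⟩⟩ := h
  · have h' : freshKeys G a b (insert z P) N = ∅ :=
      Set.subset_empty_iff.1 (h ▸ freshKeys_insert_subset)
    have := inequivalentNum_insert_lt hz
    simp only [potential, h, h', if_true, Set.ncard_empty]
    omega
  · have hsub : freshKeys G a b (insert z P) N ⊆
        {v ∈ freshKeys G a b P N | key G a b v < key G a b z} := by
      intro v hv
      refine ⟨freshKeys_insert_subset hv, ?_⟩
      obtain ⟨⟨hvD, -, H, hH, hvH⟩, hv2⟩ := hv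
      have h1 := (hH.1.key_le hab hz.1 (hH.2.1 (Set.mem_insert _ _)) hvD hvH).1
      refine lt_of_le_of_ne h1 fun he => ?_
      exact notMem_undetermined_insert (hv2 z hz.1 he.symm)
    have hcard := Set.ncard_le_ncard hsub (Set.toFinite _)
    have hpos : 1 ≤ (freshKeys G a b P N).ncard :=
      (Set.ncard_pos (Set.toFinite _)).2 ⟨z, hzf⟩
    have hclog := clog_succ_of_two_mul_le hpos
      (show 2 * (freshKeys G a b (insert z P) N).ncard ≤ _ by omega)
    have hne : freshKeys G a b P N ≠ ∅ := Set.Nonempty.ne_empty ⟨z, hzf⟩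
    have hsnd : (if freshKeys G a b (insert z P) N = ∅ then
        inequivalentNum G a b (insert z P) N else 2 * d + 2) ≤ 2 * d + 2 := by
      split_ifs with h0
      · exact inequivalentNum_le fun Z hZ hZi => card_le_of_freshKeys_eq_empty hab hd h0 hZ hZi
      · exact le_rfl
    simp only [potential, if_neg hne]
    omega

theorem GoodQuery.ncard_undetermined_insert_lt {z : V} (h : GoodQuery G a b P N z) :
    (undetermined G a b (insert z P) N).ncard + 1 ≤ (undetermined G a b P N).ncard :=
  Set.ncard_lt_ncard ((Set.ssubset_iff_of_subset undetermined_insert_subset).2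
    ⟨z, h.1, notMem_undetermined_insert⟩) (Set.toFinite _)

theorem exists_median {s : Set V} (hs : s.Nonempty) (f : V → ℤ) :
    ∃ z ∈ s, 2 * {v ∈ s | f z < f v}.ncard ≤ s.ncard ∧ 2 * {v ∈ s | f v < f z}.ncard ≤ s.ncard := by
  classical
  -- the smallest value with at most half of the values above it
  let t := {z ∈ s | 2 * {v ∈ s | f z < f v}.ncard ≤ s.ncard}
  have ht : t.Nonempty := by
    obtain ⟨z, hz, hmax⟩ := Set.exists_max_image s f (Set.toFinite _) hs
    refine ⟨z, hz, ?_⟩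
    have : {v ∈ s | f z < f v} = ∅ := by
      ext v
      simpa using fun hv => hmax v hv
    simp [this]
  obtain ⟨z, ⟨hz, hz2⟩, hmin⟩ := Set.exists_min_image t f (Set.toFinite _) ht
  refine ⟨z, hz, hz2, ?_⟩
  rcases Set.eq_empty_or_nonempty {v ∈ s | f v < f z} with hemp | hne
  · simp [hemp]
  obtain ⟨w, ⟨hw, hwz⟩, hmax⟩ := Set.exists_max_image _ f (Set.toFinite _) hne
  have hwt : ¬ 2 * {v ∈ s | f w < f v}.ncard ≤ s.ncard := fun h =>
    absurd (hmin w ⟨hw, h⟩) (not_le.2 hwz)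
  have hunion : {v ∈ s | f v < f z} ∪ {v ∈ s | f w < f v} = s := by
    ext v
    constructor
    · rintro (h | h) <;> exact h.1
    · intro hv
      by_cases h : f v < f z
      · exact .inl ⟨hv, h⟩
      · exact .inr ⟨hv, by omega⟩
  have hdisj : Disjoint {v ∈ s | f v < f z} {v ∈ s | f w < f v} := by
    rw [Set.disjoint_left]
    rintro v hv ⟨-, hv'⟩
    have := hmax v hv
    omega
  have := Set.ncard_union_eq hdisj (Set.toFinite _) (Set.toFinite _)
  rw [hunion] at this
  omega

/-- `w` bounds the size of all cliques. -/
def CliqueBound (G : SimpleGraph V) (w : ℕ) : Prop :=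
  ∀ s : Finset V, G.IsClique (s : Set V) → s.card ≤ w

theorem Separating.ncard_commonNbrs_le {H : Set V} (h : Separating G a b H) {w : ℕ}
    (hw : CliqueBound G w) : (commonNbrs G a b).ncard ≤ 2 * w := by
  classical
  have hcl : ∀ s : Set V, G.IsClique s → s.ncard ≤ w := by
    intro s hs
    rw [Set.ncard_eq_toFinset_card']
    exact hw _ (by simpa using hs)
  have h1 := hcl (commonNbrs G a b ∩ H) fun x hx y hy hne =>
    h.adj_of_mem hx.1 hy.1 (iff_of_true hx.2 hy.2) hne
  have h2 := hcl (commonNbrs G a b \ H) fun x hx y hy hne =>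
    h.adj_of_mem hx.1 hy.1 (iff_of_false hx.2 hy.2) hne
  have := Set.ncard_inter_add_ncard_sdiff_eq_ncard (commonNbrs G a b) H (Set.toFinite _)
  omega

theorem Separating.potential_le {H : Set V} (h : Separating G a b H) (hab : G.Adj a b) {w d : ℕ}
    (hw : CliqueBound G w) (hd : ShatterBound G d) :
    potential G a b d P N ≤ Nat.clog 2 (2 * w + 1) + (2 * d + 2) := by
  refine Nat.add_le_add (Nat.clog_mono_right 2 ?_) ?_
  · have := h.ncard_commonNbrs_le hw
    have := Set.ncard_le_ncard (show freshKeys G a b P N ⊆ commonNbrs G a b from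
      fun x hx => hx.1.1) (Set.toFinite _)
    omega
  · split_ifs with h0
    · exact inequivalentNum_le fun Z hZ hZi => card_le_of_freshKeys_eq_empty hab hd h0 hZ hZi
    · exact le_rfl

end Potential

section Propagation

variable {V : Type*} {G : SimpleGraph V} {P N : Set V}

/-! ### Unit propagation and the consistency test -/

/-- The vertices that are forced to be positive because of one clique boundary condition whose
other three vertices have known labels. -/
def force (G : SimpleGraph V) (P N : Set V) : Set V :=
  {v | (∃ x ∈ P, ∃ y ∈ P, ∃ y' ∈ N, x ≠ y ∧ ¬ G.Adj x y ∧ G.Adj x v ∧ G.Adj y y') ∨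
    ∃ w ∈ N, ∃ x ∈ P, ∃ y ∈ P, v ≠ w ∧ ¬ G.Adj v w ∧ G.Adj v x ∧ G.Adj w y}

/-- Some halfspace has the positive labels `P` and the negative labels `N`. -/
def Satisfiable (G : SimpleGraph V) (P N : Set V) : Prop :=
  ∃ H, IsHalfspace G H ∧ P ⊆ H ∧ ∀ x ∈ N, x ∉ H

theorem force_subset {H : Set V} (hH : IsHalfspace G H) (hP : P ⊆ H) (hN : ∀ x ∈ N, x ∉ H) :
    force G P N ⊆ H := by
  rintro v (⟨x, hx, y, hy, y', hy', hne, hxy, hxv, hyy'⟩ |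
    ⟨w, hw, x, hx, y, hy, hne, hvw, hvx, hwy⟩)
  · by_contra hv
    exact hxy (hH.1 x (hP hx) y (hP hy) v hv y' (hN y' hy') hxv hyy' hne)
  · by_contra hv
    exact hvw (hH.2 v hv w (hN w hw) x (not_not.2 (hP hx)) y (not_not.2 (hP hy)) hvx hwy hne)

theorem notMem_of_mem_force {H : Set V} (hH : IsHalfspace G H) (hP : P ⊆ H)
    (hN : ∀ x ∈ N, x ∉ H) : ∀ x ∈ force G N P, x ∉ H :=
  fun _ hx => force_subset (H := Hᶜ) hH.compl hN (fun _ h => not_not.2 (hP h)) hx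

/-- One round of propagation on a pair of positive and negative labels. -/
def propagate (G : SimpleGraph V) (s : Set V × Set V) : Set V × Set V :=
  (s.1 ∪ force G s.1 s.2, s.2 ∪ force G s.2 (s.1 ∪ force G s.1 s.2))

/-- No propagation is possible. -/
def Closed (G : SimpleGraph V) (s : Set V × Set V) : Prop :=
  force G s.1 s.2 ⊆ s.1 ∧ force G s.2 s.1 ⊆ s.2

theorem le_propagate (s : Set V × Set V) : s ≤ propagate G s :=
  ⟨Set.subset_union_left, Set.subset_union_left⟩

theorem closed_of_propagate_eq {s : Set V × Set V} (h : propagate G s = s) : Closed G s := by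
  have h1 : s.1 ∪ force G s.1 s.2 = s.1 := congrArg Prod.fst h
  have h2 : s.2 ∪ force G s.2 (s.1 ∪ force G s.1 s.2) = s.2 := congrArg Prod.snd h
  rw [h1] at h2
  exact ⟨Set.union_eq_left.1 h1, Set.union_eq_left.1 h2⟩

theorem le_iterate_propagate (s : Set V × Set V) (k : ℕ) : s ≤ (propagate G)^[k] s := by
  induction k with
  | zero => exact le_rfl
  | succ k ih => rw [Function.iterate_succ_apply']; exact ih.trans (le_propagate _)

theorem agree_iterate_propagate {H : Set V} (hH : IsHalfspace G H) {s : Set V × Set V}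
    (hP : s.1 ⊆ H) (hN : ∀ x ∈ s.2, x ∉ H) (k : ℕ) :
    ((propagate G)^[k] s).1 ⊆ H ∧ ∀ x ∈ ((propagate G)^[k] s).2, x ∉ H := by
  induction k with
  | zero => exact ⟨hP, hN⟩
  | succ k ih =>
    rw [Function.iterate_succ_apply']
    have h1 := Set.union_subset ih.1 (force_subset hH ih.1 ih.2)
    refine ⟨h1, fun x hx => ?_⟩
    rcases hx with hx | hx
    exacts [ih.2 x hx, notMem_of_mem_force hH h1 ih.2 x hx]

/-- Propagation is complete after `2 * card V` rounds. -/
theorem closed_iterate_propagate [Fintype V] (s : Set V × Set V) :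
    Closed G ((propagate G)^[2 * Fintype.card V] s) := by
  set m : Set V × Set V → ℕ := fun s => s.1.ncard + s.2.ncard with hm
  have hmle : ∀ s, m s ≤ 2 * Fintype.card V := by
    intro s
    have h1 := Set.ncard_le_card s.1
    have h2 := Set.ncard_le_card s.2
    simp only [hm]
    simp only [Nat.card_eq_fintype_card] at h1 h2
    omega
  have hstep : ∀ s : Set V × Set V, propagate G s = s ∨ m s + 1 ≤ m (propagate G s) := by
    intro s
    by_cases h : propagate G s = s
    · exact .inl h
    right
    have hle := le_propagate (G := G) s
    have h1 := Set.ncard_le_ncard hle.1 (Set.toFinite _)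
    have h2 := Set.ncard_le_ncard hle.2 (Set.toFinite _)
    by_contra hc
    simp only [hm] at hc
    exact h (Prod.ext (Set.eq_of_subset_of_ncard_le hle.1 (by omega) (Set.toFinite _)).symm
      (Set.eq_of_subset_of_ncard_le hle.2 (by omega) (Set.toFinite _)).symm)
  have hk : ∀ k, propagate G ((propagate G)^[k] s) = (propagate G)^[k] s ∨
      k ≤ m ((propagate G)^[k] s) := by
    intro k
    induction k with
    | zero => exact .inr (Nat.zero_le _)
    | succ k ih =>
      rw [Function.iterate_succ_apply']
      rcases ih with h | h
      · exact .inl (by rw [h, h])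
      · rcases hstep ((propagate G)^[k] s) with h' | h'
        · exact .inl (by rw [h', h'])
        · exact .inr (by omega)
  apply closed_of_propagate_eq
  rcases hk (2 * Fintype.card V) with h | h
  · exact h
  · rcases hstep ((propagate G)^[2 * Fintype.card V] s) with h' | h'
    · exact h'
    · have := hmle (propagate G ((propagate G)^[2 * Fintype.card V] s))
      omega

/-- Labels that are closed under propagation and free of contradictions can be combined with any
halfspace that cuts `ab`: given the labels of `a` and `b` the halfspace conditions are clauses
with two literals, and the remaining clauses do not involve the labelled vertices. -/
theorem Separating.override {a b : V} (hab : G.Adj a b) {s : Set V × Set V} (hs : Closed G s)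
    (hd : ∀ x ∈ s.1, x ∉ s.2) (ha : a ∈ s.1) (hb : b ∈ s.2) {H : Set V}
    (hH : Separating G a b H) : Separating G a b (s.1 ∪ (H \ s.2)) := by
  have key : ∀ {a b : V} {P N H : Set V}, G.Adj a b → force G P N ⊆ P → force G N P ⊆ N →
      (∀ x ∈ P, x ∉ N) → a ∈ P → b ∈ N → Separating G a b H →
      CliqueBoundary G (P ∪ (H \ N)) := by
    intro a b P N H hab hfP hfN hd ha hb hH
    have hTN : ∀ x ∈ P ∪ (H \ N), x ∉ N := fun x hx => hx.elim (hd x) (·.2)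
    have hcut : ∀ x ∈ P ∪ (H \ N), ∀ x' ∉ P ∪ (H \ N), G.Adj x x' → x ≠ a → G.Adj x a := by
      intro x hx x' hx' hxx' hne
      by_contra hxa
      have hxP : x ∉ P := fun hxP =>
        hx' (.inl (hfP (.inl ⟨x, hxP, a, ha, b, hb, hne, hxa, hxx', hab⟩)))
      have hx'N : x' ∉ N := fun hx'N =>
        hTN x hx (hfN (.inr ⟨a, ha, x', hx'N, b, hb, hne, hxa, hxx', hab⟩))
      exact hxa (hH.adj_left hab (hx.resolve_left hxP).1
        (fun h => hx' (.inr ⟨h, hx'N⟩)) hxx' hne)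
    have hpriv : ∀ x ∈ P ∪ (H \ N), G.Adj x a → ¬ G.Adj x b → x ∈ P ∧ x ∈ H := by
      intro x hx hxa hxb
      have hne : x ≠ b := by rintro rfl; exact hTN x hx hb
      exact ⟨hfP (.inr ⟨b, hb, a, ha, a, ha, hne, hxb, hxa, hab.symm⟩),
        hH.mem_of_adj hab hxa hxb hne⟩
    have hmix : ∀ x ∈ P ∪ (H \ N), G.Adj x b → ∀ y ∈ P ∪ (H \ N), y ∈ P → y ∈ H →
        ∀ y' ∉ P ∪ (H \ N), G.Adj y y' → x ≠ y → G.Adj x y := by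
      intro x hx hxb y hy hyP hyH y' hy' hyy' hne
      by_contra hxy
      have hy'N : y' ∉ N := fun h =>
        hTN x hx (hfN (.inr ⟨y, hyP, b, hb, y', h, hne, hxy, hxb, hyy'⟩))
      have hxP : x ∉ P := fun h =>
        hy' (.inl (hfP (.inl ⟨y, hyP, x, h, b, hb, hne.symm, fun h => hxy h.symm, hyy', hxb⟩)))
      exact hxy (hH.1.1 x (hx.resolve_left hxP).1 y hyH b hH.2.2 y'
        (fun h => hy' (.inr ⟨h, hy'N⟩)) hxb hyy' hne)
    intro x hx y hy x' hx' y' hy' hxx' hyy' hne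
    by_cases hxa : x = a
    · subst hxa; exact (hcut y hy y' hy' hyy' hne.symm).symm
    by_cases hya : y = a
    · subst hya; exact hcut x hx x' hx' hxx' hne
    have hxa' := hcut x hx x' hx' hxx' hxa
    have hya' := hcut y hy y' hy' hyy' hya
    by_cases hxb : G.Adj x b <;> by_cases hyb : G.Adj y b
    · by_contra hxy
      have hxP : x ∉ P := fun h => hTN y hy
        (hfN (.inr ⟨x, h, b, hb, b, hb, hne.symm, fun h => hxy h.symm, hyb, hxb⟩))
      have hyP : y ∉ P := fun h => hTN x hx (hfN (.inr ⟨y, h, b, hb, b, hb, hne, hxy, hxb, hyb⟩))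
      exact hxy (hH.1.1 x (hx.resolve_left hxP).1 y (hy.resolve_left hyP).1 b hH.2.2 b hH.2.2
        hxb hyb hne)
    · obtain ⟨hyP, hyH⟩ := hpriv y hy hya' hyb
      exact hmix x hx hxb y hy hyP hyH y' hy' hyy' hne
    · obtain ⟨hxP, hxH⟩ := hpriv x hx hxa' hxb
      exact (hmix y hy hyb x hx hxP hxH x' hx' hxx' hne.symm).symm
    · obtain ⟨hyP, hyH⟩ := hpriv y hy hya' hyb
      obtain ⟨hxP, hxH⟩ := hpriv x hx hxa' hxb
      by_contra hxy
      have hx'N : x' ∉ N := fun h =>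
        hy' (.inl (hfP (.inl ⟨y, hyP, x, hxP, x', h, hne.symm, fun h => hxy h.symm, hyy', hxx'⟩)))
      have hy'N : y' ∉ N := fun h =>
        hx' (.inl (hfP (.inl ⟨x, hxP, y, hyP, y', h, hne, hxy, hxx', hyy'⟩)))
      exact hxy (hH.1.1 x hxH y hyH x' (fun h => hx' (.inr ⟨h, hx'N⟩)) y'
        (fun h => hy' (.inr ⟨h, hy'N⟩)) hxx' hyy' hne)
  have hcompl : (s.1 ∪ (H \ s.2))ᶜ = s.2 ∪ (Hᶜ \ s.1) := by
    ext x
    have := hd x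
    simp only [Set.mem_compl_iff, Set.mem_union, Set.mem_sdiff]
    tauto
  refine ⟨⟨key hab hs.1 hs.2 hd ha hb hH, ?_⟩, .inl ha, ?_⟩
  · rw [hcompl]
    exact key hab.symm hs.2 hs.1 (fun x hx hx' => hd x hx' hx) hb ha hH.compl
  · rintro (h | h)
    exacts [hd b h hb, h.2 hb]

theorem Closed.isHalfspace {s : Set V × Set V} (hs : Closed G s) (hd : ∀ x ∈ s.1, x ∉ s.2)
    (ht : ∀ x, x ∈ s.1 ∨ x ∈ s.2) : IsHalfspace G s.1 := by
  have hc : s.1ᶜ = s.2 := by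
    ext x
    have := hd x
    have := ht x
    simp only [Set.mem_compl_iff]
    tauto
  have key : ∀ {P N : Set V}, force G P N ⊆ P → (∀ x, x ∈ P ∨ x ∈ N) → CliqueBoundary G P := by
    intro P N hf ht x hx y hy x' hx' y' hy' hxx' hyy' hne
    by_contra hxy
    exact hx' (hf (.inl ⟨x, hx, y, hy, y', (ht y').resolve_left hy', hne, hxy, hxx', hyy'⟩))
  refine ⟨key hs.1 ht, ?_⟩
  rw [hc]
  exact key hs.2 fun x => (ht x).symm

theorem le_insert_fst (z : V) (s : Set V × Set V) : s ≤ (insert z s.1, s.2) :=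
  ⟨Set.subset_insert _ _, subset_rfl⟩

theorem le_insert_snd (z : V) (s : Set V × Set V) : s ≤ (s.1, insert z s.2) :=
  ⟨subset_rfl, Set.subset_insert _ _⟩

/-- The labels `s` are closed under propagation, extend `s₀`, and are satisfiable if `s₀` is. -/
def Extends (G : SimpleGraph V) (s₀ s : Set V × Set V) : Prop :=
  Closed G s ∧ s₀ ≤ s ∧ (Satisfiable G s₀.1 s₀.2 → Satisfiable G s.1 s.2)

theorem Extends.satisfiable_iff {s₀ s : Set V × Set V} (h : Extends G s₀ s)
    (ht : ∀ x, x ∈ s.1 ∨ x ∈ s.2) :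
    Satisfiable G s₀.1 s₀.2 ↔ ∀ x ∈ s.1, x ∉ s.2 := by
  constructor
  · intro hsat x hx hx'
    obtain ⟨H, -, hP, hN⟩ := h.2.2 hsat
    exact hN x hx' (hP hx)
  · intro hd
    exact ⟨s.1, h.1.isHalfspace hd ht, h.2.1.1, fun x hx hx' => hd x hx' (h.2.1.2 hx)⟩

variable [Fintype V]

/-- Labels together with their consequences under propagation. -/
noncomputable def saturate (G : SimpleGraph V) (s : Set V × Set V) : Set V × Set V :=
  (propagate G)^[2 * Fintype.card V] s

open Classical in
/-- Give `z` a label: positive, if propagation does not refute that, else negative. -/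
noncomputable def decideVertex (G : SimpleGraph V) (z : V) (s : Set V × Set V) : Set V × Set V :=
  if z ∈ s.1 ∨ z ∈ s.2 then s
  else if ∀ x ∈ (saturate G (insert z s.1, s.2)).1, x ∉ (saturate G (insert z s.1, s.2)).2 then
    saturate G (insert z s.1, s.2)
  else saturate G (s.1, insert z s.2)

theorem extends_saturate (s : Set V × Set V) : Extends G s (saturate G s) := by
  refine ⟨closed_iterate_propagate s, le_iterate_propagate s _, ?_⟩
  rintro ⟨H, hH, hP, hN⟩
  exact ⟨H, hH, agree_iterate_propagate hH hP hN _⟩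

/-- If propagation from the chosen label finds no contradiction, then the label is compatible with
any halfspace that agrees with the labels so far, by `Separating.override`. -/
theorem Extends.decideVertex {a b : V} (hab : G.Adj a b) {s₀ s : Set V × Set V}
    (ha : a ∈ s₀.1) (hb : b ∈ s₀.2) (h : Extends G s₀ s) (z : V) :
    Extends G s₀ (decideVertex G z s) := by
  classical
  obtain ⟨hc, hle, hsat⟩ := h
  unfold MonophonicLearning.decideVertex
  split_ifs with h1 h2
  · exact ⟨hc, hle, hsat⟩
  · obtain ⟨hc', hle', -⟩ := extends_saturate (G := G) (insert z s.1, s.2)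
    have hle'' : s ≤ saturate G (insert z s.1, s.2) :=
      le_trans (le_insert_fst z s) hle'
    refine ⟨hc', hle.trans hle'', fun h => ?_⟩
    obtain ⟨H, hH, hP, hN⟩ := hsat h
    have := Separating.override hab hc' h2 (hle''.1 (hle.1 ha)) (hle''.2 (hle.2 hb))
      (⟨hH, hP (hle.1 ha), hN b (hle.2 hb)⟩ : Separating G a b H)
    refine ⟨_, this.1, Set.subset_union_left, fun x hx => ?_⟩
    rintro (hx' | hx')
    exacts [h2 x hx' hx, hx'.2 hx]
  · obtain ⟨hc', hle', hsat'⟩ := extends_saturate (G := G) (s.1, insert z s.2)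
    have hle'' : s ≤ saturate G (s.1, insert z s.2) :=
      le_trans (le_insert_snd z s) hle'
    refine ⟨hc', hle.trans hle'', fun h => hsat' ?_⟩
    obtain ⟨H, hH, hP, hN⟩ := hsat h
    refine ⟨H, hH, hP, ?_⟩
    rintro x (rfl | hx)
    swap
    · exact hN x hx
    intro hxH
    obtain ⟨e1, e2⟩ := agree_iterate_propagate (G := G) hH (s := (insert x s.1, s.2))
      (Set.insert_subset hxH hP) hN (2 * Fintype.card V)
    exact h2 fun y hy hy' => e2 y hy' (e1 hy)

theorem decideVertex_total (z : V) (s : Set V × Set V) :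
    z ∈ (decideVertex G z s).1 ∨ z ∈ (decideVertex G z s).2 := by
  classical
  unfold decideVertex
  split_ifs with h1 h2
  · exact h1
  · exact .inl ((extends_saturate (insert z s.1, s.2)).2.1.1 (Set.mem_insert _ _))
  · exact .inr ((extends_saturate (s.1, insert z s.2)).2.1.2 (Set.mem_insert _ _))

theorem le_decideVertex (z : V) (s : Set V × Set V) : s ≤ decideVertex G z s := by
  classical
  unfold decideVertex
  split_ifs with h1 h2
  · exact le_rfl
  · exact le_trans (le_insert_fst z s) (extends_saturate (insert z s.1, s.2)).2.1
  · exact le_trans (le_insert_snd z s) (extends_saturate (s.1, insert z s.2)).2.1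

end Propagation

/-! ### A programming language with terms that count -/

/-- Terms over variables, arrays and the adjacency matrix; `sum i e` is the sum of `e` over all
vertices `i`.  Truth values are encoded as zero and nonzero, so that `sum` is also the existential
quantifier. -/
inductive Term where
  | var (i : ℕ) : Term
  | const (c : ℕ) : Term
  | add (e f : Term) : Term
  | sub (e f : Term) : Term
  | arr (k : Fin 15) (e : Term) : Term
  | adj (e f : Term) : Term
  | ite (c e f : Term) : Term
  | sum (i : ℕ) (e : Term) : Term

/-- Programs whose loops run over all vertices, so that they run in polynomial time.
`setArr k i e` assigns `e` to all entries `i` of the array `k` simultaneously. -/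
inductive Code where
  | assign (i : ℕ) (e : Term) : Code
  | setArr (k : Fin 15) (i : ℕ) (e : Term) : Code
  | query (i : ℕ) (e : Term) : Code
  | seq (c d : Code) : Code
  | ite (e : Term) (c d : Code) : Code
  | loop (i : ℕ) (c : Code) : Code

/-- The values of variables and arrays, and the number of label queries made so far. -/
structure Store where
  vars : ℕ → ℕ
  arrs : Fin 15 → ℕ → ℕ
  cnt : ℕ

/-- Assignment to a variable. -/
def Store.setVar (σ : Store) (i x : ℕ) : Store := { σ with vars := Function.update σ.vars i x }

/-- Assignment to an array. -/
def Store.setArr (σ : Store) (k : Fin 15) (f : ℕ → ℕ) : Store :=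
  { σ with arrs := Function.update σ.arrs k f }

/-- The store with a query counted. -/
def Store.tick (σ : Store) : Store := { σ with cnt := σ.cnt + 1 }

section Semantics

variable {n : ℕ} (G : SimpleGraph (Fin n)) (H : Finset (Fin n))

/-- The value of a term. -/
noncomputable def Term.eval : Term → Store → ℕ
  | var i, σ => σ.vars i
  | const c, _ => c
  | add e f, σ => e.eval σ + f.eval σ
  | sub e f, σ => e.eval σ - f.eval σ
  | arr k e, σ => σ.arrs k (e.eval σ)
  | adj e f, σ => adjBit G (e.eval σ) (f.eval σ)
  | ite c e f, σ => if c.eval σ ≠ 0 then e.eval σ else f.eval σ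
  | sum i e, σ => ∑ v ∈ Finset.range n, e.eval (σ.setVar i v)

/-- Apply `f 0`, …, `f (m - 1)` one after the other. -/
def iter {α : Type*} (f : ℕ → α → α) : ℕ → α → α
  | 0, x => x
  | m + 1, x => f m (iter f m x)

/-- The effect of a program when the labels are given by `H`. -/
noncomputable def Code.run : Code → Store → Store
  | assign i e, σ => σ.setVar i (e.eval G σ)
  | setArr k i e, σ =>
      σ.setArr k fun v => if v < n then e.eval G (σ.setVar i v) else σ.arrs k v
  | query i e, σ => (σ.setVar i (labelBit H (e.eval G σ))).tick
  | seq c d, σ => d.run (c.run σ)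
  | ite e c d, σ => if e.eval G σ ≠ 0 then c.run σ else d.run σ
  | loop i c, σ => iter (fun v τ => c.run (τ.setVar i v)) n σ

end Semantics

/-! ### Compilation to random-access machines -/

/-- Sequential composition of a list of programs. -/
def Prog.block (L : List Prog) : Prog := L.foldr Prog.seq Prog.skip

/-- Variable `i` is kept in register `2 * i + 2`; the value of the term ends up in register
`2 * j + 1`, and odd registers from there on are used for intermediate results.  Entry `v` of array
`k` is kept in memory cell `16 * v + k`. -/
def Term.compile : Term → ℕ → Prog
  | var i, j => .block [.const (2 * j + 1) 0, .add (2 * j + 1) (2 * i + 2) (2 * j + 1)]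
  | const c, j => .const (2 * j + 1) c
  | add e f, j => .block [e.compile j, f.compile (j + 1),
      .add (2 * j + 1) (2 * j + 1) (2 * j + 3)]
  | sub e f, j => .block [e.compile j, f.compile (j + 1),
      .sub (2 * j + 1) (2 * j + 1) (2 * j + 3)]
  | arr k e, j => .block [e.compile j, .add (2 * j + 1) (2 * j + 1) (2 * j + 1),
      .add (2 * j + 1) (2 * j + 1) (2 * j + 1), .add (2 * j + 1) (2 * j + 1) (2 * j + 1),
      .add (2 * j + 1) (2 * j + 1) (2 * j + 1), .const (2 * j + 3) k,
      .add (2 * j + 1) (2 * j + 1) (2 * j + 3), .load (2 * j + 1) (2 * j + 1)]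
  | adj e f, j => .block [e.compile j, f.compile (j + 1),
      .adj (2 * j + 1) (2 * j + 1) (2 * j + 3)]
  | ite c e f, j => .block [c.compile j, .ite (2 * j + 1) (e.compile j) (f.compile j)]
  | sum i e, j => .block [.const (2 * j + 1) 0, .add (2 * j + 3) (2 * i + 2) (2 * j + 1),
      .add (2 * j + 5) 0 (2 * j + 1), .const (2 * i + 2) 0,
      .while (2 * j + 5) (.block [e.compile (j + 3), .add (2 * j + 1) (2 * j + 1) (2 * j + 7),
        .const (2 * j + 7) 1, .add (2 * i + 2) (2 * i + 2) (2 * j + 7),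
        .sub (2 * j + 5) (2 * j + 5) (2 * j + 7)]),
      .const (2 * j + 7) 0, .add (2 * i + 2) (2 * j + 3) (2 * j + 7)]

/-- The machine state `s` represents the store `σ` in a run on `n` vertices. -/
def Represents (n : ℕ) (σ : Store) (s : State) : Prop :=
  s.reg 0 = n ∧ (∀ i, s.reg (2 * i + 2) = σ.vars i) ∧
    ∀ (k : Fin 15) (v : ℕ), s.mem (16 * v + k) = σ.arrs k v

theorem Represents.congr {n : ℕ} {σ : Store} {s s' : State} (h : Represents n σ s)
    (hr : ∀ r, r % 2 = 0 → s'.reg r = s.reg r) (hm : s'.mem = s.mem) : Represents n σ s' :=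
  ⟨(hr 0 rfl).trans h.1, fun i => (hr _ (by omega)).trans (h.2.1 i), fun k v => by
    rw [hm]; exact h.2.2 k v⟩

theorem State.setReg_reg (s : State) (i x r : ℕ) :
    (s.setReg i x).reg r = if r = i then x else s.reg r := by
  simp [State.setReg, Function.update_apply]

theorem State.setReg_mem (s : State) (i x : ℕ) : (s.setReg i x).mem = s.mem := rfl

theorem State.setMem_reg (s : State) (a x : ℕ) : (s.setMem a x).reg = s.reg := rfl

theorem State.setMem_mem (s : State) (a x c : ℕ) :
    (s.setMem a x).mem c = if c = a then x else s.mem c := by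
  simp [State.setMem, Function.update_apply]

theorem Store.setVar_vars (σ : Store) (i x r : ℕ) :
    (σ.setVar i x).vars r = if r = i then x else σ.vars r := by
  simp [Store.setVar, Function.update_apply]

section Correctness

variable {n : ℕ} {G : SimpleGraph (Fin n)} {H : Finset (Fin n)}

/-- A `while` loop with a register `c` that counts down from `m`. -/
theorem exec_while_countdown {c m T : ℕ} {P : Prog} (I : ℕ → State → ℕ → Prop)
    (hstep : ∀ k < m, ∀ s q, I k s q → s.reg c = m - k → ∃ s' t q', Exec G H P s s' t q' ∧
      I (k + 1) s' (q + q') ∧ s'.reg c = m - (k + 1) ∧ t ≤ T)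
    {s : State} (h0 : I 0 s 0) (hc : s.reg c = m) :
    ∃ s' t q, Exec G H (.while c P) s s' t q ∧ I m s' q ∧ t ≤ m * (T + 1) + 1 := by
  have key : ∀ r k, k + r = m → ∀ s q, I k s q → s.reg c = m - k →
      ∃ s' t q', Exec G H (.while c P) s s' t q' ∧ I m s' (q + q') ∧ t ≤ r * (T + 1) + 1 := by
    intro r
    induction r with
    | zero =>
      intro k hk s q hI hs
      obtain rfl : k = m := by omega
      exact ⟨s, 1, 0, .whileFalse (by omega), hI, by omega⟩
    | succ r ih =>
      intro k hk s q hI hs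
      obtain ⟨s', t, q', hP, hI', hs', ht⟩ := hstep k (by omega) s q hI hs
      obtain ⟨s'', t', q'', hW, hI'', ht'⟩ := ih (k + 1) (by omega) s' (q + q') hI' hs'
      refine ⟨s'', _, _, .whileTrue (by omega) hP hW, by rwa [← add_assoc], ?_⟩
      rw [Nat.succ_mul]
      omega
  obtain ⟨s', t, q, h1, h2, h3⟩ := key m 0 (by omega) s 0 h0 (by omega)
  exact ⟨s', t, q, h1, by rwa [zero_add] at h2, h3⟩

/-- Registers that are available to the caller of a term evaluation at level `j` keep their
values, and so does the memory. -/
def Preserves (j : ℕ) (s s' : State) : Prop :=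
  (∀ r, r % 2 = 0 ∨ r < 2 * j + 1 → s'.reg r = s.reg r) ∧ s'.mem = s.mem

theorem Preserves.represents {j : ℕ} {s s' : State} (h : Preserves j s s') {σ : Store}
    (hs : Represents n σ s) : Represents n σ s' :=
  hs.congr (fun r hr => h.1 r (.inl hr)) h.2

/-- The compiled term computes its value in polynomial time, without queries. -/
theorem Term.exec_compile (e : Term) : ∃ p : Polynomial ℕ, ∀ (n : ℕ) (G : SimpleGraph (Fin n))
    (H : Finset (Fin n)) (j : ℕ) (σ : Store) (s : State), Represents n σ s →
    ∃ s' t, Exec G H (e.compile j) s s' t 0 ∧ s'.reg (2 * j + 1) = e.eval G σ ∧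
      Preserves j s s' ∧ t ≤ p.eval n := by
  have hbin : ∀ {e f : Term} (p q : Polynomial ℕ), (∀ (n : ℕ) (G : SimpleGraph (Fin n))
      (H : Finset (Fin n)) (j : ℕ) (σ : Store) (s : State), Represents n σ s →
      ∃ s' t, Exec G H (e.compile j) s s' t 0 ∧ s'.reg (2 * j + 1) = e.eval G σ ∧
        Preserves j s s' ∧ t ≤ p.eval n) → (∀ (n : ℕ) (G : SimpleGraph (Fin n))
      (H : Finset (Fin n)) (j : ℕ) (σ : Store) (s : State), Represents n σ s →
      ∃ s' t, Exec G H (f.compile j) s s' t 0 ∧ s'.reg (2 * j + 1) = f.eval G σ ∧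
        Preserves j s s' ∧ t ≤ q.eval n) → ∀ (n : ℕ) (G : SimpleGraph (Fin n))
      (H : Finset (Fin n)) (j : ℕ) (σ : Store) (s : State), Represents n σ s →
      ∃ s₁ t₁ s₂ t₂, Exec G H (e.compile j) s s₁ t₁ 0 ∧ Exec G H (f.compile (j + 1)) s₁ s₂ t₂ 0 ∧
        s₂.reg (2 * j + 1) = e.eval G σ ∧ s₂.reg (2 * j + 3) = f.eval G σ ∧ Preserves j s s₂ ∧
        t₁ + t₂ ≤ p.eval n + q.eval n := by
    intro e f p q he hf n G H j σ s hs
    obtain ⟨s₁, t₁, h1, v1, k1, b1⟩ := he n G H j σ s hs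
    obtain ⟨s₂, t₂, h2, v2, k2, b2⟩ := hf n G H (j + 1) σ s₁ (k1.represents hs)
    refine ⟨s₁, t₁, s₂, t₂, h1, h2, ?_, v2, ⟨fun r hr => ?_, k2.2.trans k1.2⟩, by omega⟩
    · rw [k2.1 _ (.inr (by omega)), v1]
    · rw [k2.1 r (by omega), k1.1 r hr]
  induction e with
  | var i =>
    refine ⟨3, fun n G H j σ s hs => ⟨_, _, .seq (.const _ _ _) (.seq (.add _ _ _ _) (.skip _)),
      ?_, ⟨fun r hr => ?_, rfl⟩, by simp⟩⟩
    · have := hs.2.1 i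
      simp only [State.setReg_reg, eval]
      split_ifs <;> omega
    · simp only [State.setReg_reg]
      split_ifs <;> omega
  | const c =>
    refine ⟨1, fun n G H j σ s hs => ⟨_, _, .const _ _ _, ?_, ⟨fun r hr => ?_, rfl⟩, by simp⟩⟩
    · simp [State.setReg_reg, eval]
    · simp only [State.setReg_reg]
      split_ifs <;> omega
  | add e f he hf =>
    obtain ⟨p, hp⟩ := he
    obtain ⟨q, hq⟩ := hf
    refine ⟨p + q + 2, fun n G H j σ s hs => ?_⟩
    obtain ⟨s₁, t₁, s₂, t₂, h1, h2, v1, v2, k, b⟩ := hbin p q hp hq n G H j σ s hs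
    refine ⟨_, _, .seq h1 (.seq h2 (.seq (.add _ _ _ _) (.skip _))), ?_, ⟨fun r hr => ?_, k.2⟩, ?_⟩
    · simp [State.setReg_reg, eval, v1, v2]
    · rw [← k.1 r hr]
      simp only [State.setReg_reg]
      split_ifs <;> omega
    · simp; omega
  | sub e f he hf =>
    obtain ⟨p, hp⟩ := he
    obtain ⟨q, hq⟩ := hf
    refine ⟨p + q + 2, fun n G H j σ s hs => ?_⟩
    obtain ⟨s₁, t₁, s₂, t₂, h1, h2, v1, v2, k, b⟩ := hbin p q hp hq n G H j σ s hs
    refine ⟨_, _, .seq h1 (.seq h2 (.seq (.sub _ _ _ _) (.skip _))), ?_, ⟨fun r hr => ?_, k.2⟩, ?_⟩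
    · simp [State.setReg_reg, eval, v1, v2]
    · rw [← k.1 r hr]
      simp only [State.setReg_reg]
      split_ifs <;> omega
    · simp; omega
  | arr k e he =>
    obtain ⟨p, hp⟩ := he
    refine ⟨p + 8, fun n G H j σ s hs => ?_⟩
    obtain ⟨s₁, t₁, h1, v1, k1, b1⟩ := hp n G H j σ s hs
    refine ⟨_, _, .seq h1 (.seq (.add _ _ _ _) (.seq (.add _ _ _ _) (.seq (.add _ _ _ _)
      (.seq (.add _ _ _ _) (.seq (.const _ _ _) (.seq (.add _ _ _ _) (.seq (.load _ _ _)
      (.skip _)))))))), ?_, ⟨fun r hr => ?_, k1.2⟩, ?_⟩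
    · rw [eval, ← (k1.represents hs).2.2 k, ← v1]
      simp only [State.setReg_reg, State.setReg_mem, if_true]
      rw [if_neg (by omega)]
      congr 1
      ring
    · rw [← k1.1 r hr]
      simp only [State.setReg_reg]
      split_ifs <;> omega
    · simp; omega
  | adj e f he hf =>
    obtain ⟨p, hp⟩ := he
    obtain ⟨q, hq⟩ := hf
    refine ⟨p + q + 2, fun n G H j σ s hs => ?_⟩
    obtain ⟨s₁, t₁, s₂, t₂, h1, h2, v1, v2, k, b⟩ := hbin p q hp hq n G H j σ s hs
    refine ⟨_, _, .seq h1 (.seq h2 (.seq (.adj _ _ _ _) (.skip _))), ?_, ⟨fun r hr => ?_, k.2⟩, ?_⟩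
    · simp [State.setReg_reg, eval, v1, v2]
    · rw [← k.1 r hr]
      simp only [State.setReg_reg]
      split_ifs <;> omega
    · simp; omega
  | ite c e f hc he hf =>
    obtain ⟨p, hp⟩ := hc
    obtain ⟨q, hq⟩ := he
    obtain ⟨r, hr⟩ := hf
    refine ⟨p + q + r + 2, fun n G H j σ s hs => ?_⟩
    obtain ⟨s₁, t₁, h1, v1, k1, b1⟩ := hp n G H j σ s hs
    by_cases h0 : c.eval G σ = 0
    · obtain ⟨s₂, t₂, h2, v2, k2, b2⟩ := hr n G H j σ s₁ (k1.represents hs)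
      refine ⟨_, _, .seq h1 (.seq (.iteFalse (by rw [v1, h0]) h2) (.skip _)), ?_,
        ⟨fun r hr => (k2.1 r hr).trans (k1.1 r hr), k2.2.trans k1.2⟩, ?_⟩
      · simp [eval, h0, v2]
      · simp; omega
    · obtain ⟨s₂, t₂, h2, v2, k2, b2⟩ := hq n G H j σ s₁ (k1.represents hs)
      refine ⟨_, _, .seq h1 (.seq (.iteTrue (by rw [v1]; exact h0) h2) (.skip _)), ?_,
        ⟨fun r hr => (k2.1 r hr).trans (k1.1 r hr), k2.2.trans k1.2⟩, ?_⟩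
      · simp [eval, h0, v2]
      · simp; omega
  | sum i e he =>
    obtain ⟨p, hp⟩ := he
    refine ⟨Polynomial.X * (p + 6) + 9, fun n G H j σ s hs => ?_⟩
    let I : ℕ → State → ℕ → Prop := fun k s' q => q = 0 ∧ Represents n (σ.setVar i k) s' ∧
      s'.reg (2 * j + 1) = ∑ v ∈ Finset.range k, e.eval G (σ.setVar i v) ∧
      s'.reg (2 * j + 3) = σ.vars i ∧
      (∀ r, r % 2 = 0 ∨ r < 2 * j + 1 → r ≠ 2 * i + 2 → s'.reg r = s.reg r) ∧ s'.mem = s.mem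
    have hstep : ∀ k < n, ∀ s' q, I k s' q → s'.reg (2 * j + 5) = n - k →
        ∃ s'' t q', Exec G H (.block [e.compile (j + 3), .add (2 * j + 1) (2 * j + 1) (2 * j + 7),
          .const (2 * j + 7) 1, .add (2 * i + 2) (2 * i + 2) (2 * j + 7),
          .sub (2 * j + 5) (2 * j + 5) (2 * j + 7)]) s' s'' t q' ∧ I (k + 1) s'' (q + q') ∧
          s''.reg (2 * j + 5) = n - (k + 1) ∧ t ≤ p.eval n + 5 := by
      rintro k hk s' q ⟨rfl, hr, hacc, hsave, hkeep, hmem⟩ hcnt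
      obtain ⟨s₁, t₁, h1, v1, k1, b1⟩ := hp n G H (j + 3) _ s' hr
      change s₁.reg (2 * j + 7) = _ at v1
      have e1 := k1.1 (2 * j + 1) (by omega)
      have e3 := k1.1 (2 * j + 3) (by omega)
      have e5 := k1.1 (2 * j + 5) (by omega)
      have ei := k1.1 (2 * i + 2) (by omega)
      refine ⟨_, _, _, .seq h1 (.seq (.add _ _ _ _) (.seq (.const _ _ _) (.seq (.add _ _ _ _)
        (.seq (.sub _ _ _ _) (.skip _))))), ⟨rfl, ⟨?_, fun i' => ?_, fun k' v => ?_⟩, ?_, ?_,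
        fun r hr' hri => ?_, k1.2.trans hmem⟩, ?_, ?_⟩
      · have h0 := k1.1 0 (by omega)
        simp only [State.setReg_reg]
        rw [if_neg (by omega), if_neg (by omega), if_neg (by omega), if_neg (by omega), h0, hr.1]
      · have h0 := k1.1 (2 * i' + 2) (by omega)
        have h1 := hr.2.1 i'
        rw [Store.setVar_vars] at h1 ⊢
        simp only [State.setReg_reg]
        by_cases hii : i' = i
        · subst hii
          simp only [if_true] at h1 ⊢
          split_ifs <;> omega
        · rw [if_neg hii] at h1 ⊢
          split_ifs <;> omega
      · exact (k1.represents hr).2.2 k' v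
      · rw [Finset.sum_range_succ, ← hacc, ← v1]
        simp only [State.setReg_reg]
        split_ifs <;> omega
      · simp only [State.setReg_reg]
        split_ifs <;> omega
      · rw [← hkeep r hr' hri, ← k1.1 r (by omega)]
        simp only [State.setReg_reg]
        split_ifs <;> omega
      · simp only [State.setReg_reg]
        split_ifs <;> omega
      · omega
    have hvar := hs.2.1 i
    have hn := hs.1
    set s₀ := (((s.setReg (2 * j + 1) 0).setReg (2 * j + 3) (s.reg (2 * i + 2))).setReg
      (2 * j + 5) (s.reg 0)).setReg (2 * i + 2) 0 with hs₀
    have h0 : I 0 s₀ 0 := by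
      refine ⟨rfl, ⟨?_, fun i' => ?_, fun k' v => hs.2.2 k' v⟩, ?_, ?_, fun r hr' hri => ?_, rfl⟩
      · simp [hs₀, State.setReg_reg, hn]
      · have h1 := hs.2.1 i'
        rw [Store.setVar_vars, ← h1]
        simp only [hs₀, State.setReg_reg]
        split_ifs <;> omega
      · simp only [hs₀, State.setReg_reg]
        rw [if_neg (by omega), if_neg (by omega), if_neg (by omega), if_pos trivial]
        simp
      · simp only [hs₀, State.setReg_reg]
        rw [if_neg (by omega), if_neg (by omega), if_pos trivial, hvar]
      · simp only [hs₀, State.setReg_reg]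
        rw [if_neg (by omega), if_neg (by omega), if_neg (by omega), if_neg (by omega)]
    have hc : s₀.reg (2 * j + 5) = n := by
      simp only [hs₀, State.setReg_reg]
      rw [if_neg (by omega), if_pos trivial, hn]
    obtain ⟨s', t, q, hW, ⟨rfl, hr, hacc, hsave, hkeep, hmem⟩, ht⟩ :=
      exec_while_countdown I hstep h0 hc
    have hpre : Exec G H (.add (2 * j + 3) (2 * i + 2) (2 * j + 1)) (s.setReg (2 * j + 1) 0)
        ((s.setReg (2 * j + 1) 0).setReg (2 * j + 3) (s.reg (2 * i + 2))) 1 0 := by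
      convert Exec.add (G := G) (H := H) (s.setReg (2 * j + 1) 0) (2 * j + 3) (2 * i + 2)
        (2 * j + 1) using 2
      simp only [State.setReg_reg]
      split_ifs <;> omega
    have hpre' : Exec G H (.add (2 * j + 5) 0 (2 * j + 1))
        ((s.setReg (2 * j + 1) 0).setReg (2 * j + 3) (s.reg (2 * i + 2)))
        (((s.setReg (2 * j + 1) 0).setReg (2 * j + 3) (s.reg (2 * i + 2))).setReg (2 * j + 5)
          (s.reg 0)) 1 0 := by
      convert Exec.add (G := G) (H := H) ((s.setReg (2 * j + 1) 0).setReg (2 * j + 3)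
        (s.reg (2 * i + 2))) (2 * j + 5) 0 (2 * j + 1) using 2
      simp only [State.setReg_reg]
      rw [if_neg (by omega), if_neg (by omega), if_neg (by omega), if_pos trivial, add_zero]
    refine ⟨_, _, .seq (.const _ _ _) (.seq hpre (.seq hpre' (.seq (.const _ _ _) (.seq hW
      (.seq (.const _ _ _) (.seq (.add _ _ _ _) (.skip _))))))), ?_, ⟨fun r hr' => ?_, hmem⟩, ?_⟩
    · rw [eval, ← hacc]
      simp only [State.setReg_reg]
      split_ifs <;> omega
    · by_cases hri : r = 2 * i + 2
      · subst hri
        rw [hvar, ← hsave]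
        simp only [State.setReg_reg]
        split_ifs <;> omega
      · rw [← hkeep r hr' hri]
        simp only [State.setReg_reg]
        split_ifs <;> omega
    · simp only [Polynomial.eval_add, Polynomial.eval_mul, Polynomial.eval_X,
        Polynomial.eval_ofNat]
      have : p.eval n + 5 + 1 = p.eval n + 6 := rfl
      rw [this] at ht
      omega
end Correctness

/-- Runs `P` once for every vertex, with the vertex in register `2 * j + 5`. -/
def Prog.forVertices (j : ℕ) (P : Prog) : Prog :=
  .block [.const (2 * j + 1) 0, .add (2 * j + 3) 0 (2 * j + 1), .const (2 * j + 5) 0,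
    .while (2 * j + 3) (.block [P, .const (2 * j + 1) 1, .add (2 * j + 5) (2 * j + 5) (2 * j + 1),
      .sub (2 * j + 3) (2 * j + 3) (2 * j + 1)])]

/-- Puts the address `16 * R[i] + k` into register `2 * j + 1`. -/
def Prog.address (j i k : ℕ) : Prog :=
  .block [.add (2 * j + 1) i i, .add (2 * j + 1) (2 * j + 1) (2 * j + 1),
    .add (2 * j + 1) (2 * j + 1) (2 * j + 1), .add (2 * j + 1) (2 * j + 1) (2 * j + 1),
    .const (2 * j + 3) k, .add (2 * j + 1) (2 * j + 1) (2 * j + 3)]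

/-- Puts the content of register `i` into register `x`; register `2 * j + 1` is used. -/
def Prog.move (j x i : ℕ) : Prog :=
  .block [.const (2 * j + 1) 0, .add x i (2 * j + 1)]

/-- The compiled program keeps the odd registers below `2 * j + 1`.  A simultaneous assignment to
an array goes through the cells `16 * v + 15`, which belong to no array. -/
def Code.compile : Code → ℕ → Prog
  | assign i e, j => .block [e.compile j, .move (j + 1) (2 * i + 2) (2 * j + 1)]
  | setArr k i e, j => .block [.move (j + 1) (2 * j + 1) (2 * i + 2),
      .forVertices (j + 1) (.block [.move (j + 1) (2 * i + 2) (2 * j + 7), e.compile (j + 4),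
        .address (j + 5) (2 * j + 7) 15, .store (2 * j + 11) (2 * j + 9)]),
      .move (j + 1) (2 * i + 2) (2 * j + 1),
      .forVertices (j + 1) (.block [.address (j + 4) (2 * j + 7) 15, .load (2 * j + 3) (2 * j + 9),
        .address (j + 4) (2 * j + 7) k, .store (2 * j + 9) (2 * j + 3)])]
  | query i e, j => .block [e.compile j, .query (2 * i + 2) (2 * j + 1)]
  | seq c d, j => .block [c.compile j, d.compile j]
  | ite e c d, j => .block [e.compile j, .ite (2 * j + 1) (c.compile j) (d.compile j)]
  | loop i c, j => .forVertices j
      (.block [.move j (2 * i + 2) (2 * j + 5), c.compile (j + 3)])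

section Correctness

variable {n : ℕ} {G : SimpleGraph (Fin n)} {H : Finset (Fin n)}

theorem exec_move {j x i : ℕ} (hi : i ≠ 2 * j + 1) (s : State) :
    Exec G H (.move j x i) s ((s.setReg (2 * j + 1) 0).setReg x (s.reg i)) 3 0 := by
  have h : Exec G H (.move j x i) s _ _ _ := .seq (.const _ _ _) (.seq (.add _ _ _ _) (.skip _))
  simpa [State.setReg_reg, hi] using h

theorem exec_address {j i k : ℕ} (s : State) :
    ∃ s', Exec G H (.address j i k) s s' 7 0 ∧ s'.reg (2 * j + 1) = 16 * s.reg i + k ∧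
      Preserves j s s' := by
  refine ⟨_, .seq (.add _ _ _ _) (.seq (.add _ _ _ _) (.seq (.add _ _ _ _) (.seq (.add _ _ _ _)
    (.seq (.const _ _ _) (.seq (.add _ _ _ _) (.skip _)))))), ?_, fun r hr => ?_, rfl⟩
  · simp only [State.setReg_reg, if_true]
    rw [if_neg (by omega)]
    ring
  · simp only [State.setReg_reg]
    rw [if_neg (by omega), if_neg (by omega), if_neg (by omega), if_neg (by omega),
      if_neg (by omega), if_neg (by omega)]

/-- A loop over all vertices whose invariant does not depend on the registers that it uses. -/
theorem exec_forVertices {j T : ℕ} {P : Prog} (I : ℕ → State → ℕ → Prop)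
    (hI : ∀ k s s' q, Preserves j s s' → I k s q → I k s' q)
    (hP : ∀ k < n, ∀ s q, I k s q → s.reg (2 * j + 5) = k → ∃ s' t q', Exec G H P s s' t q' ∧
      I (k + 1) s' (q + q') ∧ s'.reg (2 * j + 3) = s.reg (2 * j + 3) ∧ s'.reg (2 * j + 5) = k ∧
      t ≤ T) {s : State} (h0 : I 0 s 0) (hs : s.reg 0 = n) :
    ∃ s' t q, Exec G H (.forVertices j P) s s' t q ∧ I n s' q ∧ t ≤ n * (T + 5) + 5 := by
  let J : ℕ → State → ℕ → Prop := fun k s q => I k s q ∧ s.reg (2 * j + 5) = k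
  have hstep : ∀ k < n, ∀ s q, J k s q → s.reg (2 * j + 3) = n - k → ∃ s' t q',
      Exec G H (.block [P, .const (2 * j + 1) 1, .add (2 * j + 5) (2 * j + 5) (2 * j + 1),
        .sub (2 * j + 3) (2 * j + 3) (2 * j + 1)]) s s' t q' ∧ J (k + 1) s' (q + q') ∧
      s'.reg (2 * j + 3) = n - (k + 1) ∧ t ≤ T + 4 := by
    rintro k hk s q ⟨hIk, hix⟩ hc
    obtain ⟨s', t, q', hex, hI', h3, h5, ht⟩ := hP k hk s q hIk hix
    refine ⟨_, _, _, .seq hex (.seq (.const _ _ _) (.seq (.add _ _ _ _) (.seq (.sub _ _ _ _)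
      (.skip _)))), ⟨hI _ s' _ _ ⟨fun r hr => ?_, rfl⟩ hI', ?_⟩, ?_, by omega⟩
    · simp only [State.setReg_reg]
      rw [if_neg (by omega), if_neg (by omega), if_neg (by omega)]
    · simp only [State.setReg_reg, if_true]
      rw [if_neg (by omega), if_neg (by omega), h5]
    · simp only [State.setReg_reg, if_true]
      rw [if_neg (by omega), if_neg (by omega), if_neg (by omega), h3, hc]
      omega
  set s₀ := ((s.setReg (2 * j + 1) 0).setReg (2 * j + 3) n).setReg (2 * j + 5) 0 with hs₀
  have hJ : J 0 s₀ 0 := by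
    refine ⟨hI _ s _ _ ⟨fun r hr => ?_, rfl⟩ h0, ?_⟩
    · simp only [hs₀, State.setReg_reg]
      rw [if_neg (by omega), if_neg (by omega), if_neg (by omega)]
    · simp [hs₀, State.setReg_reg]
  have hc : s₀.reg (2 * j + 3) = n := by
    simp only [hs₀, State.setReg_reg, if_true]
    rw [if_neg (by omega)]
  obtain ⟨s', t, q, hW, hJ', ht⟩ := exec_while_countdown J hstep hJ hc
  have hadd : Exec G H (.add (2 * j + 3) 0 (2 * j + 1)) (s.setReg (2 * j + 1) 0)
      ((s.setReg (2 * j + 1) 0).setReg (2 * j + 3) n) 1 0 := by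
    have := Exec.add (G := G) (H := H) (s.setReg (2 * j + 1) 0) (2 * j + 3) 0 (2 * j + 1)
    rwa [State.setReg_reg, State.setReg_reg, if_neg (by omega), if_pos rfl, hs] at this
  refine ⟨s', _, _, .seq (.const _ _ _) (.seq hadd (.seq (.const _ _ _) (.seq hW (.skip _)))),
    by simpa using hJ'.1, ?_⟩
  have : n * (T + 4 + 1) = n * (T + 5) := rfl
  omega

/-- Odd registers below `2 * j + 1` keep their values. -/
def KeepsLow (j : ℕ) (s s' : State) : Prop := ∀ r < 2 * j + 1, r % 2 = 1 → s'.reg r = s.reg r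

theorem Represents.setReg_odd {σ : Store} {s : State} (h : Represents n σ s) {r : ℕ}
    (hr : r % 2 = 1) (x : ℕ) : Represents n σ (s.setReg r x) :=
  h.congr (fun r' hr' => by rw [State.setReg_reg, if_neg (by omega)]) rfl

theorem Represents.setVar {σ : Store} {s : State} (h : Represents n σ s) (i x : ℕ) :
    Represents n (σ.setVar i x) (s.setReg (2 * i + 2) x) := by
  refine ⟨?_, fun i' => ?_, h.2.2⟩
  · rw [State.setReg_reg, if_neg (by omega), h.1]
  · rw [State.setReg_reg, Store.setVar_vars, ← h.2.1 i']
    split_ifs <;> first | rfl | omega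

theorem Represents.setMem_scratch {σ : Store} {s : State} (h : Represents n σ s) (v x : ℕ) :
    Represents n σ (s.setMem (16 * v + 15) x) :=
  ⟨h.1, h.2.1, fun k u => by rw [State.setMem_mem, if_neg (by omega), h.2.2]⟩

theorem Represents.setMem {σ : Store} {s : State} (h : Represents n σ s) (k : Fin 15) (v x : ℕ) :
    Represents n (σ.setArr k (Function.update (σ.arrs k) v x)) (s.setMem (16 * v + k) x) := by
  refine ⟨h.1, h.2.1, fun k' u => ?_⟩
  rw [State.setMem_mem]
  simp only [Store.setArr]
  by_cases hk : k' = k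
  · subst hk
    rw [Function.update_self, Function.update_apply, ← h.2.2]
    split_ifs <;> first | rfl | omega
  · rw [Function.update_of_ne hk, ← h.2.2, if_neg]
    intro h'
    exact hk (Fin.ext (by omega))

theorem Code.exec_compile_setArr (k : Fin 15) (i : ℕ) (e : Term) : ∃ p : Polynomial ℕ,
    ∀ (n : ℕ) (G : SimpleGraph (Fin n)) (H : Finset (Fin n)) (j : ℕ) (σ : Store) (s : State),
      Represents n σ s → ∃ s' t, Exec G H ((Code.setArr k i e).compile j) s s' t 0 ∧
        Represents n ((Code.setArr k i e).run G H σ) s' ∧ KeepsLow j s s' ∧ t ≤ p.eval n := by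
  obtain ⟨p, hp⟩ := e.exec_compile
  refine ⟨Polynomial.X * (p + 17) + Polynomial.X * 22 + 17, fun n G H j σ s hs => ?_⟩
  -- the first loop computes the new entries
  let s₁ := (s.setReg (2 * (j + 1) + 1) 0).setReg (2 * j + 1) (s.reg (2 * i + 2))
  have hs₁ : Represents n σ s₁ := (hs.setReg_odd (by omega) _).setReg_odd (by omega) _
  let I : ℕ → State → ℕ → Prop := fun v s' q => q = 0 ∧ (∃ x, Represents n (σ.setVar i x) s') ∧
    (∀ u < v, s'.mem (16 * u + 15) = e.eval G (σ.setVar i u)) ∧ KeepsLow (j + 1) s₁ s'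
  have hI : ∀ v s s' q, Preserves (j + 1) s s' → I v s q → I v s' q := by
    rintro v s s' q hss ⟨rfl, ⟨x, hx⟩, hmem, hlow⟩
    exact ⟨rfl, ⟨x, hss.represents hx⟩, by rw [hss.2]; exact hmem,
      fun r hr hr' => (hss.1 r (.inr hr)).trans (hlow r hr hr')⟩
  have h1 : ∀ v < n, ∀ s q, I v s q → s.reg (2 * (j + 1) + 5) = v → ∃ s' t q', Exec G H
      (.block [.move (j + 1) (2 * i + 2) (2 * j + 7), e.compile (j + 4),
        .address (j + 5) (2 * j + 7) 15, .store (2 * j + 11) (2 * j + 9)]) s s' t q' ∧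
      I (v + 1) s' (q + q') ∧ s'.reg (2 * (j + 1) + 3) = s.reg (2 * (j + 1) + 3) ∧
      s'.reg (2 * (j + 1) + 5) = v ∧ t ≤ p.eval n + 12 := by
    rintro v hv s' q ⟨rfl, ⟨x, hx⟩, hmem, hlow⟩ hix
    have hx' : Represents n (σ.setVar i v)
        ((s'.setReg (2 * (j + 1) + 1) 0).setReg (2 * i + 2) (s'.reg (2 * j + 7))) := by
      have := (hx.setReg_odd (r := 2 * (j + 1) + 1) (by omega) 0).setVar i (s'.reg (2 * j + 7))
      rw [show s'.reg (2 * j + 7) = v from hix] at this ⊢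
      simpa [Store.setVar] using this
    obtain ⟨s₂, t, h2, v2, k2, b2⟩ := hp n G H (j + 4) _ _ hx'
    obtain ⟨s₃, h3, v3, k3⟩ := exec_address (G := G) (H := H) (j := j + 5) (i := 2 * j + 7)
      (k := 15) s₂
    have a2 : ∀ r < 2 * j + 9, r % 2 = 1 → r ≠ 2 * j + 3 → s₂.reg r = s'.reg r := by
      intro r hr hr' h
      rw [k2.1 r (.inr (by omega)), State.setReg_reg, if_neg (by omega), State.setReg_reg,
        if_neg (by omega)]
    have a3 : ∀ r < 2 * j + 9, r % 2 = 1 → r ≠ 2 * j + 3 → s₃.reg r = s'.reg r := by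
      intro r hr hr' h
      rw [k3.1 r (.inr (by omega)), a2 r hr hr' h]
    have v3' : s₃.reg (2 * j + 11) = 16 * v + 15 := by
      rw [← hix, ← a2 (2 * (j + 1) + 5) (by omega) (by omega) (by omega)]
      exact v3
    have v2' : s₃.reg (2 * j + 9) = e.eval G (σ.setVar i v) := by
      rw [k3.1 _ (.inr (by omega))]
      exact v2
    refine ⟨_, _, _, .seq (exec_move (by omega) _) (.seq h2 (.seq h3 (.seq (.store _ _ _)
      (.skip _)))), ⟨rfl, ⟨v, ?_⟩, fun u hu => ?_, fun r hr hr' => ?_⟩, ?_, ?_, by omega⟩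
    · rw [v3']
      exact (k3.represents (k2.represents hx')).setMem_scratch _ _
    · rw [v3', v2', State.setMem_mem]
      split_ifs with h
      · rw [show u = v by omega]
      · rw [k3.2, k2.2, ← hmem u (by omega)]
        rfl
    · rw [State.setMem_reg, a3 r (by omega) hr' (by omega), hlow r hr hr']
    · rw [State.setMem_reg, a3 _ (by omega) (by omega) (by omega)]
    · rw [State.setMem_reg, a3 _ (by omega) (by omega) (by omega), hix]
  have h0 : I 0 s₁ 0 := ⟨rfl, ⟨σ.vars i, by simpa [Store.setVar] using hs₁⟩, by simp,
    fun r _ _ => rfl⟩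
  obtain ⟨s₂, t₂, q₂, hex₂, ⟨rfl, ⟨x, hx⟩, hmem, hlow⟩, ht₂⟩ := exec_forVertices I hI h1 h0 hs₁.1
  -- the second loop copies them
  let s₃ := (s₂.setReg (2 * (j + 1) + 1) 0).setReg (2 * i + 2) (s₂.reg (2 * j + 1))
  have hs₃ : Represents n σ s₃ := by
    have h := (hx.setReg_odd (r := 2 * (j + 1) + 1) (by omega) 0).setVar i (s₂.reg (2 * j + 1))
    have : s₂.reg (2 * j + 1) = σ.vars i := by
      rw [hlow _ (by omega) (by omega), ← hs.2.1 i]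
      simp [s₁, State.setReg_reg]
    rw [this] at h
    simpa [Store.setVar, s₃, this] using h
  let f : ℕ → ℕ → ℕ := fun m v => if v < m then e.eval G (σ.setVar i v) else σ.arrs k v
  let J : ℕ → State → ℕ → Prop := fun v s' q => q = 0 ∧ Represents n (σ.setArr k (f v)) s' ∧
    (∀ u < n, s'.mem (16 * u + 15) = e.eval G (σ.setVar i u)) ∧ KeepsLow j s s'
  have hJ : ∀ v s s' q, Preserves (j + 1) s s' → J v s q → J v s' q := by
    rintro v s s' q hss ⟨rfl, hx, hmem, hlow⟩
    exact ⟨rfl, hss.represents hx, by rw [hss.2]; exact hmem,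
      fun r hr hr' => (hss.1 r (.inr (by omega))).trans (hlow r hr hr')⟩
  have h2 : ∀ v < n, ∀ s q, J v s q → s.reg (2 * (j + 1) + 5) = v → ∃ s' t q', Exec G H
      (.block [.address (j + 4) (2 * j + 7) 15, .load (2 * j + 3) (2 * j + 9),
        .address (j + 4) (2 * j + 7) k, .store (2 * j + 9) (2 * j + 3)]) s s' t q' ∧
      J (v + 1) s' (q + q') ∧ s'.reg (2 * (j + 1) + 3) = s.reg (2 * (j + 1) + 3) ∧
      s'.reg (2 * (j + 1) + 5) = v ∧ t ≤ 17 := by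
    rintro v hv s' q ⟨rfl, hx, hmem, hlow⟩ hix
    obtain ⟨s₄, h4, v4, k4⟩ := exec_address (G := G) (H := H) (j := j + 4) (i := 2 * j + 7)
      (k := 15) s'
    have k5 : s₄.mem (s₄.reg (2 * j + 9)) = e.eval G (σ.setVar i v) := by
      rw [show s₄.reg (2 * j + 9) = 16 * s'.reg (2 * j + 7) + 15 from v4,
        show s'.reg (2 * j + 7) = v from hix, k4.2, hmem v hv]
    obtain ⟨s₅, h5, v5, k6⟩ := exec_address (G := G) (H := H) (j := j + 4) (i := 2 * j + 7)
      (k := k) (s₄.setReg (2 * j + 3) (s₄.mem (s₄.reg (2 * j + 9))))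
    have a5 : ∀ r < 2 * j + 9, r ≠ 2 * j + 3 → s₅.reg r = s'.reg r := fun r hr hr' => by
      rw [k6.1 r (.inr (by omega)), State.setReg_reg, if_neg hr', k4.1 r (.inr (by omega))]
    have v5' : s₅.reg (2 * j + 9) = 16 * v + k := by
      rw [show s₅.reg (2 * j + 9) = _ from v5, State.setReg_reg, if_neg (by omega),
        k4.1 _ (.inr (by omega)), show s'.reg (2 * j + 7) = v from hix]
    have v6 : s₅.reg (2 * j + 3) = e.eval G (σ.setVar i v) := by
      rw [k6.1 _ (.inr (by omega)), State.setReg_reg, if_pos rfl, k5]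
    have hm5 : s₅.mem = s'.mem := k6.2.trans k4.2
    refine ⟨_, _, _, .seq h4 (.seq (.load _ _ _) (.seq h5 (.seq (.store _ _ _) (.skip _)))),
      ⟨rfl, ?_, fun u hu => ?_, fun r hr hr' => ?_⟩, ?_, ?_, by omega⟩
    · rw [v5', v6]
      have := (k6.represents ((k4.represents hx).setReg_odd (r := 2 * j + 3) (by omega)
        (s₄.mem (s₄.reg (2 * j + 9))))).setMem k v (e.eval G (σ.setVar i v))
      convert this using 1
      simp only [Store.setArr, Function.update_idem, Function.update_self]
      congr 2
      funext u
      simp only [f, Function.update_apply]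
      split_ifs <;> first | rfl | omega | (subst_vars; rfl)
    · rw [v5', State.setMem_mem, if_neg (by omega), hm5, hmem u hu]
    · rw [State.setMem_reg, a5 r (by omega) (by omega), hlow r hr hr']
    · rw [State.setMem_reg, a5 _ (by omega) (by omega)]
    · rw [State.setMem_reg, a5 _ (by omega) (by omega), hix]
  have h0' : J 0 s₃ 0 := by
    refine ⟨rfl, ?_, hmem, fun r hr hr' => ?_⟩
    · simpa [f, Store.setArr] using hs₃
    · simp only [s₃, State.setReg_reg]
      rw [if_neg (by omega), if_neg (by omega), hlow r (by omega) hr']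
      simp only [s₁, State.setReg_reg]
      by_cases h : r = 2 * j + 1
      · omega
      · rw [if_neg h, if_neg (by omega)]
  obtain ⟨s₄, t₄, q₄, hex₄, ⟨rfl, hr₄, -, hlow₄⟩, ht₄⟩ := exec_forVertices J hJ h2 h0' hs₃.1
  refine ⟨s₄, _, .seq (exec_move (by omega) _) (.seq hex₂ (.seq (exec_move (by omega) _)
    (.seq hex₄ (.skip _)))), hr₄, hlow₄, ?_⟩
  simp only [Polynomial.eval_add, Polynomial.eval_mul, Polynomial.eval_X, Polynomial.eval_ofNat]
  have : n * (p.eval n + 12 + 5) = n * (p.eval n + 17) := rfl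
  omega

/-- The compiled program simulates the program in polynomial time, with the same queries. -/
theorem Code.exec_compile (c : Code) : ∃ p : Polynomial ℕ, ∀ (n : ℕ) (G : SimpleGraph (Fin n))
    (H : Finset (Fin n)) (j : ℕ) (σ : Store) (s : State), Represents n σ s →
    ∃ s' t q, Exec G H (c.compile j) s s' t q ∧ Represents n (c.run G H σ) s' ∧
      KeepsLow j s s' ∧ σ.cnt + q = (c.run G H σ).cnt ∧ t ≤ p.eval n := by
  induction c with
  | assign i e =>
    obtain ⟨p, hp⟩ := e.exec_compile
    refine ⟨p + 4, fun n G H j σ s hs => ?_⟩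
    obtain ⟨s₁, t₁, h1, v1, k1, b1⟩ := hp n G H j σ s hs
    refine ⟨_, _, _, .seq h1 (.seq (exec_move (by omega) _) (.skip _)), ?_, fun r hr hr' => ?_,
      rfl, ?_⟩
    · rw [v1]
      exact ((k1.represents hs).setReg_odd (by omega) _).setVar i _
    · rw [State.setReg_reg, if_neg (by omega), State.setReg_reg, if_neg (by omega),
        k1.1 r (.inr hr)]
    · simp; omega
  | setArr k i e =>
    obtain ⟨p, hp⟩ := Code.exec_compile_setArr k i e
    refine ⟨p, fun n G H j σ s hs => ?_⟩
    obtain ⟨s', t, h1, h2, h3, h4⟩ := hp n G H j σ s hs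
    exact ⟨s', t, 0, h1, h2, h3, rfl, h4⟩
  | query i e =>
    obtain ⟨p, hp⟩ := e.exec_compile
    refine ⟨p + 2, fun n G H j σ s hs => ?_⟩
    obtain ⟨s₁, t₁, h1, v1, k1, b1⟩ := hp n G H j σ s hs
    refine ⟨_, _, _, .seq h1 (.seq (.query _ _ _) (.skip _)), ?_, fun r hr hr' => ?_, rfl, ?_⟩
    · rw [v1]
      exact (k1.represents hs).setVar i _
    · rw [State.setReg_reg, if_neg (by omega), k1.1 r (.inr hr)]
    · simp; omega
  | seq c d hc hd =>
    obtain ⟨p, hp⟩ := hc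
    obtain ⟨q, hq⟩ := hd
    refine ⟨p + q + 1, fun n G H j σ s hs => ?_⟩
    obtain ⟨s₁, t₁, q₁, h1, r1, k1, c1, b1⟩ := hp n G H j σ s hs
    obtain ⟨s₂, t₂, q₂, h2, r2, k2, c2, b2⟩ := hq n G H j _ s₁ r1
    refine ⟨_, _, _, .seq h1 (.seq h2 (.skip _)), r2,
      fun r hr hr' => (k2 r hr hr').trans (k1 r hr hr'), ?_, ?_⟩
    · rw [run, ← c2, ← c1, add_zero, add_assoc]
    · simp; omega
  | ite e c d hc hd =>
    obtain ⟨r, hr⟩ := e.exec_compile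
    obtain ⟨p, hp⟩ := hc
    obtain ⟨q, hq⟩ := hd
    refine ⟨r + p + q + 2, fun n G H j σ s hs => ?_⟩
    obtain ⟨s₁, t₁, h1, v1, k1, b1⟩ := hr n G H j σ s hs
    by_cases h0 : e.eval G σ = 0
    · obtain ⟨s₂, t₂, q₂, h2, r2, k2, c2, b2⟩ := hq n G H j σ s₁ (k1.represents hs)
      refine ⟨_, _, _, .seq h1 (.seq (.iteFalse (by rw [v1, h0]) h2) (.skip _)), ?_,
        fun r hr hr' => (k2 r hr hr').trans (k1.1 r (.inr hr)), ?_, ?_⟩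
      · simpa [run, h0] using r2
      · simpa [run, h0] using c2
      · simp; omega
    · obtain ⟨s₂, t₂, q₂, h2, r2, k2, c2, b2⟩ := hp n G H j σ s₁ (k1.represents hs)
      refine ⟨_, _, _, .seq h1 (.seq (.iteTrue (by rw [v1]; exact h0) h2) (.skip _)), ?_,
        fun r hr hr' => (k2 r hr hr').trans (k1.1 r (.inr hr)), ?_, ?_⟩
      · simpa [run, h0] using r2
      · simpa [run, h0] using c2
      · simp; omega
  | loop i c hc =>
    obtain ⟨p, hp⟩ := hc
    refine ⟨Polynomial.X * (p + 9) + 5, fun n G H j σ s hs => ?_⟩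
    let I : ℕ → State → ℕ → Prop := fun v s' q =>
      Represents n (iter (fun v τ => c.run G H (τ.setVar i v)) v σ) s' ∧ KeepsLow j s s' ∧
        σ.cnt + q = (iter (fun v τ => c.run G H (τ.setVar i v)) v σ).cnt
    have hI : ∀ v s s' q, Preserves j s s' → I v s q → I v s' q := by
      rintro v s s' q hss ⟨hr, hlow, hcnt⟩
      exact ⟨hss.represents hr, fun r hr hr' => (hss.1 r (.inr hr)).trans (hlow r hr hr'), hcnt⟩
    obtain ⟨s', t, q, hex, ⟨h1, h2, h3⟩, ht⟩ := exec_forVertices (G := G) (H := H)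
      (P := .block [.move j (2 * i + 2) (2 * j + 5), c.compile (j + 3)]) (T := p.eval n + 4) I hI
      (fun v hv s' q => by
        rintro ⟨hr, hlow, hcnt⟩ hix
        have hr' := (hr.setReg_odd (r := 2 * j + 1) (by omega) 0).setVar i v
        obtain ⟨s₁, t₁, q₁, h1, r1, k1, c1, b1⟩ := hp n G H (j + 3) _ _ hr'
        have hm := exec_move (G := G) (H := H) (j := j) (x := 2 * i + 2) (i := 2 * j + 5)
          (by omega) s'
        rw [hix] at hm
        have keep : ∀ r < 2 * j + 7, r % 2 = 1 → r ≠ 2 * j + 1 → s₁.reg r = s'.reg r := by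
          intro r hr hr' h
          rw [k1 r (by omega) hr', State.setReg_reg, if_neg (by omega), State.setReg_reg,
            if_neg h]
        refine ⟨_, _, _, .seq hm (.seq h1 (.skip _)),
          ⟨r1, fun r hr hr' => ?_, ?_⟩, keep _ (by omega) (by omega) (by omega), ?_, by omega⟩
        · rw [keep r (by omega) hr' (by omega), hlow r hr hr']
        · rw [iter, ← c1, Store.setVar]
          simp only
          omega
        · rw [keep _ (by omega) (by omega) (by omega), hix])
      ⟨hs, fun _ _ _ => rfl, rfl⟩ hs.1
    refine ⟨s', t, q, hex, h1, h2, h3, ?_⟩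
    simp only [Polynomial.eval_add, Polynomial.eval_mul, Polynomial.eval_X, Polynomial.eval_ofNat]
    exact ht

end Correctness

/-- The store in which all values are zero. -/
def Store.init : Store := ⟨fun _ => 0, fun _ _ => 0, 0⟩

theorem represents_init (n : ℕ) : Represents n Store.init (State.init n) :=
  ⟨by simp [State.init], fun i => by simp [State.init, Store.init], fun _ _ => rfl⟩

/-- The compiled program followed by a loop that moves array `0` to the place for the output.  Cell
`v` is overwritten only after cell `16 * v` has been read. -/
def Code.toProg (c : Code) : Prog :=
  .block [c.compile 0, .forVertices 0 (.block [.address 3 5 0, .load 7 7, .store 5 7])]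

/-- Array `0` is the output of the machine. -/
theorem Code.outputs_toProg (c : Code) : ∃ p : Polynomial ℕ, ∀ (n : ℕ) (G : SimpleGraph (Fin n))
    (H S : Finset (Fin n)), (∀ v : Fin n, v ∈ S ↔ (c.run G H Store.init).arrs 0 v ≠ 0) →
    ∃ t, Outputs G H c.toProg S t (c.run G H Store.init).cnt ∧ t ≤ p.eval n := by
  obtain ⟨p, hp⟩ := c.exec_compile
  refine ⟨p + Polynomial.X * 15 + 6, fun n G H S hS => ?_⟩
  obtain ⟨s₁, t₁, q₁, h1, r1, -, c1, b1⟩ := hp n G H 0 _ _ (represents_init n)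
  let I : ℕ → State → ℕ → Prop := fun v s q => q = 0 ∧ (∀ u < v, s.mem u = s₁.mem (16 * u)) ∧
    ∀ a ≥ v, s.mem a = s₁.mem a
  have hI : ∀ v s s' q, Preserves 0 s s' → I v s q → I v s' q := by
    rintro v s s' q hss ⟨rfl, h2, h3⟩
    exact ⟨rfl, by rwa [hss.2], by rwa [hss.2]⟩
  obtain ⟨s₂, t₂, q₂, hex, ⟨rfl, h2, -⟩, b2⟩ := exec_forVertices (G := G) (H := H)
    (P := .block [.address 3 5 0, .load 7 7, .store 5 7]) (j := 0) (T := 10) I hI (by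
      rintro v hv s q ⟨rfl, h2, h3⟩ hix
      obtain ⟨s', h4, v4, k4⟩ := exec_address (G := G) (H := H) (j := 3) (i := 5) (k := 0) s
      change s.reg 5 = v at hix
      change s'.reg 7 = _ at v4
      have h5 : s'.reg 5 = v := (k4.1 5 (by omega)).trans hix
      refine ⟨_, _, _, .seq h4 (.seq (.load _ _ _) (.seq (.store _ _ _) (.skip _))),
        ⟨rfl, fun u hu => ?_, fun a ha => ?_⟩, ?_, ?_, by omega⟩
      · simp only [State.setMem_mem, State.setReg_reg, State.setReg_mem]
        norm_num
        rw [h5, v4, hix, k4.2]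
        split_ifs with h
        · rw [h3 _ (by omega), h, add_zero]
        · exact h2 u (by omega)
      · simp only [State.setMem_mem, State.setReg_reg, State.setReg_mem]
        norm_num
        rw [h5, if_neg (by omega), k4.2, h3 a (by omega)]
      · simp only [State.setMem_reg, State.setReg_reg]
        exact k4.1 3 (by omega)
      · simp only [State.setMem_reg, State.setReg_reg]
        exact h5) ⟨rfl, by simp, fun _ _ => rfl⟩ r1.1
  refine ⟨t₁ + (t₂ + 1), ⟨s₂, ?_, fun v => ?_⟩, ?_⟩
  · have := Exec.seq h1 (Exec.seq hex (Exec.skip _))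
    rwa [show q₁ + (0 + 0) = (c.run G H Store.init).cnt by rw [← c1, Store.init]; simp] at this
  · rw [hS, h2 v v.2, ← r1.2.2 0 v]
    rfl
  · simp only [Polynomial.eval_add, Polynomial.eval_mul, Polynomial.eval_X, Polynomial.eval_ofNat]
    omega

/-! ### Programs as query strategies -/

/-- Iteration in continuation-passing style. -/
def iterThen {α β : Type*} (f : ℕ → α → (α → β) → β) : ℕ → α → (α → β) → β
  | 0, x, k => k x
  | m + 1, x, k => iterThen f m x fun y => f m y k

open Classical in
/-- The query strategy that follows the program and then, in the store that is reached, the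
strategy `k`. -/
noncomputable def Code.strategy {n : ℕ} (G : SimpleGraph (Fin n)) :
    Code → Store → (Store → Strategy (Fin n)) → Strategy (Fin n)
  | assign i e, σ, k => k (σ.setVar i (e.eval G σ))
  | setArr a i e, σ, k =>
      k (σ.setArr a fun v => if v < n then e.eval G (σ.setVar i v) else σ.arrs a v)
  | query i e, σ, k =>
      if h : e.eval G σ < n then
        .query ⟨e.eval G σ, h⟩ (k (σ.setVar i 1).tick) (k (σ.setVar i 0).tick)
      else k (σ.setVar i 0).tick
  | seq c d, σ, k => c.strategy G σ fun τ => d.strategy G τ k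
  | ite e c d, σ, k => if e.eval G σ ≠ 0 then c.strategy G σ k else d.strategy G σ k
  | loop i c, σ, k => iterThen (fun v τ k => c.strategy G (τ.setVar i v) k) n σ k

/-- Following the program and running it lead to the same store. -/
theorem Code.strategy_spec {n : ℕ} (G : SimpleGraph (Fin n)) (H : Finset (Fin n)) (c : Code)
    (σ : Store) (k : Store → Strategy (Fin n)) :
    (c.strategy G σ k).result H = (k (c.run G H σ)).result H ∧
      (c.strategy G σ k).numQueries H + σ.cnt ≤
        (k (c.run G H σ)).numQueries H + (c.run G H σ).cnt := by
  induction c generalizing σ k with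
  | assign i e => exact ⟨rfl, le_rfl⟩
  | setArr a i e => exact ⟨rfl, le_rfl⟩
  | query i e =>
    simp only [strategy, run]
    by_cases h : e.eval G σ < n
    · by_cases hH : (⟨e.eval G σ, h⟩ : Fin n) ∈ H
      · have : labelBit H (e.eval G σ) = 1 := if_pos ⟨h, hH⟩
        simp only [h, dif_pos, Strategy.result, Strategy.numQueries, hH, if_true, this, true_and]
        simp only [Store.tick, Store.setVar]
        omega
      · have : labelBit H (e.eval G σ) = 0 := if_neg fun ⟨_, h'⟩ => hH h'
        simp only [h, dif_pos, Strategy.result, Strategy.numQueries, hH, if_false, this, true_and]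
        simp only [Store.tick, Store.setVar]
        omega
    · have : labelBit H (e.eval G σ) = 0 := if_neg fun ⟨h', _⟩ => h h'
      simp only [h, dif_neg, not_false_eq_true, this, true_and]
      simp only [Store.tick, Store.setVar]
      omega
  | seq c d hc hd =>
    obtain ⟨h1, h2⟩ := hc σ fun τ => d.strategy G τ k
    obtain ⟨h3, h4⟩ := hd (c.run G H σ) k
    exact ⟨h1.trans h3, by simp only [strategy, run]; omega⟩
  | ite e c d hc hd =>
    by_cases h : e.eval G σ = 0
    · simpa [strategy, run, h] using hd σ k
    · simpa [strategy, run, h] using hc σ k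
  | loop i c hc =>
    have key : ∀ (m : ℕ) (k : Store → Strategy (Fin n)),
        (iterThen (fun v τ k => c.strategy G (τ.setVar i v) k) m σ k).result H =
          (k (iter (fun v τ => c.run G H (τ.setVar i v)) m σ)).result H ∧
        (iterThen (fun v τ k => c.strategy G (τ.setVar i v) k) m σ k).numQueries H + σ.cnt ≤
          (k (iter (fun v τ => c.run G H (τ.setVar i v)) m σ)).numQueries H +
            (iter (fun v τ => c.run G H (τ.setVar i v)) m σ).cnt := by
      intro m
      induction m with
      | zero => exact fun k => ⟨rfl, le_rfl⟩
      | succ m ih =>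
        intro k
        obtain ⟨h1, h2⟩ := ih fun τ => c.strategy G (τ.setVar i m) k
        obtain ⟨h3, h4⟩ := hc ((iter (fun v τ => c.run G H (τ.setVar i v)) m σ).setVar i m) k
        exact ⟨h1.trans h3, h2.trans h4⟩
    exact key n k

/-! ### Logic of terms -/

namespace Term

/-- Negation. -/
def neg (e : Term) : Term := .ite e (.const 0) (.const 1)
/-- Conjunction. -/
def conj (e f : Term) : Term := .ite e f (.const 0)
/-- Disjunction. -/
def disj (e f : Term) : Term := .ite e (.const 1) f
/-- Universal quantification over the vertices. -/
def all (i : ℕ) (e : Term) : Term := neg (.sum i (neg e))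
/-- Comparison; truncated subtraction gives zero if and only if it holds. -/
def le (e f : Term) : Term := neg (.sub e f)
/-- Strict comparison; truncated subtraction is nonzero if and only if it holds. -/
def lt (e f : Term) : Term := .sub f e
/-- Equality of numbers. -/
def eq (e f : Term) : Term := conj (le e f) (le f e)
/-- The number of vertices `i` for which `e` is nonzero. -/
def count (i : ℕ) (e : Term) : Term := .sum i (.ite e (.const 1) (.const 0))
/-- The first vertex `i` for which `e` is nonzero, or the number of vertices if there is none:
vertices `i + 1` before it are counted. -/
def first (i : ℕ) (e : Term) : Term :=
  count (i + 1) (neg (.sum i (conj (le (.var i) (.var (i + 1))) e)))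

end Term

/-- The set of all vertices at which an array is nonzero. -/
def Store.supp {n : ℕ} (σ : Store) (k : Fin 15) : Set (Fin n) := {v | σ.arrs k v ≠ 0}

section Logic

variable {n : ℕ} {G : SimpleGraph (Fin n)} {H : Finset (Fin n)} {σ : Store}

@[simp] theorem Store.vars_setVar (i x r : ℕ) :
    (σ.setVar i x).vars r = if r = i then x else σ.vars r := σ.setVar_vars i x r

@[simp] theorem Store.arrs_setVar (i x : ℕ) : (σ.setVar i x).arrs = σ.arrs := rfl

@[simp] theorem Store.cnt_setVar (i x : ℕ) : (σ.setVar i x).cnt = σ.cnt := rfl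

@[simp] theorem Store.vars_tick : σ.tick.vars = σ.vars := rfl

@[simp] theorem Store.arrs_tick : σ.tick.arrs = σ.arrs := rfl

@[simp] theorem Store.cnt_tick : σ.tick.cnt = σ.cnt + 1 := rfl

@[simp] theorem Store.supp_setVar (i x : ℕ) (k : Fin 15) :
    (σ.setVar i x).supp k = (σ.supp k : Set (Fin n)) := rfl

@[simp] theorem Store.supp_tick (k : Fin 15) : σ.tick.supp k = (σ.supp k : Set (Fin n)) := rfl

@[simp] theorem Store.arrs_coe_eq_zero {k : Fin 15} {v : Fin n} :
    σ.arrs k v = 0 ↔ v ∉ σ.supp k := by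
  simp [supp]

@[simp] theorem adjBit_coe_eq_zero {u v : Fin n} : adjBit G u v = 0 ↔ ¬ G.Adj u v := by
  simp [adjBit]

/-- The truth value of a term. -/
def Term.Holds (G : SimpleGraph (Fin n)) (e : Term) (σ : Store) : Prop := e.eval G σ ≠ 0

namespace Term

variable {e f : Term} {i : ℕ}

@[simp] theorem eval_var : (var i).eval G σ = σ.vars i := rfl

@[simp] theorem eval_const : (const i).eval G σ = i := rfl

@[simp] theorem eval_add : (add e f).eval G σ = e.eval G σ + f.eval G σ := rfl

@[simp] theorem eval_sub : (sub e f).eval G σ = e.eval G σ - f.eval G σ := rfl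

@[simp] theorem eval_arr {k : Fin 15} : (arr k e).eval G σ = σ.arrs k (e.eval G σ) := rfl

theorem eval_ite_of_holds {c : Term} (h : c.Holds G σ) : (ite c e f).eval G σ = e.eval G σ :=
  if_pos h

theorem eval_ite_of_not_holds {c : Term} (h : ¬ c.Holds G σ) :
    (ite c e f).eval G σ = f.eval G σ := if_neg h

@[simp] theorem holds_ite {c : Term} :
    (ite c e f).Holds G σ ↔ (c.Holds G σ ∧ e.Holds G σ ∨ ¬ c.Holds G σ ∧ f.Holds G σ) := by
  by_cases h : c.eval G σ = 0 <;> simp [Holds, eval, h]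

@[simp] theorem holds_const : (const i).Holds G σ ↔ i ≠ 0 := Iff.rfl

@[simp] theorem holds_neg : e.neg.Holds G σ ↔ ¬ e.Holds G σ := by
  simp [neg]

@[simp] theorem holds_conj : (conj e f).Holds G σ ↔ e.Holds G σ ∧ f.Holds G σ := by
  simp [conj]

@[simp] theorem holds_disj : (disj e f).Holds G σ ↔ e.Holds G σ ∨ f.Holds G σ := by
  simp only [disj, holds_ite, holds_const]
  tauto

@[simp] theorem holds_sum :
    (sum i e).Holds G σ ↔ ∃ v : Fin n, e.Holds G (σ.setVar i v) := by
  simp only [Holds, eval, ne_eq, Finset.sum_eq_zero_iff, Finset.mem_range, not_forall]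
  exact ⟨fun ⟨v, hv, h⟩ => ⟨⟨v, hv⟩, h⟩, fun ⟨v, h⟩ => ⟨v, v.2, h⟩⟩

@[simp] theorem holds_all : (all i e).Holds G σ ↔ ∀ v : Fin n, e.Holds G (σ.setVar i v) := by
  simp [all]

@[simp] theorem holds_le : (le e f).Holds G σ ↔ e.eval G σ ≤ f.eval G σ := by
  simp [le, Holds, Nat.sub_eq_zero_iff_le, neg, eval]

@[simp] theorem holds_lt : (lt e f).Holds G σ ↔ e.eval G σ < f.eval G σ := by
  simp [lt, Holds, Nat.sub_eq_zero_iff_le]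

@[simp] theorem holds_eq : (eq e f).Holds G σ ↔ e.eval G σ = f.eval G σ := by
  simp [eq, le_antisymm_iff]

@[simp] theorem holds_arr {k : Fin 15} :
    (arr k e).Holds G σ ↔ σ.arrs k (e.eval G σ) ≠ 0 := Iff.rfl

@[simp] theorem holds_var : (var i).Holds G σ ↔ σ.vars i ≠ 0 := Iff.rfl

@[simp] theorem holds_adj :
    (adj e f).Holds G σ ↔ adjBit G (e.eval G σ) (f.eval G σ) ≠ 0 := Iff.rfl

@[simp] theorem eval_count :
    (count i e).eval G σ = {v : Fin n | e.Holds G (σ.setVar i v)}.ncard := by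
  classical
  have h : {v : Fin n | e.Holds G (σ.setVar i v)} =
      ((Finset.univ.filter fun v : Fin n => e.Holds G (σ.setVar i v) : Finset (Fin n)) :
        Set (Fin n)) := by
    ext v
    simp
  rw [h, Set.ncard_coe_finset, Finset.card_filter,
    Fin.sum_univ_eq_sum_range (fun v => if e.Holds G (σ.setVar i v) then 1 else 0)]
  exact Finset.sum_congr rfl fun v _ => if_congr Iff.rfl rfl rfl

/-- The hypothesis says that `e` does not depend on variable `i + 1`. -/
theorem eval_first (S : Set (Fin n))
    (hS : ∀ u v : Fin n, e.Holds G ((σ.setVar (i + 1) u).setVar i v) ↔ v ∈ S) :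
    (S = ∅ ∧ (first i e).eval G σ = n) ∨ ∃ z ∈ S, (first i e).eval G σ = z := by
  classical
  have h : (first i e).eval G σ = {u : Fin n | ∀ v ≤ u, v ∉ S}.ncard := by
    simp [first, hS]
  rw [h]
  rcases S.eq_empty_or_nonempty with rfl | hne
  · left
    simp [Set.ncard_univ]
  · right
    obtain ⟨z, hz, hmin⟩ := Set.exists_min_image S id (Set.toFinite _) hne
    refine ⟨z, hz, ?_⟩
    have : {u : Fin n | ∀ v ≤ u, v ∉ S} = Set.Iio z := by
      ext u
      simp only [Set.mem_ofPred_eq, Set.mem_Iio]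
      refine ⟨fun h => not_le.1 fun h' => h z h' hz, fun h v hv hvS => ?_⟩
      exact absurd (hmin v hvS) (not_le.2 (hv.trans_lt h))
    rw [this, Set.ncard_eq_toFinset_card']
    simp

end Term

end Logic

/-! ### Logic of programs -/

namespace Code

/-- The program that does nothing. -/
def skip : Code := .assign 0 (.var 0)

/-- Array `a` is not assigned to. -/
def keepsArr (a : Fin 15) : Code → Bool
  | assign _ _ => true
  | setArr k _ _ => k != a
  | query _ _ => true
  | seq c d => c.keepsArr a && d.keepsArr a
  | ite _ c d => c.keepsArr a && d.keepsArr a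
  | loop _ c => c.keepsArr a

/-- Variable `x` is not assigned to. -/
def keepsVar (x : ℕ) : Code → Bool
  | assign i _ => i != x
  | setArr _ _ _ => true
  | query i _ => i != x
  | seq c d => c.keepsVar x && d.keepsVar x
  | ite _ c d => c.keepsVar x && d.keepsVar x
  | loop i c => i != x && c.keepsVar x

/-- There are no queries. -/
def silent : Code → Bool
  | assign _ _ => true
  | setArr _ _ _ => true
  | query _ _ => false
  | seq c d => c.silent && d.silent
  | ite _ c d => c.silent && d.silent
  | loop _ c => c.silent

end Code

theorem iter_induction {α : Type*} {n : ℕ} {f : ℕ → α → α} {x : α} (I : ℕ → α → Prop) (h0 : I 0 x)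
    (hs : ∀ (v : Fin n) (y : α), I v y → I (v + 1) (f v y)) : I n (iter f n x) := by
  have : ∀ m ≤ n, I m (iter f m x) := by
    intro m hm
    induction m with
    | zero => exact h0
    | succ m ih => exact hs ⟨m, hm⟩ _ (ih (by omega))
  exact this n le_rfl

section Run

variable {n : ℕ} {G : SimpleGraph (Fin n)} {H : Finset (Fin n)} {σ : Store} {c d : Code}

namespace Code

theorem run_arrs {a : Fin 15} (h : c.keepsArr a = true) : (c.run G H σ).arrs a = σ.arrs a := by
  induction c generalizing σ with
  | assign i e => rfl
  | setArr k i e =>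
    have : a ≠ k := fun h' => by simp [keepsArr, h'] at h
    simp [run, Store.setArr, this]
  | query i e => rfl
  | seq c d hc hd =>
    simp only [keepsArr, Bool.and_eq_true] at h
    exact (hd h.2).trans (hc h.1)
  | ite e c d hc hd =>
    simp only [keepsArr, Bool.and_eq_true] at h
    rw [run]
    split_ifs
    exacts [hc h.1, hd h.2]
  | loop i c hc =>
    exact iter_induction (fun _ (τ : Store) => τ.arrs a = σ.arrs a) rfl fun v τ hτ =>
      (hc (by simpa [keepsArr] using h)).trans hτ

theorem run_supp {a : Fin 15} (h : c.keepsArr a = true) :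
    (c.run G H σ).supp a = (σ.supp a : Set (Fin n)) := by
  simp only [Store.supp, run_arrs h]

theorem run_vars {x : ℕ} (h : c.keepsVar x = true) : (c.run G H σ).vars x = σ.vars x := by
  induction c generalizing σ with
  | assign i e =>
    have : x ≠ i := fun h' => by simp [keepsVar, h'] at h
    simp [run, this]
  | setArr k i e => rfl
  | query i e =>
    have : x ≠ i := fun h' => by simp [keepsVar, h'] at h
    simp [run, this]
  | seq c d hc hd =>
    simp only [keepsVar, Bool.and_eq_true] at h
    exact (hd h.2).trans (hc h.1)
  | ite e c d hc hd =>
    simp only [keepsVar, Bool.and_eq_true] at h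
    rw [run]
    split_ifs
    exacts [hc h.1, hd h.2]
  | loop i c hc =>
    simp only [keepsVar, Bool.and_eq_true] at h
    have : x ≠ i := fun h' => by simp [h'] at h
    exact iter_induction (fun _ (τ : Store) => τ.vars x = σ.vars x) rfl fun v τ hτ =>
      (hc h.2).trans (by simpa [this] using hτ)

theorem run_cnt (h : c.silent = true) : (c.run G H σ).cnt = σ.cnt := by
  induction c generalizing σ with
  | assign i e => rfl
  | setArr k i e => rfl
  | query i e => simp [silent] at h
  | seq c d hc hd =>
    simp only [silent, Bool.and_eq_true] at h
    exact (hd h.2).trans (hc h.1)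
  | ite e c d hc hd =>
    simp only [silent, Bool.and_eq_true] at h
    rw [run]
    split_ifs
    exacts [hc h.1, hd h.2]
  | loop i c hc =>
    exact iter_induction (fun _ (τ : Store) => τ.cnt = σ.cnt) rfl fun v τ hτ =>
      (hc (by simpa [silent] using h)).trans hτ

@[simp] theorem run_skip : skip.run G H σ = σ := by
  simp [skip, run, Store.setVar]

@[simp] theorem run_assign (i : ℕ) (e : Term) :
    (assign i e).run G H σ = σ.setVar i (e.eval G σ) := rfl

@[simp] theorem run_seq : (seq c d).run G H σ = d.run G H (c.run G H σ) := rfl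

theorem run_ite_of_holds {e : Term} (h : e.Holds G σ) : (ite e c d).run G H σ = c.run G H σ :=
  if_pos h

theorem run_ite_of_not_holds {e : Term} (h : ¬ e.Holds G σ) :
    (ite e c d).run G H σ = d.run G H σ := if_neg h

@[simp] theorem vars_setArr (k : Fin 15) (i : ℕ) (e : Term) :
    ((setArr k i e).run G H σ).vars = σ.vars := rfl

@[simp] theorem cnt_setArr (k : Fin 15) (i : ℕ) (e : Term) :
    ((setArr k i e).run G H σ).cnt = σ.cnt := rfl

theorem arrs_setArr_self (k : Fin 15) (i : ℕ) (e : Term) (v : Fin n) :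
    ((setArr k i e).run G H σ).arrs k v = e.eval G (σ.setVar i v) := by
  simp [run, Store.setArr]

@[simp] theorem supp_setArr (k k' : Fin 15) (i : ℕ) (e : Term) :
    ((setArr k i e).run G H σ).supp k' =
      if k' = k then {v : Fin n | e.Holds G (σ.setVar i v)} else σ.supp k' := by
  split_ifs with h
  · subst h
    ext v
    simp only [Store.supp, Set.mem_ofPred_eq]
    rw [arrs_setArr_self]
    rfl
  · simp only [Store.supp, run, Store.setArr, Function.update_of_ne h]

@[simp] theorem arrs_setArr_of_ne {k k' : Fin 15} (h : k' ≠ k) (i : ℕ) (e : Term) :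
    ((setArr k i e).run G H σ).arrs k' = σ.arrs k' := by
  simp [run, Store.setArr, h]

/-- Reasoning about a loop with an invariant. -/
theorem run_loop_induction {i : ℕ} (I : ℕ → Store → Prop) (h0 : I 0 σ)
    (hs : ∀ (v : Fin n) (τ : Store), I v τ → I (v + 1) (c.run G H (τ.setVar i v))) :
    I n ((loop i c).run G H σ) :=
  iter_induction I h0 hs

end Code

end Run

/-! ### The consistency test -/

/-- The term for `force` of the arrays `k` and `l` at the vertex `e`. -/
def forceTerm (k l : Fin 15) (e : Term) : Term :=
  .disj
    (.sum 31 <| .sum 32 <| .sum 33 <| .conj (.arr k (.var 31)) <| .conj (.arr k (.var 32)) <|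
      .conj (.arr l (.var 33)) <| .conj (.neg (.eq (.var 31) (.var 32))) <|
      .conj (.neg (.adj (.var 31) (.var 32))) <| .conj (.adj (.var 31) e)
        (.adj (.var 32) (.var 33)))
    (.sum 31 <| .sum 32 <| .sum 33 <| .conj (.arr l (.var 31)) <| .conj (.arr k (.var 32)) <|
      .conj (.arr k (.var 33)) <| .conj (.neg (.eq e (.var 31))) <|
      .conj (.neg (.adj e (.var 31))) <| .conj (.adj e (.var 32)) (.adj (.var 31) (.var 33)))

namespace Code

/-- One round of propagation on the arrays `3` and `4`. -/
def propagate : Code :=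
  .seq (.setArr 3 20 (.disj (.arr 3 (.var 20)) (forceTerm 3 4 (.var 20))))
    (.setArr 4 20 (.disj (.arr 4 (.var 20)) (forceTerm 4 3 (.var 20))))

/-- Complete propagation on the arrays `3` and `4`. -/
def saturate : Code := .seq (.loop 11 propagate) (.loop 11 propagate)

/-- A positive and negative vertex in the arrays `3` and `4`. -/
def conflict : Term := .sum 20 (.conj (.arr 3 (.var 20)) (.arr 4 (.var 20)))

/-- Decide on a label for vertex `10`; the arrays `5` and `6` keep the previous labels. -/
def decideVertex : Code :=
  .ite (.disj (.arr 3 (.var 10)) (.arr 4 (.var 10))) skip <|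
    .seq (.setArr 5 20 (.arr 3 (.var 20))) <| .seq (.setArr 6 20 (.arr 4 (.var 20))) <|
    .seq (.setArr 3 20 (.disj (.eq (.var 20) (.var 10)) (.arr 3 (.var 20)))) <| .seq saturate <|
    .ite conflict
      (.seq (.setArr 3 20 (.arr 5 (.var 20))) <|
        .seq (.setArr 4 20 (.disj (.eq (.var 20) (.var 10)) (.arr 6 (.var 20)))) saturate)
      skip

/-- Sets variable `0` to a nonzero value if some halfspace has the positive labels in array `1` and
the negative labels in array `2`. -/
def solve : Code :=
  .seq (.setArr 3 20 (.arr 1 (.var 20))) <| .seq (.setArr 4 20 (.arr 2 (.var 20))) <|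
    .seq saturate <| .seq (.loop 10 decideVertex) <| .assign 0 (.neg conflict)

end Code

section Solve

variable {n : ℕ} {G : SimpleGraph (Fin n)} {H : Finset (Fin n)} {σ : Store}

theorem holds_forceTerm (k l : Fin 15) (v : Fin n) :
    (forceTerm k l (.var 20)).Holds G (σ.setVar 20 v) ↔ v ∈ force G (σ.supp k) (σ.supp l) := by
  simp [forceTerm, force, Fin.val_inj]

theorem run_propagate :
    (((Code.propagate.run G H σ).supp 3, (Code.propagate.run G H σ).supp 4) :
      Set (Fin n) × Set (Fin n)) = propagate G (σ.supp 3, σ.supp 4) := by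
  have h1 : ((Code.setArr 3 20 (.disj (.arr 3 (.var 20)) (forceTerm 3 4 (.var 20)))).run G H
      σ).supp 3 = (propagate G (σ.supp 3, σ.supp 4)).1 := by
    ext v
    simp [propagate, holds_forceTerm]
  ext v
  · simpa [Code.propagate] using Set.ext_iff.1 h1 v
  · have h2 : ((Code.setArr 3 20 (.disj (.arr 3 (.var 20)) (forceTerm 3 4 (.var 20)))).run G H
        σ).supp 4 = (σ.supp 4 : Set (Fin n)) := Code.run_supp rfl
    simp only [Code.propagate, Code.run_seq]
    rw [Code.supp_setArr, if_pos rfl]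
    simp only [Set.mem_ofPred_eq, Term.holds_disj, holds_forceTerm]
    rw [h1, h2]
    simp [propagate]

theorem run_saturate :
    (((Code.saturate.run G H σ).supp 3, (Code.saturate.run G H σ).supp 4) :
      Set (Fin n) × Set (Fin n)) = saturate G (σ.supp 3, σ.supp 4) := by
  have h1 : ∀ τ : Store, ((((Code.loop 11 .propagate).run G H τ).supp 3,
      ((Code.loop 11 .propagate).run G H τ).supp 4) : Set (Fin n) × Set (Fin n)) =
      (propagate G)^[n] (τ.supp 3, τ.supp 4) := by
    intro τ
    refine Code.run_loop_induction (fun k ρ => ((ρ.supp 3, ρ.supp 4) : Set (Fin n) × Set (Fin n)) =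
      (propagate G)^[k] (τ.supp 3, τ.supp 4)) rfl fun v ρ hρ => ?_
    rw [Function.iterate_succ_apply', ← hρ, run_propagate]
    rfl
  rw [Code.saturate, Code.run_seq, h1, h1, ← Function.iterate_add_apply, saturate,
    Fintype.card_fin, two_mul]

theorem holds_conflict : Code.conflict.Holds G σ ↔
    ¬ ∀ x ∈ (σ.supp 3 : Set (Fin n)), x ∉ (σ.supp 4 : Set (Fin n)) := by
  simp [Code.conflict]

theorem run_decideVertex {z : Fin n} (hz : σ.vars 10 = z) :
    (((Code.decideVertex.run G H σ).supp 3, (Code.decideVertex.run G H σ).supp 4) :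
      Set (Fin n) × Set (Fin n)) = decideVertex G z (σ.supp 3, σ.supp 4) := by
  classical
  rw [decideVertex, Code.decideVertex]
  by_cases h1 : z ∈ (σ.supp 3 : Set (Fin n)) ∨ z ∈ (σ.supp 4 : Set (Fin n))
  · rw [Code.run_ite_of_holds (by simpa [hz] using h1), if_pos h1, Code.run_skip]
  rw [Code.run_ite_of_not_holds (by simpa [hz] using h1), if_neg h1]
  simp only [Code.run_seq]
  set τ := (Code.setArr 3 20 (.disj (.eq (.var 20) (.var 10)) (.arr 3 (.var 20)))).run G H
    ((Code.setArr 6 20 (.arr 4 (.var 20))).run G H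
      ((Code.setArr 5 20 (.arr 3 (.var 20))).run G H σ)) with hτ
  have t3 : (τ.supp 3 : Set (Fin n)) = insert z (σ.supp 3) := by
    ext v
    simp [hτ, hz, Fin.val_inj]
  have t4 : (τ.supp 4 : Set (Fin n)) = σ.supp 4 := by
    simp [hτ]
  have t5 : (τ.supp 5 : Set (Fin n)) = σ.supp 3 := by
    ext v
    simp [hτ]
  have t6 : (τ.supp 6 : Set (Fin n)) = σ.supp 4 := by
    ext v
    simp [hτ]
  have t10 : τ.vars 10 = z := by simp [hτ, hz]
  have hs := run_saturate (G := G) (H := H) (σ := τ)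
  rw [t3, t4] at hs
  rw [← hs]
  set ρ := Code.saturate.run G H τ with hρ
  have r5 : (ρ.supp 5 : Set (Fin n)) = σ.supp 3 := (Code.run_supp rfl).trans t5
  have r6 : (ρ.supp 6 : Set (Fin n)) = σ.supp 4 := (Code.run_supp rfl).trans t6
  have r10 : ρ.vars 10 = z := (Code.run_vars rfl).trans t10
  by_cases h2 : ∀ x ∈ (ρ.supp 3 : Set (Fin n)), x ∉ (ρ.supp 4 : Set (Fin n))
  · rw [if_pos h2, Code.run_ite_of_not_holds (by rw [holds_conflict]; exact not_not.2 h2),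
      Code.run_skip]
  · rw [if_neg h2, Code.run_ite_of_holds (holds_conflict.2 h2)]
    simp only [Code.run_seq]
    rw [run_saturate]
    congr 1
    refine Prod.ext ?_ ?_
    · ext v
      simp [r5]
    · ext v
      simp [r6, r10, Fin.val_inj]

/-- The greedy assignment of labels succeeds if and only if some halfspace has the given labels. -/
theorem run_solve {a b : Fin n} (hab : G.Adj a b) (ha : a ∈ (σ.supp 1 : Set (Fin n)))
    (hb : b ∈ (σ.supp 2 : Set (Fin n))) :
    (Code.solve.run G H σ).vars 0 ≠ 0 ↔ Satisfiable G (σ.supp 1) (σ.supp 2) := by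
  simp only [Code.solve, Code.run_seq]
  set τ := (Code.setArr 4 20 (.arr 2 (.var 20))).run G H
    ((Code.setArr 3 20 (.arr 1 (.var 20))).run G H σ) with hτ
  have t3 : (τ.supp 3 : Set (Fin n)) = σ.supp 1 := by
    ext v
    simp [hτ]
  have t4 : (τ.supp 4 : Set (Fin n)) = σ.supp 2 := by
    ext v
    simp [hτ]
  have hs := run_saturate (G := G) (H := H) (σ := τ)
  rw [t3, t4] at hs
  set s₀ : Set (Fin n) × Set (Fin n) := (σ.supp 1, σ.supp 2) with hs₀
  set ρ := Code.saturate.run G H τ with hρ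
  obtain ⟨h1, h2⟩ := Code.run_loop_induction (G := G) (H := H) (i := 10) (σ := ρ)
    (c := .decideVertex) (fun k π => Extends G s₀ (π.supp 3, π.supp 4) ∧
      ∀ v : Fin n, (v : ℕ) < k → v ∈ π.supp 3 ∨ v ∈ π.supp 4)
    ⟨hs ▸ extends_saturate s₀, by simp⟩ (by
      rintro z π ⟨h1, h2⟩
      have h := run_decideVertex (G := G) (H := H) (σ := π.setVar 10 z) (z := z) (by simp)
      have h3 := h1.decideVertex hab ha hb z
      have h4 := le_decideVertex (G := G) z (π.supp 3, π.supp 4)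
      have h5 := decideVertex_total (G := G) z (π.supp 3, π.supp 4)
      simp only [Store.supp_setVar] at h
      rw [← h] at h3 h4 h5
      refine ⟨h3, fun v hv => ?_⟩
      rcases Nat.lt_succ_iff_lt_or_eq.1 hv with hv | hv
      · exact (h2 v hv).imp (fun h => h4.1 h) fun h => h4.2 h
      · rw [Fin.ext hv]
        exact h5)
  have h3 := h1.satisfiable_iff fun v => h2 v v.2
  rw [h3]
  simp only [Code.run_assign, Store.vars_setVar, if_true]
  change Term.Holds G _ _ ↔ _
  rw [Term.holds_neg, holds_conflict, not_not]

end Solve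

/-! ### A minimal set that hits all halfspaces -/

section Hitting

variable {V : Type*} {G : SimpleGraph V}

theorem HitsHalfspaces.mono {S T : Set V} (h : HitsHalfspaces G S) (hST : S ⊆ T) :
    HitsHalfspaces G T :=
  fun H hH hne hnu => (h H hH hne hnu).mono (Set.inter_subset_inter_left _ hST)

/-- Every halfspace other than `∅` and the vertex set cuts some edge `ab`. -/
theorem hitsHalfspaces_iff (hG : G.Connected) {S : Set V} :
    HitsHalfspaces G S ↔ ∀ a b, G.Adj a b → ¬ Satisfiable G {a} (insert b S) := by
  constructor
  · rintro h a b - ⟨H, hH, ha, hb⟩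
    obtain ⟨x, hxS, hxH⟩ := h H hH ⟨a, ha rfl⟩ fun h' => hb b (Set.mem_insert _ _) (h' ▸ trivial)
    exact hb x (Set.mem_insert_of_mem _ hxS) hxH
  · intro h H hH ⟨u, hu⟩ hnu
    obtain ⟨v, hv⟩ := (Set.ne_univ_iff_exists_notMem H).1 hnu
    obtain ⟨a, b, hab, ha, hb⟩ := exists_adj_mem_notMem hG hu hv
    by_contra hc
    refine h a b hab ⟨H, hH, Set.singleton_subset_iff.2 ha, ?_⟩
    rintro x (rfl | hx) hxH
    exacts [hb hxH, hc ⟨x, hx, hxH⟩]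

end Hitting

namespace Code

/-- Sets variable `5` to a nonzero value if the set in array `9` without the vertex in variable `12`
misses a halfspace that cuts the edge in the variables `13` and `14`. -/
def checkEdge : Code :=
  .ite (.adj (.var 13) (.var 14))
    (.seq (.setArr 1 20 (.eq (.var 20) (.var 13))) <|
      .seq (.setArr 2 20 (.disj (.eq (.var 20) (.var 14))
        (.conj (.arr 9 (.var 20)) (.neg (.eq (.var 20) (.var 12)))))) <|
      .seq solve <| .ite (.var 0) (.assign 5 (.const 1)) skip) skip

/-- Sets variable `5` to a nonzero value if the set in array `9` without the vertex in variable `12`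
misses a halfspace. -/
def checkHits : Code :=
  .seq (.assign 5 (.const 0)) <| .loop 13 <| .loop 14 checkEdge

/-- Computes in array `9` a minimal set that hits all halfspaces, by greedy removal. -/
def minimalHitting : Code :=
  .seq (.setArr 9 20 (.const 1)) <| .loop 12 <| .seq checkHits <|
    .ite (.var 5) skip (.setArr 9 20 (.conj (.arr 9 (.var 20)) (.neg (.eq (.var 20) (.var 12)))))

/-- Queries the vertex in variable `3` and stores the answer in the arrays `7` and `8` of positive
and negative vertices. -/
def ask : Code :=
  .seq (.query 4 (.var 3)) <| .ite (.var 4)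
    (.setArr 7 20 (.disj (.eq (.var 20) (.var 3)) (.arr 7 (.var 20))))
    (.setArr 8 20 (.disj (.eq (.var 20) (.var 3)) (.arr 8 (.var 20))))

/-- Queries vertex `0` and the vertices of array `9`. -/
def askHitting : Code :=
  .loop 12 <| .ite (.disj (.arr 9 (.var 12)) (.eq (.var 12) (.const 0)))
    (.seq (.assign 3 (.var 12)) ask) skip

end Code

section Run

variable {n : ℕ} {G : SimpleGraph (Fin n)} {H : Finset (Fin n)} {σ : Store}

/-- A loop that looks for a vertex with the property `φ`. -/
theorem Code.run_loop_exists {i x : ℕ} {c : Code} {φ : Fin n → Prop} (hix : i ≠ x)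
    (K : Store → Prop) (hK : K σ)
    (hc : ∀ (v : Fin n) (τ : Store), K τ → K (c.run G H (τ.setVar i v)) ∧
      ((c.run G H (τ.setVar i v)).vars x ≠ 0 ↔ (τ.setVar i v).vars x ≠ 0 ∨ φ v)) :
    K ((loop i c).run G H σ) ∧
      (((loop i c).run G H σ).vars x ≠ 0 ↔ σ.vars x ≠ 0 ∨ ∃ v, φ v) := by
  have := Code.run_loop_induction (G := G) (H := H) (i := i) (σ := σ) (c := c)
    (fun k τ => K τ ∧ (τ.vars x ≠ 0 ↔ σ.vars x ≠ 0 ∨ ∃ v : Fin n, (v : ℕ) < k ∧ φ v))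
    ⟨hK, by simp⟩ (by
      rintro v τ ⟨h1, h2⟩
      obtain ⟨h3, h4⟩ := hc v τ h1
      refine ⟨h3, ?_⟩
      rw [h4, Store.vars_setVar, if_neg hix.symm, h2, or_assoc]
      refine or_congr_right ⟨?_, ?_⟩
      · rintro (⟨w, hw, h⟩ | h)
        exacts [⟨w, by omega, h⟩, ⟨v, by omega, h⟩]
      · rintro ⟨w, hw, h⟩
        rcases Nat.lt_succ_iff_lt_or_eq.1 hw with hw | hw
        · exact .inl ⟨w, hw, h⟩
        · exact .inr (Fin.ext hw ▸ h))
  refine ⟨this.1, this.2.trans (or_congr_right ?_)⟩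
  simp

theorem run_checkHits (hG : G.Connected) {z : Fin n} (hz : σ.vars 12 = z) :
    (Code.checkHits.run G H σ).vars 5 ≠ 0 ↔ ¬ HitsHalfspaces G (σ.supp 9 \ {z}) := by
  set Q : Set (Fin n) := σ.supp 9 with hQ
  rw [hitsHalfspaces_iff hG]
  push Not
  have h := (Code.run_loop_exists (G := G) (H := H) (i := 13) (x := 5)
    (σ := σ.setVar 5 0) (φ := fun a => ∃ b, G.Adj a b ∧ Satisfiable G {a} (insert b (Q \ {z})))
    (by omega) (fun τ => τ.vars 12 = z ∧ τ.supp 9 = Q) ⟨by simp [hz], rfl⟩ (fun a τ hτ => ?_)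
    (c := .loop 14 .checkEdge)).2
  · rw [Code.checkHits, Code.run_seq, Code.run_assign, Term.eval_const, h]
    simp
  have h := Code.run_loop_exists (G := G) (H := H) (i := 14) (x := 5) (σ := τ.setVar 13 a)
    (φ := fun b => G.Adj a b ∧ Satisfiable G {a} (insert b (Q \ {z})))
    (by omega) (fun τ => τ.vars 12 = z ∧ τ.supp 9 = Q ∧ τ.vars 13 = a)
    ⟨by simp [hτ.1], hτ.2, by simp⟩ (fun b τ hτ => ?_)
    (c := .checkEdge)
  · exact ⟨⟨h.1.1, h.1.2.1⟩, h.2⟩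
  refine ⟨⟨(Code.run_vars rfl).trans ?_, (Code.run_supp rfl).trans ?_,
    (Code.run_vars rfl).trans ?_⟩, ?_⟩
  · simp [hτ.1]
  · exact hτ.2.1
  · simp [hτ.2.2]
  rw [Code.checkEdge]
  by_cases hab : G.Adj a b
  · rw [Code.run_ite_of_holds (by simpa [hτ.2.2] using hab)]
    simp only [Code.run_seq]
    set ρ := (Code.setArr 2 20 (.disj (.eq (.var 20) (.var 14))
        (.conj (.arr 9 (.var 20)) (.neg (.eq (.var 20) (.var 12)))))).run G H
      ((Code.setArr 1 20 (.eq (.var 20) (.var 13))).run G H (τ.setVar 14 b)) with hρ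
    have h1 : (ρ.supp 1 : Set (Fin n)) = {a} := by
      ext v
      simp [hρ, hτ.2.2, Fin.val_inj]
    have h2 : (ρ.supp 2 : Set (Fin n)) = insert b (Q \ {z}) := by
      ext v
      simp [hρ, hτ.1, hτ.2.1, Fin.val_inj]
    have h5 : (Code.solve.run G H ρ).vars 5 = (τ.setVar 14 b).vars 5 := Code.run_vars rfl
    have h := run_solve (G := G) (H := H) (σ := ρ) hab (by rw [h1]; rfl)
      (by rw [h2]; exact Set.mem_insert _ _)
    rw [h1, h2] at h
    rw [← h, ← h5]
    by_cases hs : (Code.solve.run G H ρ).vars 0 = 0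
    · rw [Code.run_ite_of_not_holds (by simpa using hs), Code.run_skip]
      simp [hs]
    · rw [Code.run_ite_of_holds (by simpa using hs)]
      simp [hs, hab]
  · rw [Code.run_ite_of_not_holds (by simpa [hτ.2.2] using hab), Code.run_skip]
    simp [hab]

theorem run_minimalHitting (hG : G.Connected) :
    HitsHalfspaces G ((Code.minimalHitting.run G H σ).supp 9) ∧
      ∀ q ∈ ((Code.minimalHitting.run G H σ).supp 9 : Set (Fin n)),
        ¬ HitsHalfspaces G ((Code.minimalHitting.run G H σ).supp 9 \ {q}) := by
  rw [Code.minimalHitting, Code.run_seq]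
  have h := Code.run_loop_induction (G := G) (H := H) (i := 12)
    (σ := (Code.setArr 9 20 (.const 1)).run G H σ)
    (c := .seq .checkHits <| .ite (.var 5) .skip
      (.setArr 9 20 (.conj (.arr 9 (.var 20)) (.neg (.eq (.var 20) (.var 12))))))
    (fun k τ => HitsHalfspaces G (τ.supp 9) ∧ ∀ q ∈ (τ.supp 9 : Set (Fin n)), (q : ℕ) < k →
      ¬ HitsHalfspaces G (τ.supp 9 \ {q})) ⟨fun H' hH' hne _ => ?_, by simp⟩ ?_
  · exact ⟨h.1, fun q hq => h.2 q hq q.2⟩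
  · obtain ⟨x, hx⟩ := hne
    exact ⟨x, by simp, hx⟩
  · rintro z τ ⟨h1, h2⟩
    have h := run_checkHits (G := G) (H := H) hG (σ := τ.setVar 12 z) (z := z) (by simp)
    have h9 : ((Code.checkHits.run G H (τ.setVar 12 z)).supp 9 : Set (Fin n)) = τ.supp 9 :=
      Code.run_supp rfl
    have h12 : (Code.checkHits.run G H (τ.setVar 12 z)).vars 12 = z :=
      (Code.run_vars rfl).trans (by simp)
    rw [Store.supp_setVar] at h
    rw [Code.run_seq]
    by_cases hz : HitsHalfspaces G (τ.supp 9 \ {z})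
    · rw [Code.run_ite_of_not_holds (by simpa [hz] using h)]
      have : (((Code.setArr 9 20 (.conj (.arr 9 (.var 20)) (.neg (.eq (.var 20) (.var 12))))).run
          G H (Code.checkHits.run G H (τ.setVar 12 z))).supp 9 : Set (Fin n)) =
          τ.supp 9 \ {z} := by
        ext v
        simp [h9, h12, Fin.val_inj]
      rw [this]
      refine ⟨hz, fun q hq hqk hh => ?_⟩
      have hqz : q ≠ z := hq.2
      have : (q : ℕ) ≠ z := fun h => hqz (Fin.ext h)
      exact h2 q hq.1 (by omega) (hh.mono (Set.sdiff_subset_sdiff_left Set.sdiff_subset))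
    · rw [Code.run_ite_of_holds (by simpa [hz] using h), Code.run_skip, h9]
      refine ⟨h1, fun q hq hqk => ?_⟩
      rcases Nat.lt_succ_iff_lt_or_eq.1 hqk with hqk | hqk
      · exact h2 q hq hqk
      · rw [Fin.ext hqk]
        exact hz

/-- The arrays `7` and `8` hold correct labels. -/
def Knows (H : Finset (Fin n)) (σ : Store) : Prop :=
  σ.supp 7 ⊆ (H : Set (Fin n)) ∧ ∀ x ∈ (σ.supp 8 : Set (Fin n)), x ∉ (H : Set (Fin n))

theorem labelBit_coe {z : Fin n} : labelBit H z = if z ∈ H then 1 else 0 := by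
  simp [labelBit]

theorem run_ask_of_mem {z : Fin n} (hz : σ.vars 3 = z) (h : z ∈ H) :
    ((Code.ask.run G H σ).supp 7 : Set (Fin n)) = insert z (σ.supp 7) ∧
      ((Code.ask.run G H σ).supp 8 : Set (Fin n)) = σ.supp 8 ∧
      (Code.ask.run G H σ).cnt = σ.cnt + 1 := by
  have : (Code.query 4 (.var 3)).run G H σ = (σ.setVar 4 1).tick := by
    simp [Code.run, hz, labelBit_coe, h]
  rw [Code.ask, Code.run_seq, this, Code.run_ite_of_holds (by simp)]
  refine ⟨?_, by simp, by simp⟩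
  ext v
  simp [hz, Fin.val_inj]

theorem run_ask_of_notMem {z : Fin n} (hz : σ.vars 3 = z) (h : z ∉ H) :
    ((Code.ask.run G H σ).supp 7 : Set (Fin n)) = σ.supp 7 ∧
      ((Code.ask.run G H σ).supp 8 : Set (Fin n)) = insert z (σ.supp 8) ∧
      (Code.ask.run G H σ).cnt = σ.cnt + 1 := by
  have : (Code.query 4 (.var 3)).run G H σ = (σ.setVar 4 0).tick := by
    simp [Code.run, hz, labelBit_coe, h]
  rw [Code.ask, Code.run_seq, this, Code.run_ite_of_not_holds (by simp)]
  refine ⟨by simp, ?_, by simp⟩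
  ext v
  simp [hz, Fin.val_inj]

theorem Knows.ask (h : Knows H σ) {z : Fin n} (hz : σ.vars 3 = z) :
    Knows H (Code.ask.run G H σ) := by
  by_cases hzH : z ∈ H
  · obtain ⟨h7, h8, -⟩ := run_ask_of_mem (G := G) hz hzH
    exact ⟨by rw [h7]; exact Set.insert_subset hzH h.1, by rw [h8]; exact h.2⟩
  · obtain ⟨h7, h8, -⟩ := run_ask_of_notMem (G := G) hz hzH
    refine ⟨by rw [h7]; exact h.1, ?_⟩
    rw [h8]
    rintro x (rfl | hx)
    exacts [hzH, h.2 x hx]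

theorem run_askHitting (h7 : (σ.supp 7 : Set (Fin n)) = ∅) (h8 : (σ.supp 8 : Set (Fin n)) = ∅) :
    ((Code.askHitting.run G H σ).supp 7 : Set (Fin n)) =
        {v | (v ∈ (σ.supp 9 : Set (Fin n)) ∨ (v : ℕ) = 0) ∧ v ∈ H} ∧
      ((Code.askHitting.run G H σ).supp 8 : Set (Fin n)) =
        {v | (v ∈ (σ.supp 9 : Set (Fin n)) ∨ (v : ℕ) = 0) ∧ v ∉ H} ∧
      (Code.askHitting.run G H σ).cnt ≤ σ.cnt + ((σ.supp 9 : Set (Fin n)).ncard + 1) := by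
  set S : Set (Fin n) := {v | v ∈ (σ.supp 9 : Set (Fin n)) ∨ (v : ℕ) = 0} with hS
  have hcard : S.ncard ≤ (σ.supp 9 : Set (Fin n)).ncard + 1 := by
    have h1 : ({v : Fin n | (v : ℕ) = 0}).ncard ≤ 1 :=
      (Set.ncard_le_one_iff (Set.toFinite _)).2 fun hx hy => Fin.ext (hx.trans hy.symm)
    exact (Set.ncard_union_le _ {v : Fin n | (v : ℕ) = 0}).trans (by omega)
  have h := Code.run_loop_induction (G := G) (H := H) (i := 12) (σ := σ)
    (c := .ite (.disj (.arr 9 (.var 12)) (.eq (.var 12) (.const 0)))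
      (.seq (.assign 3 (.var 12)) .ask) .skip)
    (fun k τ => (τ.supp 9 : Set (Fin n)) = σ.supp 9 ∧
      (τ.supp 7 : Set (Fin n)) = {v : Fin n | (v : ℕ) < k ∧ v ∈ S ∧ v ∈ H} ∧
      (τ.supp 8 : Set (Fin n)) = {v : Fin n | (v : ℕ) < k ∧ v ∈ S ∧ v ∉ H} ∧
      τ.cnt = σ.cnt + {v : Fin n | (v : ℕ) < k ∧ v ∈ S}.ncard)
    ⟨rfl, by simp [h7], by simp [h8], by simp⟩ ?_
  · simp only [Fin.is_lt, true_and] at h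
    refine ⟨h.2.1, h.2.2.1, ?_⟩
    rw [Code.askHitting, h.2.2.2]
    exact Nat.add_le_add_left hcard _
  rintro z τ ⟨i9, i7, i8, ic⟩
  have split : ∀ {v : Fin n}, (v : ℕ) < z + 1 ↔ v = z ∨ (v : ℕ) < z := fun {v} => by
    rw [Fin.ext_iff]
    omega
  refine ⟨(Code.run_supp rfl).trans i9, ?_⟩
  by_cases hz : z ∈ S
  · have hz' : z ∈ (σ.supp 9 : Set (Fin n)) ∨ (z : ℕ) = 0 := hz
    rw [Code.run_ite_of_holds (by simpa [i9] using hz'), Code.run_seq]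
    have hcnt : {v : Fin n | (v : ℕ) < z + 1 ∧ v ∈ S}.ncard =
        {v : Fin n | (v : ℕ) < z ∧ v ∈ S}.ncard + 1 := by
      rw [← Set.ncard_insert_of_notMem (a := z) (by simp)]
      congr 1
      ext v
      simp only [split, Set.mem_ofPred_eq, Set.mem_insert_iff]
      constructor
      · rintro ⟨h | h, hv⟩
        exacts [.inl h, .inr ⟨h, hv⟩]
      · rintro (rfl | ⟨h, hv⟩)
        exacts [⟨.inl rfl, hz⟩, ⟨.inr h, hv⟩]
    have h3 : ((Code.assign 3 (.var 12)).run G H (τ.setVar 12 z)).vars 3 = z := by simp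
    by_cases hzH : z ∈ H
    · obtain ⟨a7, a8, ac⟩ := run_ask_of_mem (G := G) h3 hzH
      rw [a7, a8, ac, hcnt]
      refine ⟨?_, ?_, ?_⟩
      · ext v
        simp only [Code.run_assign, Store.supp_setVar, i7, split, Set.mem_ofPred_eq,
          Set.mem_insert_iff]
        constructor
        · rintro (rfl | ⟨h, h'⟩)
          exacts [⟨.inl rfl, hz, hzH⟩, ⟨.inr h, h'⟩]
        · rintro ⟨h | h, h'⟩
          exacts [.inl h, .inr ⟨h, h'⟩]
      · ext v
        simp only [Code.run_assign, Store.supp_setVar, i8, split, Set.mem_ofPred_eq]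
        refine ⟨fun h => ⟨.inr h.1, h.2⟩, ?_⟩
        rintro ⟨rfl | h, h'⟩
        exacts [absurd hzH h'.2, ⟨h, h'⟩]
      · simp [ic, add_assoc]
    · obtain ⟨a7, a8, ac⟩ := run_ask_of_notMem (G := G) h3 hzH
      rw [a7, a8, ac, hcnt]
      refine ⟨?_, ?_, ?_⟩
      · ext v
        simp only [Code.run_assign, Store.supp_setVar, i7, split, Set.mem_ofPred_eq]
        refine ⟨fun h => ⟨.inr h.1, h.2⟩, ?_⟩
        rintro ⟨rfl | h, h'⟩
        exacts [absurd h'.2 hzH, ⟨h, h'⟩]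
      · ext v
        simp only [Code.run_assign, Store.supp_setVar, i8, split, Set.mem_ofPred_eq,
          Set.mem_insert_iff]
        constructor
        · rintro (rfl | ⟨h, h'⟩)
          exacts [⟨.inl rfl, hz, hzH⟩, ⟨.inr h, h'⟩]
        · rintro ⟨h | h, h'⟩
          exacts [.inl h, .inr ⟨h, h'⟩]
      · simp [ic, add_assoc]
  · have hz' : ¬ (z ∈ (σ.supp 9 : Set (Fin n)) ∨ (z : ℕ) = 0) := hz
    rw [Code.run_ite_of_not_holds (by simpa [i9] using hz'), Code.run_skip]
    have : ∀ {v : Fin n}, v ∈ S → ((v : ℕ) < z + 1 ↔ (v : ℕ) < z) := fun {v} hv => by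
      rw [split, or_iff_right]
      rintro rfl
      exact hz hv
    refine ⟨?_, ?_, ?_⟩
    · rw [Store.supp_setVar, i7]
      ext v
      exact ⟨fun h => ⟨(this h.2.1).2 h.1, h.2⟩, fun h => ⟨(this h.2.1).1 h.1, h.2⟩⟩
    · rw [Store.supp_setVar, i8]
      ext v
      exact ⟨fun h => ⟨(this h.2.1).2 h.1, h.2⟩, fun h => ⟨(this h.2.1).1 h.1, h.2⟩⟩
    · rw [Store.cnt_setVar, ic]
      congr 2
      ext v
      exact ⟨fun h => ⟨(this h.2).2 h.1, h.2⟩, fun h => ⟨(this h.2).1 h.1, h.2⟩⟩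

end Run

/-! ### Binary search for a cut edge -/

section Distance

variable {V : Type*} {G : SimpleGraph V}

theorem dist_lt_card [Fintype V] (hG : G.Connected) (a b : V) : G.dist a b < Fintype.card V := by
  classical
  obtain ⟨p, hp, hl⟩ := hG.exists_path_of_dist a b
  exact hl ▸ hp.length_lt

theorem exists_dist_eq (hG : G.Connected) {a b : V} {k l : ℕ} (h : k + l = G.dist a b) :
    ∃ z, G.dist a z = k ∧ G.dist b z = l := by
  obtain ⟨p, hp⟩ := hG.exists_walk_length_eq_dist a b
  have h1 := SimpleGraph.dist_le (p.take k)
  have h2 := SimpleGraph.dist_le (p.drop k)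
  rw [SimpleGraph.Walk.take_length] at h1
  rw [SimpleGraph.Walk.drop_length, SimpleGraph.dist_comm] at h2
  have h3 := hG.dist_triangle (u := a) (v := p.getVert k) (w := b)
  rw [SimpleGraph.dist_comm (u := p.getVert k)] at h3
  exact ⟨p.getVert k, by omega, by omega⟩

theorem dist_le_succ_iff (hG : G.Connected) {a v : V} {m : ℕ} :
    G.dist a v ≤ m + 1 ↔ G.dist a v ≤ m ∨ ∃ u, G.dist a u ≤ m ∧ G.Adj u v := by
  constructor
  · intro h
    rcases Nat.lt_or_ge m (G.dist a v) with h' | h'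
    · obtain ⟨z, hz, hz'⟩ := exists_dist_eq hG (a := a) (b := v) (k := m) (l := 1) (by omega)
      exact .inr ⟨z, hz.le, (SimpleGraph.dist_eq_one_iff_adj.1 hz').symm⟩
    · exact .inl h'
  · rintro (h | ⟨u, hu, huv⟩)
    · omega
    · have := hG.dist_triangle (u := a) (v := u) (w := v)
      rw [SimpleGraph.dist_eq_one_iff_adj.2 huv] at this
      omega

end Distance

theorem clog_succ_of_two_mul_le_succ {d d' : ℕ} (hd : 2 ≤ d) (h : 2 * d' ≤ d + 1) :
    Nat.clog 2 d' + 1 ≤ Nat.clog 2 d := by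
  rw [Nat.clog_of_two_le one_lt_two hd]
  exact Nat.succ_le_succ (Nat.clog_mono_right 2 (by omega))

namespace Code

/-- Computes in array `k` the distances from the vertex in variable `s`; array `12` holds balls
around it. -/
def distances (s : ℕ) (k : Fin 15) : Code :=
  .seq (.setArr 12 20 (.eq (.var 20) (.var s))) <| .seq (.setArr k 20 (.const 0)) <| .loop 11 <|
    .seq (.setArr k 20 (.add (.arr k (.var 20)) (.neg (.arr 12 (.var 20)))))
      (.setArr 12 20 (.disj (.arr 12 (.var 20))
        (.sum 21 (.conj (.arr 12 (.var 21)) (.adj (.var 21) (.var 20))))))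

/-- A vertex halfway between those in the variables `1` and `2`, in terms of the distances in the
arrays `10` and `11`. -/
def midpoint : Term :=
  .first 20 <| .conj (.eq (.add (.arr 10 (.var 20)) (.arr 11 (.var 20))) (.arr 10 (.var 2)))
    (.disj (.eq (.add (.arr 10 (.var 20)) (.arr 10 (.var 20))) (.arr 10 (.var 2)))
      (.eq (.add (.arr 10 (.var 20)) (.arr 10 (.var 20))) (.add (.arr 10 (.var 2)) (.const 1))))

/-- One step of the binary search between a positive vertex in variable `1` and a negative vertex
in variable `2`. -/
def bisect : Code :=
  .ite (.adj (.var 1) (.var 2)) skip <| .seq (distances 1 10) <| .seq (distances 2 11) <|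
    .seq (.assign 3 midpoint) <| .seq ask <|
    .ite (.arr 7 (.var 3)) (.assign 1 (.var 3)) (.assign 2 (.var 3))

end Code

section Run

variable {n : ℕ} {G : SimpleGraph (Fin n)} {H : Finset (Fin n)} {σ : Store}

theorem Term.eval_neg_of_holds {e : Term} (h : e.Holds G σ) : e.neg.eval G σ = 0 :=
  Term.eval_ite_of_holds h

theorem Term.eval_neg_of_not_holds {e : Term} (h : ¬ e.Holds G σ) : e.neg.eval G σ = 1 :=
  Term.eval_ite_of_not_holds h

theorem run_distances (hG : G.Connected) {s : ℕ} {k : Fin 15} (hk : k ≠ 12) (hs : s ≠ 20)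
    {a : Fin n} (ha : σ.vars s = a) (v : Fin n) :
    ((Code.distances s k).run G H σ).arrs k v = G.dist a v := by
  have h := Code.run_loop_induction (G := G) (H := H) (i := 11)
    (c := .seq (.setArr k 20 (.add (.arr k (.var 20)) (.neg (.arr 12 (.var 20)))))
      (.setArr 12 20 (.disj (.arr 12 (.var 20))
        (.sum 21 (.conj (.arr 12 (.var 21)) (.adj (.var 21) (.var 20)))))))
    (σ := (Code.setArr k 20 (.const 0)).run G H
      ((Code.setArr 12 20 (.eq (.var 20) (.var s))).run G H σ))
    (fun m τ => (τ.supp 12 : Set (Fin n)) = {v | G.dist a v ≤ m} ∧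
      ∀ v : Fin n, τ.arrs k v = min (G.dist a v) m) ⟨?_, fun v => ?_⟩ ?_
  · rw [Code.distances, Code.run_seq, Code.run_seq, h.2 v]
    have := dist_lt_card hG a v
    rw [Fintype.card_fin] at this
    omega
  · ext v
    simp [hk.symm, hs, ha, Fin.val_inj, hG.dist_eq_zero_iff, eq_comm]
  · rw [Code.arrs_setArr_self]
    simp
  · rintro m τ ⟨h1, h2⟩
    set ρ := τ.setVar 11 m with hρ
    have r1 : (ρ.supp 12 : Set (Fin n)) = {v | G.dist a v ≤ m} := h1
    have r2 : ∀ v : Fin n, ρ.arrs k v = min (G.dist a v) m := h2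
    rw [Code.run_seq]
    set π := (Code.setArr k 20 (.add (.arr k (.var 20)) (.neg (.arr 12 (.var 20))))).run G H ρ
      with hπ
    have p1 : (π.supp 12 : Set (Fin n)) = {v | G.dist a v ≤ m} := by
      rw [hπ, Code.supp_setArr, if_neg hk.symm, r1]
    have p2 : ∀ v : Fin n, π.arrs k v = min (G.dist a v) (m + 1) := by
      intro v
      rw [hπ, Code.arrs_setArr_self, Term.eval_add, Term.eval_arr]
      simp only [Term.eval_var, Store.vars_setVar, if_true, Store.arrs_setVar, r2]
      by_cases hv : G.dist a v ≤ m
      · rw [Term.eval_neg_of_holds (by simpa [r1] using hv)]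
        omega
      · rw [Term.eval_neg_of_not_holds (by simpa [r1] using hv)]
        omega
    refine ⟨?_, fun v => ?_⟩
    · ext v
      rw [Set.mem_ofPred_eq, dist_le_succ_iff hG]
      simp [p1]
    · rw [Code.arrs_setArr_of_ne hk, p2]

/-- The vertices `a` and `b` in the variables `1` and `2` are known to be positive and negative. -/
def Located (H : Finset (Fin n)) (σ : Store) (a b : Fin n) : Prop :=
  σ.vars 1 = a ∧ σ.vars 2 = b ∧ a ∈ (σ.supp 7 : Set (Fin n)) ∧ b ∈ (σ.supp 8 : Set (Fin n)) ∧
    Knows H σ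

theorem run_bisect (hG : G.Connected) {a b : Fin n} (h : Located H σ a b) (hab : ¬ G.Adj a b) :
    ∃ a' b', Located H (Code.bisect.run G H σ) a' b' ∧ 2 * G.dist a' b' ≤ G.dist a b + 1 ∧
      (Code.bisect.run G H σ).cnt = σ.cnt + 1 := by
  obtain ⟨ha, hb, ha7, hb8, hK⟩ := h
  rw [Code.bisect, Code.run_ite_of_not_holds (by simpa [ha, hb] using hab)]
  simp only [Code.run_seq]
  set τ := (Code.distances 1 10).run G H σ with hτ
  have t10 : ∀ v : Fin n, τ.arrs 10 v = G.dist a v :=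
    run_distances hG (by decide) (by omega) ha
  have t2 : τ.vars 2 = b := (Code.run_vars rfl).trans hb
  set ρ := (Code.distances 2 11).run G H τ with hρ
  have r10 : ∀ v : Fin n, ρ.arrs 10 v = G.dist a v := fun v => by
    rw [hρ, Code.run_arrs rfl, t10]
  have r11 : ∀ v : Fin n, ρ.arrs 11 v = G.dist b v :=
    run_distances hG (by decide) (by omega) t2
  have r1 : ρ.vars 1 = a := (Code.run_vars rfl).trans ((Code.run_vars rfl).trans ha)
  have r2 : ρ.vars 2 = b := (Code.run_vars rfl).trans t2
  have r7 : (ρ.supp 7 : Set (Fin n)) = σ.supp 7 := (Code.run_supp rfl).trans (Code.run_supp rfl)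
  have r8 : (ρ.supp 8 : Set (Fin n)) = σ.supp 8 := (Code.run_supp rfl).trans (Code.run_supp rfl)
  have rc : ρ.cnt = σ.cnt := (Code.run_cnt rfl).trans (Code.run_cnt rfl)
  have hmid := Term.eval_first (G := G) (σ := ρ) (i := 20)
    (e := .conj (.eq (.add (.arr 10 (.var 20)) (.arr 11 (.var 20))) (.arr 10 (.var 2)))
    (.disj (.eq (.add (.arr 10 (.var 20)) (.arr 10 (.var 20))) (.arr 10 (.var 2)))
      (.eq (.add (.arr 10 (.var 20)) (.arr 10 (.var 20))) (.add (.arr 10 (.var 2)) (.const 1)))))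
    {z | G.dist a z + G.dist b z = G.dist a b ∧ (G.dist a z + G.dist a z = G.dist a b ∨
      G.dist a z + G.dist a z = G.dist a b + 1)} (by simp [r10, r11, r2])
  obtain ⟨z, ⟨hz1, hz2⟩, hz⟩ : ∃ z : Fin n, (G.dist a z + G.dist b z = G.dist a b ∧
      (G.dist a z + G.dist a z = G.dist a b ∨ G.dist a z + G.dist a z = G.dist a b + 1)) ∧
      Code.midpoint.eval G ρ = z := by
    rcases hmid with ⟨h, -⟩ | ⟨z, h1, h2⟩
    · obtain ⟨z, h1, h2⟩ := exists_dist_eq hG (a := a) (b := b) (k := (G.dist a b + 1) / 2)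
        (l := G.dist a b / 2) (by omega)
      exact absurd h (Set.Nonempty.ne_empty ⟨z, by simp only [Set.mem_ofPred_eq]; omega⟩)
    · exact ⟨z, h1, h2⟩
  set π := (Code.assign 3 Code.midpoint).run G H ρ with hπ
  have p3 : π.vars 3 = z := by simp [hπ, hz]
  have p1 : π.vars 1 = a := by simp [hπ, r1]
  have p2 : π.vars 2 = b := by simp [hπ, r2]
  have p7 : (π.supp 7 : Set (Fin n)) = σ.supp 7 := r7
  have p8 : (π.supp 8 : Set (Fin n)) = σ.supp 8 := r8
  have hK' : Knows H π := by rw [Knows, p7, p8]; exact hK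
  have hK'' : Knows H (Code.ask.run G H π) := hK'.ask p3
  have q1 : (Code.ask.run G H π).vars 1 = a := (Code.run_vars rfl).trans p1
  have q2 : (Code.ask.run G H π).vars 2 = b := (Code.run_vars rfl).trans p2
  have q3 : (Code.ask.run G H π).vars 3 = z := (Code.run_vars rfl).trans p3
  by_cases hzH : z ∈ H
  · obtain ⟨e7, e8, ec⟩ := run_ask_of_mem (G := G) p3 hzH
    have hz7 : z ∈ ((Code.ask.run G H π).supp 7 : Set (Fin n)) := by
      rw [e7]; exact Set.mem_insert _ _
    rw [Code.run_ite_of_holds (by simpa [q3] using hz7)]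
    refine ⟨z, b, ⟨by simp [q3], by simp [q2], hz7, ?_, hK''⟩, ?_, ec.trans (by rw [← rc]; rfl)⟩
    · rw [Code.run_assign, Store.supp_setVar, e8, p8]
      exact hb8
    · rw [SimpleGraph.dist_comm]
      omega
  · obtain ⟨e7, e8, ec⟩ := run_ask_of_notMem (G := G) p3 hzH
    have hz7 : z ∉ ((Code.ask.run G H π).supp 7 : Set (Fin n)) := fun h => hzH (hK''.1 h)
    rw [Code.run_ite_of_not_holds (by simpa [q3] using hz7)]
    refine ⟨a, z, ⟨by simp [q1], by simp [q3], ?_, ?_, hK''⟩, by omega,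
      ec.trans (by rw [← rc]; rfl)⟩
    · rw [Code.run_assign, Store.supp_setVar, e7, p7]
      exact ha7
    · rw [Code.run_assign, Store.supp_setVar, e8]
      exact Set.mem_insert _ _

/-- After `n` steps the binary search has ended: each step decreases the distance. -/
theorem run_loop_bisect (hG : G.Connected) {a b : Fin n} (h : Located H σ a b) :
    ∃ a' b', Located H ((Code.loop 12 .bisect).run G H σ) a' b' ∧ G.Adj a' b' ∧
      ((Code.loop 12 .bisect).run G H σ).cnt ≤ σ.cnt + Nat.clog 2 (G.dist a b) := by
  have key := Code.run_loop_induction (G := G) (H := H) (i := 12) (c := .bisect) (σ := σ)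
    (fun k τ => ∃ a' b', Located H τ a' b' ∧
      τ.cnt + Nat.clog 2 (G.dist a' b') ≤ σ.cnt + Nat.clog 2 (G.dist a b) ∧
      (G.Adj a' b' ∨ G.dist a' b' + k ≤ n)) ⟨a, b, h, le_rfl, .inr ?_⟩ ?_
  · obtain ⟨a', b', h1, h2, h3⟩ := key
    refine ⟨a', b', h1, h3.resolve_right fun h4 => ?_, by omega⟩
    have h5 : G.dist a' b' = 0 := by omega
    rw [hG.dist_eq_zero_iff] at h5
    obtain ⟨-, -, h7, h8, hK⟩ := h1
    exact hK.2 b' h8 (h5 ▸ hK.1 h7)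
  · have := dist_lt_card hG a b
    rw [Fintype.card_fin] at this
    omega
  · rintro z τ ⟨a', b', h1, h2, h3⟩
    have h1' : Located H (τ.setVar 12 z) a' b' := by
      obtain ⟨h1, h1', h1''⟩ := h1
      exact ⟨by simp [h1], by simp [h1'], h1''⟩
    by_cases hab : G.Adj a' b'
    · have : Code.bisect.run G H (τ.setVar 12 z) = τ.setVar 12 z := by
        rw [Code.bisect, Code.run_ite_of_holds (by simpa [h1.1, h1.2.1] using hab), Code.run_skip]
      rw [this]
      exact ⟨a', b', h1', h2, .inl hab⟩
    · obtain ⟨a'', b'', h4, h5, h6⟩ := run_bisect hG h1' hab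
      have hne : G.dist a' b' ≠ 0 := by
        rw [Ne, hG.dist_eq_zero_iff]
        rintro rfl
        obtain ⟨-, -, h7, h8, hK⟩ := h1
        exact hK.2 _ h8 (hK.1 h7)
      have hne' : G.dist a' b' ≠ 1 := fun h => hab (SimpleGraph.dist_eq_one_iff_adj.1 h)
      have h7 := clog_succ_of_two_mul_le_succ (by omega) h5
      rw [Store.cnt_setVar] at h6
      have h8 := h3.resolve_left hab
      exact ⟨a'', b'', h4, by omega, .inr (by omega)⟩

end Run

/-! ### Queries of undetermined vertices -/

section Satisfiable

variable {V : Type*} {G : SimpleGraph V} {a b : V} {P N : Set V}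

theorem satisfiable_insert_fst_iff (ha : a ∈ P) (hb : b ∈ N) {z : V} :
    Satisfiable G (insert z P) N ↔ ∃ H, Consistent G a b P N H ∧ z ∈ H := by
  constructor
  · rintro ⟨H, hH, hP, hN⟩
    have hP' := (Set.subset_insert z P).trans hP
    exact ⟨H, ⟨⟨hH, hP' ha, hN b hb⟩, hP', hN⟩, hP (Set.mem_insert _ _)⟩
  · rintro ⟨H, ⟨⟨hH, -⟩, hP, hN⟩, hz⟩
    exact ⟨H, hH, Set.insert_subset hz hP, hN⟩

theorem satisfiable_insert_snd_iff (ha : a ∈ P) (hb : b ∈ N) {z : V} :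
    Satisfiable G P (insert z N) ↔ ∃ H, Consistent G a b P N H ∧ z ∉ H := by
  constructor
  · rintro ⟨H, hH, hP, hN⟩
    have hN' : ∀ x ∈ N, x ∉ H := fun x hx => hN x (Set.mem_insert_of_mem _ hx)
    exact ⟨H, ⟨⟨hH, hP ha, hN' b hb⟩, hP, hN'⟩, hN z (Set.mem_insert _ _)⟩
  · rintro ⟨H, ⟨⟨hH, -⟩, hP, hN⟩, hz⟩
    refine ⟨H, hH, hP, ?_⟩
    rintro x (rfl | hx)
    exacts [hz, hN x hx]

end Satisfiable

namespace Term

/-- The number of vertices. -/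
def card : Term := count 22 (.const 1)

/-- Vertex `u` is adjacent to the vertex in variable `x` and not to that in variable `y`. -/
def privateNbr (x y : ℕ) (u : Term) : Term := conj (.adj u (.var x)) (neg (.adj u (.var y)))

/-- Vertex `u` is adjacent to the vertices in the variables `1` and `2`. -/
def commonNbr (u : Term) : Term := conj (.adj u (.var 1)) (.adj u (.var 2))

end Term

namespace Code

/-- Tests consistency of a positive label of the vertex in variable `13`. -/
def solvePos : Code :=
  .seq (.setArr 1 20 (.disj (.eq (.var 20) (.var 13)) (.arr 7 (.var 20)))) <|
    .seq (.setArr 2 20 (.arr 8 (.var 20))) solve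

/-- Tests consistency of a negative label of the vertex in variable `13`. -/
def solveNeg : Code :=
  .seq (.setArr 1 20 (.arr 7 (.var 20))) <|
    .seq (.setArr 2 20 (.disj (.eq (.var 20) (.var 13)) (.arr 8 (.var 20)))) solve

/-- Changes the entry of array `k` for the vertex in variable `13`. -/
def setEntry (k : Fin 15) (e : Term) : Code :=
  .setArr k 20 (.ite (.eq (.var 20) (.var 13)) e (.arr k (.var 20)))

/-- Computes in array `13` the undetermined vertices. -/
def undetermined : Code :=
  .loop 13 <| .seq solvePos <| .seq (.assign 6 (.var 0)) <| .seq solveNeg <|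
    setEntry 13 (.conj (.commonNbr (.var 13)) (.conj (.var 6) (.var 0)))

/-- Computes in array `12` the keys, shifted by the number of vertices. -/
def keys : Code :=
  .setArr 12 20 (.sub
    (.add (.count 21 (.conj (.privateNbr 1 2 (.var 21)) (.adj (.var 21) (.var 20)))) .card)
    (.count 21 (.conj (.privateNbr 2 1 (.var 21)) (.adj (.var 21) (.var 20)))))

/-- Computes in array `14` the vertices with a key without determined vertices. -/
def freshKeys : Code :=
  .setArr 14 20 (.conj (.arr 13 (.var 20)) (.all 21 (.disj (.neg (.commonNbr (.var 21)))
    (.disj (.neg (.eq (.arr 12 (.var 21)) (.arr 12 (.var 20)))) (.arr 13 (.var 21))))))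

/-- At most half of the vertices in array `14` satisfy `e`, as a term in variable `23`. -/
def atMostHalf (e : Term) : Term :=
  .le (.add (.count 23 (.conj (.arr 14 (.var 23)) e)) (.count 23 (.conj (.arr 14 (.var 23)) e)))
    (.count 23 (.arr 14 (.var 23)))

/-- A vertex in array `14` with a median key. -/
def median : Term :=
  .first 20 <| .conj (.arr 14 (.var 20)) <|
    .conj (atMostHalf (.lt (.arr 12 (.var 20)) (.arr 12 (.var 23))))
      (atMostHalf (.lt (.arr 12 (.var 23)) (.arr 12 (.var 20))))

/-- Chooses in variable `3` the next query. -/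
def choose : Code :=
  .seq undetermined <| .seq keys <| .seq freshKeys <| .seq (.assign 3 median) <|
    .ite (.lt (.var 3) .card) skip (.assign 3 (.first 20 (.arr 13 (.var 20))))

/-- Makes a query if there is an undetermined vertex. -/
def refine : Code := .seq choose <| .ite (.lt (.var 3) .card) ask skip

/-- Computes in array `0` the vertices whose positive label is consistent. -/
def deduce : Code := .loop 13 <| .seq solvePos <| setEntry 0 (.var 0)

end Code

section Run

variable {n : ℕ} {G : SimpleGraph (Fin n)} {H : Finset (Fin n)} {σ : Store} {a b : Fin n}

@[simp] theorem Term.eval_card : Term.card.eval G σ = n := by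
  simp [Term.card, Set.ncard_univ]

theorem run_solvePos (hab : G.Adj a b) (ha : a ∈ (σ.supp 7 : Set (Fin n)))
    (hb : b ∈ (σ.supp 8 : Set (Fin n))) {z : Fin n} (hz : σ.vars 13 = z) :
    (Code.solvePos.run G H σ).vars 0 ≠ 0 ↔ Satisfiable G (insert z (σ.supp 7)) (σ.supp 8) := by
  rw [Code.solvePos, Code.run_seq, Code.run_seq]
  set τ := (Code.setArr 2 20 (.arr 8 (.var 20))).run G H ((Code.setArr 1 20 (.disj (.eq (.var 20)
    (.var 13)) (.arr 7 (.var 20)))).run G H σ) with hτ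
  have t1 : (τ.supp 1 : Set (Fin n)) = insert z (σ.supp 7) := by
    ext v
    simp [hτ, hz, Fin.val_inj]
  have t2 : (τ.supp 2 : Set (Fin n)) = σ.supp 8 := by
    ext v
    simp [hτ]
  rw [run_solve hab (by rw [t1]; exact Set.mem_insert_of_mem _ ha) (by rw [t2]; exact hb), t1, t2]

theorem run_solveNeg (hab : G.Adj a b) (ha : a ∈ (σ.supp 7 : Set (Fin n)))
    (hb : b ∈ (σ.supp 8 : Set (Fin n))) {z : Fin n} (hz : σ.vars 13 = z) :
    (Code.solveNeg.run G H σ).vars 0 ≠ 0 ↔ Satisfiable G (σ.supp 7) (insert z (σ.supp 8)) := by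
  rw [Code.solveNeg, Code.run_seq, Code.run_seq]
  set τ := (Code.setArr 2 20 (.disj (.eq (.var 20) (.var 13)) (.arr 8 (.var 20)))).run G H
    ((Code.setArr 1 20 (.arr 7 (.var 20))).run G H σ) with hτ
  have t1 : (τ.supp 1 : Set (Fin n)) = σ.supp 7 := by
    ext v
    simp [hτ]
  have t2 : (τ.supp 2 : Set (Fin n)) = insert z (σ.supp 8) := by
    ext v
    simp [hτ, hz, Fin.val_inj]
  rw [run_solve hab (by rw [t1]; exact ha) (by rw [t2]; exact Set.mem_insert_of_mem _ hb), t1, t2]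

theorem mem_supp_setEntry (k : Fin 15) (e : Term) {z : Fin n} (hz : σ.vars 13 = z)
    (he : ∀ x, (e.Holds G (σ.setVar 20 x) ↔ e.Holds G σ)) (v : Fin n) :
    v ∈ (((Code.setEntry k e).run G H σ).supp k : Set (Fin n)) ↔
      (v = z ∧ e.Holds G σ ∨ v ≠ z ∧ v ∈ (σ.supp k : Set (Fin n))) := by
  simp [Code.setEntry, hz, Fin.val_inj, he]

/-- A loop that computes a set vertex by vertex. -/
theorem run_loop_setEntry {c : Code} {e : Term} {k : Fin 15} (φ : Fin n → Prop) (K : Store → Prop)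
    (hK : K σ) (he : ∀ (τ : Store) x, (e.Holds G (τ.setVar 20 x) ↔ e.Holds G τ))
    (hc : ∀ (z : Fin n) (τ : Store), K τ →
      (c.run G H (τ.setVar 13 z)).vars 13 = z ∧
      ((c.run G H (τ.setVar 13 z)).supp k : Set (Fin n)) = τ.supp k ∧
      (e.Holds G (c.run G H (τ.setVar 13 z)) ↔ φ z) ∧
      K ((Code.setEntry k e).run G H (c.run G H (τ.setVar 13 z)))) :
    K ((Code.loop 13 (.seq c (.setEntry k e))).run G H σ) ∧
      (((Code.loop 13 (.seq c (.setEntry k e))).run G H σ).supp k : Set (Fin n)) = {v | φ v} := by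
  have h := Code.run_loop_induction (G := G) (H := H) (i := 13) (σ := σ)
    (c := .seq c (.setEntry k e)) (fun m τ => K τ ∧ ∀ v : Fin n, (v : ℕ) < m →
      (v ∈ (τ.supp k : Set (Fin n)) ↔ φ v)) ⟨hK, by simp⟩ (by
      rintro z τ ⟨h1, h2⟩
      obtain ⟨h3, h4, h5, h6⟩ := hc z τ h1
      refine ⟨h6, fun v hv => ?_⟩
      rw [Code.run_seq, mem_supp_setEntry k e h3 (he _), h4, h5]
      by_cases hvz : v = z
      · simp [hvz]
      · have : (v : ℕ) ≠ z := fun h => hvz (Fin.ext h)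
        simp [hvz, h2 v (by omega)])
  exact ⟨h.1, Set.ext fun v => h.2 v v.2⟩

theorem run_undetermined (hab : G.Adj a b) (h : Located H σ a b) :
    ((Code.undetermined.run G H σ).supp 13 : Set (Fin n)) =
      undetermined G a b (σ.supp 7) (σ.supp 8) := by
  obtain ⟨ha, hb, ha7, hb8, -⟩ := h
  have hassoc : ∀ τ : Store, (Code.undetermined.run G H τ) = (Code.loop 13 (.seq (.seq .solvePos
      (.seq (.assign 6 (.var 0)) .solveNeg)) (.setEntry 13 (.conj (.commonNbr (.var 13))
      (.conj (.var 6) (.var 0)))))).run G H τ := fun _ => rfl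
  rw [hassoc, (run_loop_setEntry (G := G) (H := H) (σ := σ)
    (fun z => z ∈ undetermined G a b (σ.supp 7) (σ.supp 8))
    (fun τ => τ.vars 1 = a ∧ τ.vars 2 = b ∧ (τ.supp 7 : Set (Fin n)) = σ.supp 7 ∧
      (τ.supp 8 : Set (Fin n)) = σ.supp 8) ⟨ha, hb, rfl, rfl⟩
      (fun τ x => by simp [Term.commonNbr]) ?_).2]
  · rfl
  rintro z τ ⟨h1, h2, h7, h8⟩
  simp only [Code.run_seq]
  set τ' := τ.setVar 13 z with hτ'
  have z' : τ'.vars 13 = z := by simp [hτ']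
  have s1 := run_solvePos (G := G) (H := H) (σ := τ') hab (h7 ▸ ha7) (h8 ▸ hb8) z'
  set ρ := (Code.assign 6 (.var 0)).run G H (Code.solvePos.run G H τ') with hρ
  have r6 : ρ.vars 6 = (Code.solvePos.run G H τ').vars 0 := by simp [hρ]
  have r7 : (ρ.supp 7 : Set (Fin n)) = σ.supp 7 := by
    rw [hρ, Code.run_supp rfl, Code.run_supp rfl]
    exact h7
  have r8 : (ρ.supp 8 : Set (Fin n)) = σ.supp 8 := by
    rw [hρ, Code.run_supp rfl, Code.run_supp rfl]
    exact h8
  have r13 : ρ.vars 13 = z := by rw [hρ, Code.run_vars rfl, Code.run_vars rfl, z']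
  have r1 : ρ.vars 1 = a := by
    rw [hρ, Code.run_vars rfl, Code.run_vars rfl]
    simp [hτ', h1]
  have r2 : ρ.vars 2 = b := by
    rw [hρ, Code.run_vars rfl, Code.run_vars rfl]
    simp [hτ', h2]
  have s2 := run_solveNeg (G := G) (H := H) (σ := ρ) hab (r7 ▸ ha7) (r8 ▸ hb8) r13
  have e1 : (Code.solveNeg.run G H ρ).vars 1 = a := (Code.run_vars rfl).trans r1
  have e2 : (Code.solveNeg.run G H ρ).vars 2 = b := (Code.run_vars rfl).trans r2
  have e6 : (Code.solveNeg.run G H ρ).vars 6 = ρ.vars 6 := Code.run_vars rfl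
  have e13 : (Code.solveNeg.run G H ρ).vars 13 = z := (Code.run_vars rfl).trans r13
  refine ⟨e13, ?_, ?_, ?_, ?_, ?_, ?_⟩
  · rw [Code.run_supp rfl, hρ, Code.run_supp rfl, Code.run_supp rfl]
    rfl
  · have t7 : (τ'.supp 7 : Set (Fin n)) = σ.supp 7 := h7
    have t8 : (τ'.supp 8 : Set (Fin n)) = σ.supp 8 := h8
    rw [t7, t8, satisfiable_insert_fst_iff ha7 hb8] at s1
    rw [r7, r8, satisfiable_insert_snd_iff ha7 hb8] at s2
    rw [undetermined, Set.mem_ofPred_eq, ← s1, ← s2]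
    simp [Term.commonNbr, e1, e2, e6, e13, r6, commonNbrs]
  · exact (Code.run_vars rfl).trans e1
  · exact (Code.run_vars rfl).trans e2
  · rw [Code.run_supp rfl, Code.run_supp rfl, r7]
  · rw [Code.run_supp rfl, Code.run_supp rfl, r8]

theorem run_keys (ha : σ.vars 1 = a) (hb : σ.vars 2 = b) (z : Fin n) :
    ((Code.keys.run G H σ).arrs 12 z : ℤ) = key G a b z + n := by
  classical
  have hcard : ∀ φ : Fin n → Prop, {u | φ u}.ncard = (Finset.univ.filter φ).card := by
    intro φ
    rw [← Set.ncard_coe_finset]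
    congr 1
    ext
    simp
  have hle : {u | G.Adj u b ∧ ¬ G.Adj u a ∧ G.Adj u z}.ncard ≤ n := by
    simpa using Set.ncard_le_card {u | G.Adj u b ∧ ¬ G.Adj u a ∧ G.Adj u z}
  rw [Code.keys, Code.arrs_setArr_self]
  have h1 : ∀ x y : Fin n, {u : Fin n | G.Adj u x ∧ ¬ G.Adj u y ∧ G.Adj u z}.ncard =
      (Finset.univ.filter fun u => G.Adj u x ∧ ¬ G.Adj u y ∧ G.Adj u z).card := fun x y => by
    rw [hcard]
    congr
  simp only [Term.privateNbr, Term.eval_sub, Term.eval_add, Term.eval_count, Term.holds_conj,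
    Term.holds_neg, Term.holds_adj, Term.eval_var, Store.vars_setVar, Term.eval_card]
  norm_num [ha, hb, and_assoc]
  rw [Nat.cast_sub (by omega), key, Nat.cast_add, h1, h1]
  ring

theorem run_freshKeys (ha : σ.vars 1 = a) (hb : σ.vars 2 = b) {P N : Set (Fin n)}
    (h13 : (σ.supp 13 : Set (Fin n)) = undetermined G a b P N)
    (h12 : ∀ z : Fin n, (σ.arrs 12 z : ℤ) = key G a b z + n) :
    ((Code.freshKeys.run G H σ).supp 14 : Set (Fin n)) = freshKeys G a b P N := by
  have h : ∀ u v : Fin n, σ.arrs 12 u = σ.arrs 12 v ↔ key G a b u = key G a b v := fun u v => by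
    rw [← Nat.cast_inj (R := ℤ), h12, h12, add_left_inj]
  ext v
  simp [Code.freshKeys, Term.commonNbr, ha, hb, h13, h, freshKeys, commonNbrs]
  refine fun _ => forall_congr' fun w => ?_
  tauto

theorem eval_median {P N : Set (Fin n)} (h14 : (σ.supp 14 : Set (Fin n)) = freshKeys G a b P N)
    (h12 : ∀ z : Fin n, (σ.arrs 12 z : ℤ) = key G a b z + n) :
    (freshKeys G a b P N = ∅ ∧ Code.median.eval G σ = n) ∨
      ∃ z : Fin n, GoodQuery G a b P N z ∧ Code.median.eval G σ = z := by
  have h : ∀ u v : Fin n, σ.arrs 12 u < σ.arrs 12 v ↔ key G a b u < key G a b v := fun u v => by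
    rw [← Nat.cast_lt (α := ℤ), h12, h12, add_lt_add_iff_right]
  have hmid := Term.eval_first (G := G) (σ := σ) (i := 20)
    (e := .conj (.arr 14 (.var 20)) <|
      .conj (Code.atMostHalf (.lt (.arr 12 (.var 20)) (.arr 12 (.var 23))))
        (Code.atMostHalf (.lt (.arr 12 (.var 23)) (.arr 12 (.var 20)))))
    {z | z ∈ freshKeys G a b P N ∧
      2 * {v ∈ freshKeys G a b P N | key G a b z < key G a b v}.ncard ≤
        (freshKeys G a b P N).ncard ∧
      2 * {v ∈ freshKeys G a b P N | key G a b v < key G a b z}.ncard ≤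
        (freshKeys G a b P N).ncard} (by
      intro u v
      simp [Code.atMostHalf, h14, h, two_mul]
      exact and_and_left)
  rcases hmid with ⟨h1, h2⟩ | ⟨z, h1, h2⟩
  · refine .inl ⟨?_, h2⟩
    by_contra hne
    obtain ⟨z, hz, hz'⟩ := exists_median (Set.nonempty_iff_ne_empty.2 hne) (key G a b)
    exact Set.eq_empty_iff_forall_notMem.1 h1 z ⟨hz, hz'⟩
  · exact .inr ⟨z, ⟨h1.1.1, .inr h1⟩, h2⟩

theorem run_choose (hab : G.Adj a b) (h : Located H σ a b) :
    (undetermined G a b (σ.supp 7) (σ.supp 8) = ∅ ∧ (Code.choose.run G H σ).vars 3 = n) ∨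
      ∃ z : Fin n, GoodQuery G a b (σ.supp 7) (σ.supp 8) z ∧
        (Code.choose.run G H σ).vars 3 = z := by
  have hX := run_undetermined (G := G) (H := H) hab h
  obtain ⟨ha, hb, -⟩ := h
  rw [Code.choose]
  simp only [Code.run_seq]
  set τ := Code.undetermined.run G H σ with hτ
  have t1 : τ.vars 1 = a := (Code.run_vars rfl).trans ha
  have t2 : τ.vars 2 = b := (Code.run_vars rfl).trans hb
  set ρ := Code.keys.run G H τ with hρ
  have r1 : ρ.vars 1 = a := t1
  have r2 : ρ.vars 2 = b := t2
  have r13 : (ρ.supp 13 : Set (Fin n)) = _ := (Code.run_supp rfl).trans hX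
  have r12 := run_keys (G := G) (H := H) t1 t2
  rw [← hρ] at r12
  have p14 := run_freshKeys (G := G) (H := H) r1 r2 r13 r12
  set π := Code.freshKeys.run G H ρ with hπ
  have p12 : π.arrs 12 = ρ.arrs 12 := Code.run_arrs rfl
  have p13 : (π.supp 13 : Set (Fin n)) = _ := (Code.run_supp rfl).trans r13
  rw [← p12] at r12
  rcases eval_median p14 r12 with ⟨h1, h2⟩ | ⟨z, h1, h2⟩
  · rw [Code.run_ite_of_not_holds (by simp [h2]), Code.run_assign, Code.run_assign]
    rcases Term.eval_first (G := G) (σ := π.setVar 3 (Code.median.eval G π)) (i := 20)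
      (e := .arr 13 (.var 20)) (undetermined G a b (σ.supp 7) (σ.supp 8))
      (by simp [p13]) with ⟨h3, h4⟩ | ⟨z, h3, h4⟩
    · exact .inl ⟨h3, by simp [h4]⟩
    · exact .inr ⟨z, ⟨h3, .inl h1⟩, by simp [h4]⟩
  · rw [Code.run_ite_of_holds (by simp [h2]), Code.run_skip]
    exact .inr ⟨z, h1, by simp [h2]⟩

/-- After `n` steps no vertex is undetermined: each query decreases their number. -/
theorem run_loop_refine (hab : G.Adj a b) (h : Located H σ a b) {d : ℕ} (hd : ShatterBound G d) :
    Located H ((Code.loop 12 .refine).run G H σ) a b ∧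
      undetermined G a b (((Code.loop 12 .refine).run G H σ).supp 7)
        (((Code.loop 12 .refine).run G H σ).supp 8) = ∅ ∧
      ((Code.loop 12 .refine).run G H σ).cnt ≤
        σ.cnt + potential G a b d (σ.supp 7) (σ.supp 8) := by
  have key := Code.run_loop_induction (G := G) (H := H) (i := 12) (c := .refine) (σ := σ)
    (fun k τ => Located H τ a b ∧ τ.cnt + potential G a b d (τ.supp 7) (τ.supp 8) ≤
        σ.cnt + potential G a b d (σ.supp 7) (σ.supp 8) ∧
      (undetermined G a b (τ.supp 7) (τ.supp 8) = ∅ ∨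
        (undetermined G a b (τ.supp 7) (τ.supp 8)).ncard + k ≤ n)) ⟨h, le_rfl, .inr ?_⟩ ?_
  · obtain ⟨h1, h2, h3⟩ := key
    refine ⟨h1, h3.elim id fun h4 => ?_, by omega⟩
    rw [← Set.ncard_eq_zero]
    omega
  · simpa using Set.ncard_le_card (undetermined G a b (σ.supp 7) (σ.supp 8))
  · rintro z τ ⟨h1, h2, h3⟩
    have h1' : Located H (τ.setVar 12 z) a b := by
      obtain ⟨h1, h1', h1''⟩ := h1
      exact ⟨by simp [h1], by simp [h1'], h1''⟩
    have hch := run_choose (G := G) hab h1'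
    rw [Code.refine, Code.run_seq]
    set ρ := Code.choose.run G H (τ.setVar 12 z) with hρ
    have r1 : ρ.vars 1 = a := (Code.run_vars rfl).trans h1'.1
    have r2 : ρ.vars 2 = b := (Code.run_vars rfl).trans h1'.2.1
    have r7 : (ρ.supp 7 : Set (Fin n)) = τ.supp 7 := (Code.run_supp rfl).trans rfl
    have r8 : (ρ.supp 8 : Set (Fin n)) = τ.supp 8 := (Code.run_supp rfl).trans rfl
    have rc : ρ.cnt = τ.cnt := (Code.run_cnt rfl).trans rfl
    have hK : Knows H ρ := by rw [Knows, r7, r8]; exact h1.2.2.2.2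
    rcases hch with ⟨h4, h5⟩ | ⟨v, h4, h5⟩
    · rw [Code.run_ite_of_not_holds (by simp [h5]), Code.run_skip, r7, r8, rc]
      exact ⟨⟨r1, r2, by rw [r7]; exact h1.2.2.1, by rw [r8]; exact h1.2.2.2.1, hK⟩, h2, .inl h4⟩
    · simp only [Store.supp_setVar] at h4
      rw [Code.run_ite_of_holds (by simp [h5])]
      have hne : undetermined G a b (τ.supp 7) (τ.supp 8) ≠ ∅ := fun h => by
        have := h4.1
        rw [h] at this
        exact this
      have h3' := h3.resolve_left hne
      have q1 : (Code.ask.run G H ρ).vars 1 = a := (Code.run_vars rfl).trans r1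
      have q2 : (Code.ask.run G H ρ).vars 2 = b := (Code.run_vars rfl).trans r2
      have hK' : Knows H (Code.ask.run G H ρ) := hK.ask h5
      by_cases hv : v ∈ H
      · obtain ⟨e7, e8, ec⟩ := run_ask_of_mem (G := G) h5 hv
        rw [r7] at e7
        rw [r8] at e8
        have hp := h4.potential_insert_lt hab hd
        have hu := h4.ncard_undetermined_insert_lt
        refine ⟨⟨q1, q2, ?_, ?_, hK'⟩, ?_, .inr ?_⟩
        · rw [e7]
          exact Set.mem_insert_of_mem _ h1.2.2.1
        · rw [e8]
          exact h1.2.2.2.1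
        · rw [e7, e8]
          omega
        · rw [e7, e8]
          omega
      · obtain ⟨e7, e8, ec⟩ := run_ask_of_notMem (G := G) h5 hv
        rw [r7] at e7
        rw [r8] at e8
        have hp := h4.swap.potential_insert_lt hab.symm hd
        have hu := h4.swap.ncard_undetermined_insert_lt
        rw [potential_swap (a := a), potential_swap (a := a)] at hp
        rw [undetermined_swap (a := a), undetermined_swap (a := a)] at hu
        refine ⟨⟨q1, q2, ?_, ?_, hK'⟩, ?_, .inr ?_⟩
        · rw [e7]
          exact h1.2.2.1
        · rw [e8]
          exact Set.mem_insert_of_mem _ h1.2.2.2.1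
        · rw [e7, e8]
          omega
        · rw [e7, e8]
          omega

theorem run_deduce (hG : G.Connected) (hab : G.Adj a b) (h : Located H σ a b)
    (hH : IsHalfspace G (H : Set (Fin n)))
    (hX : undetermined G a b (σ.supp 7) (σ.supp 8) = ∅) :
    ((Code.deduce.run G H σ).supp 0 : Set (Fin n)) = H := by
  obtain ⟨ha, hb, ha7, hb8, hK⟩ := h
  have hcon : Consistent G a b (σ.supp 7) (σ.supp 8) H :=
    ⟨⟨hH, hK.1 ha7, hK.2 b hb8⟩, hK.1, hK.2⟩
  rw [Code.deduce, (run_loop_setEntry (G := G) (H := H) (σ := σ) (fun z => z ∈ H)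
    (fun τ => (τ.supp 7 : Set (Fin n)) = σ.supp 7 ∧ (τ.supp 8 : Set (Fin n)) = σ.supp 8)
    ⟨rfl, rfl⟩ (fun τ x => by simp) ?_).2]
  · rfl
  rintro z τ ⟨h7, h8⟩
  have s1 := run_solvePos (G := G) (H := H) (σ := τ.setVar 13 z) hab (h7 ▸ ha7) (h8 ▸ hb8)
    (z := z) (by simp)
  refine ⟨(Code.run_vars rfl).trans (by simp), Code.run_supp rfl, ?_, ?_, ?_⟩
  · rw [Term.holds_var, s1, Store.supp_setVar, Store.supp_setVar, h7, h8,
      satisfiable_insert_fst_iff ha7 hb8]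
    constructor
    · rintro ⟨H', hH', hz⟩
      rwa [← hcon.eq_of_undetermined_eq_empty hG hab hX hH'] at hz
    · exact fun hz => ⟨H, hcon, hz⟩
  · rw [Code.run_supp rfl, Code.run_supp rfl]
    exact h7
  · rw [Code.run_supp rfl, Code.run_supp rfl]
    exact h8

end Run

/-! ### The learning program -/

section Parameters

variable {V W : Type*} {G : SimpleGraph V} {G' : SimpleGraph W}

/-- Upper bounds on the size of a smallest set that hits all halfspaces, the diameter, the clique
number, and the number of vertices that halfspaces shatter. -/
structure ParameterBounds (G : SimpleGraph V) (h δ w d : ℕ) : Prop where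
  hits : ∃ S : Finset V, HitsHalfspaces G (S : Set V) ∧ S.card ≤ h
  dist_le : ∀ a b, G.dist a b ≤ δ
  clique : CliqueBound G w
  shatter : ShatterBound G d

/-- The number of label queries in terms of the graph parameters. -/
def queryBound (h δ w d : ℕ) : ℕ :=
  2 * h + 1 + Nat.clog 2 δ + (Nat.clog 2 (2 * w + 1) + (2 * d + 2))

theorem IsHalfspace.preimage (e : G ≃g G') {H : Set W} (hH : IsHalfspace G' H) :
    IsHalfspace G (e ⁻¹' H) := by
  have key : ∀ H : Set W, CliqueBoundary G' H → CliqueBoundary G (e ⁻¹' H) :=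
    fun H hH x hx y hy x' hx' y' hy' h h' hne => e.map_adj_iff.1 <|
      hH _ hx _ hy _ hx' _ hy' (e.map_adj_iff.2 h) (e.map_adj_iff.2 h') (e.injective.ne hne)
  exact ⟨key H hH.1, key Hᶜ hH.2⟩

theorem ParameterBounds.of_iso {h δ w d : ℕ} (hb : ParameterBounds G h δ w d)
    (hG : G.Connected) (e : G ≃g G') : ParameterBounds G' h δ w d := by
  classical
  obtain ⟨⟨S, hS, hSh⟩, hδ, hw, hd⟩ := hb
  refine ⟨⟨S.map e.toEquiv.toEmbedding, fun H hH hne hnu => ?_, by simpa using hSh⟩,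
    fun a b => ?_, fun s hs => ?_, fun Z hZ => ?_⟩
  · obtain ⟨x, hxS, hxH⟩ := hS _ (hH.preimage e) (hne.preimage e.surjective) fun h => hnu <|
      Set.eq_univ_of_forall fun y => by
        have : e.symm y ∈ e ⁻¹' H := h ▸ trivial
        simpa using this
    exact ⟨e x, by simpa using hxS, hxH⟩
  · obtain ⟨p, hp⟩ := hG.exists_walk_length_eq_dist (e.symm a) (e.symm b)
    have h1 := SimpleGraph.dist_le (p.map e.toHom)
    rw [SimpleGraph.Walk.length_map, hp] at h1
    have h2 := h1.trans (hδ _ _)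
    simpa using h2
  · have := hw (s.map e.symm.toEquiv.toEmbedding) (by
      rintro x hx y hy hne
      simp only [Finset.coe_map, Set.mem_image] at hx hy
      obtain ⟨x, hx, rfl⟩ := hx
      obtain ⟨y, hy, rfl⟩ := hy
      exact e.symm.map_adj_iff.2 (hs hx hy fun h => hne (h ▸ rfl)))
    simpa using this
  · have := hd (Z.map e.symm.toEquiv.toEmbedding) fun σ => by
      obtain ⟨H, hH, h⟩ := hZ (e.symm ⁻¹' σ)
      refine ⟨e ⁻¹' H, hH.preimage e, fun z hz => ?_⟩
      simp only [Finset.mem_map] at hz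
      obtain ⟨z, hz, rfl⟩ := hz
      have := h z hz
      simpa using this
    simpa using this

theorem parameterBounds [Fintype V] [DecidableEq V] (hG : G.Connected) :
    ParameterBounds G (hullNumber G) G.diam G.cliqueNum (mHalfspaces G).vcDim := by
  classical
  have := hG.nonempty
  obtain ⟨S, hS, hSc⟩ := exists_hitsHalfspaces_card_eq_hullNumber G
  refine ⟨⟨S, hS, hSc.le⟩, fun a b => SimpleGraph.dist_le_diam
    (SimpleGraph.connected_iff_ediam_ne_top.1 hG), fun s hs =>
    SimpleGraph.IsClique.card_le_cliqueNum (tc := hs), fun Z hZ => ?_⟩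
  refine Finset.Shatters.card_le_vcDim fun t ht => ?_
  obtain ⟨H, hH, h⟩ := hZ t
  refine ⟨H.toFinset, (mem_mHalfspaces_iff hG).2 (by simpa using hH), ?_⟩
  ext v
  simp only [Finset.mem_inter, Set.mem_toFinset]
  constructor
  · rintro ⟨h1, h2⟩
    exact (h v h1).1 h2
  · exact fun hv => ⟨ht hv, (h v (ht hv)).2 hv⟩

theorem clog_le_two_mul_log (m : ℕ) : (Nat.clog 2 m : ℝ) ≤ 2 * Real.log m + 1 := by
  rcases Nat.eq_zero_or_pos m with rfl | hm
  · simp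
  have hl : 0 ≤ Real.log m := Real.log_natCast_nonneg m
  have h2 : (1 / 2 : ℝ) < Real.log 2 := lt_trans (by norm_num) Real.log_two_gt_d9
  rw [← Real.natCeil_logb_natCast]
  refine (Nat.ceil_lt_add_one (Real.logb_nonneg (by norm_num) (by exact_mod_cast hm))).le.trans ?_
  rw [Real.logb, Nat.cast_two, add_le_add_iff_right, div_le_iff₀ (by linarith)]
  nlinarith

theorem queryBound_le {h δ w d : ℕ} (hh : 1 ≤ h) (hw : 1 ≤ w) :
    (queryBound h δ w d : ℝ) ≤ 9 * (h + Real.log δ + Real.log w + d) := by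
  have h1 := clog_le_two_mul_log δ
  have h2 := clog_le_two_mul_log w
  have h3 : Nat.clog 2 (2 * w + 1) ≤ Nat.clog 2 w + 2 := by
    refine Nat.clog_le_of_le_pow ?_
    have := Nat.le_pow_clog one_lt_two w
    rw [pow_add]
    omega
  have h3' : (Nat.clog 2 (2 * w + 1) : ℝ) ≤ Nat.clog 2 w + 2 := by exact_mod_cast h3
  have h4 : (1 : ℝ) ≤ h := by exact_mod_cast hh
  have h5 : 0 ≤ Real.log δ := Real.log_natCast_nonneg δ
  have h6 : 0 ≤ Real.log w := Real.log_natCast_nonneg w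
  have h7 : (0 : ℝ) ≤ d := Nat.cast_nonneg d
  simp only [queryBound, Nat.cast_add, Nat.cast_mul, Nat.cast_ofNat, Nat.cast_one]
  linarith

theorem queryBound_le_of_connected [Fintype V] [DecidableEq V] (hG : G.Connected) :
    (queryBound (hullNumber G) G.diam G.cliqueNum (mHalfspaces G).vcDim : ℝ) ≤
      9 * ((hullNumber G : ℝ) + Real.log G.diam + Real.log G.cliqueNum +
        (mHalfspaces G).vcDim) := by
  have := hG.nonempty
  obtain ⟨v⟩ := id this
  refine queryBound_le (one_le_hullNumber G) ?_
  have : G.IsClique (({v} : Finset V) : Set V) := by simp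
  simpa using this.card_le_cliqueNum

end Parameters

namespace Strategy

variable {V W : Type*}

/-- The strategy with the vertices renamed. -/
def map (e : W ≃ V) : Strategy W → Strategy V
  | output S => output (S.map e.toEmbedding)
  | query x A B => query (e x) (A.map e) (B.map e)

theorem result_map (e : W ≃ V) (H : Finset V) (A : Strategy W) :
    (A.map e).result H = (A.result (H.map e.symm.toEmbedding)).map e.toEmbedding := by
  induction A with
  | output S => rfl
  | query x A B hA hB =>
    have : x ∈ H.map e.symm.toEmbedding ↔ e x ∈ H := by simp
    by_cases hx : e x ∈ H
    · simp only [map, result, this, hx, if_true, hA]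
    · simp only [map, result, this, hx, if_false, hB]

theorem numQueries_map (e : W ≃ V) (H : Finset V) (A : Strategy W) :
    (A.map e).numQueries H = A.numQueries (H.map e.symm.toEmbedding) := by
  induction A with
  | output S => rfl
  | query x A B hA hB =>
    have : x ∈ H.map e.symm.toEmbedding ↔ e x ∈ H := by simp
    by_cases hx : e x ∈ H
    · simp only [map, numQueries, this, hx, if_true, hA]
    · simp only [map, numQueries, this, hx, if_false, hB]

end Strategy

/-- The learning program.  Labels on a minimal set that hits all halfspaces either determine the
halfspace or include both values; then a binary search finds an edge that is cut, and queries of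
undetermined common neighbours of its ends determine the rest. -/
def Code.learn : Code :=
  .seq minimalHitting <| .seq askHitting <| .seq (.assign 1 (.first 20 (.arr 7 (.var 20)))) <|
    .seq (.assign 2 (.first 20 (.arr 8 (.var 20)))) <|
    .ite (.conj (.lt (.var 1) .card) (.lt (.var 2) .card))
      (.seq (.loop 12 bisect) <| .seq (.loop 12 refine) deduce)
      (.setArr 0 20 (.arr 7 (.const 0)))

section Run

variable {n : ℕ} {G : SimpleGraph (Fin n)} {H : Finset (Fin n)}

/-- The learning program outputs the halfspace after few queries. -/
theorem run_learn (hG : G.Connected) (hH : IsHalfspace G (H : Set (Fin n))) {h δ w d : ℕ}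
    (hb : ParameterBounds G h δ w d) :
    ((Code.learn.run G H Store.init).supp 0 : Set (Fin n)) = H ∧
      (Code.learn.run G H Store.init).cnt ≤ queryBound h δ w d := by
  classical
  obtain ⟨⟨S, hS, hSh⟩, hδ, hw, hd⟩ := hb
  obtain ⟨hQ, hmin⟩ := run_minimalHitting (G := G) (H := H) (σ := Store.init) hG
  simp only [Code.learn, Code.run_seq]
  set σ := Code.minimalHitting.run G H Store.init with hσ
  set Q : Set (Fin n) := σ.supp 9 with hQ'
  have hcard : Q.ncard ≤ 2 * h := by
    have := card_le_two_mul_of_minimal hG (Q := Q.toFinset) (S := S) (by simpa using hQ)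
      (by simpa using hmin) hS
    rw [Set.ncard_eq_toFinset_card']
    omega
  have s7 : (σ.supp 7 : Set (Fin n)) = ∅ :=
    (Code.run_supp rfl).trans (by simp [Store.supp, Store.init])
  have s8 : (σ.supp 8 : Set (Fin n)) = ∅ :=
    (Code.run_supp rfl).trans (by simp [Store.supp, Store.init])
  have sc : σ.cnt = 0 := Code.run_cnt rfl
  obtain ⟨t7, t8, tc⟩ := run_askHitting (G := G) (H := H) s7 s8
  set τ := Code.askHitting.run G H σ with hτ
  rw [← hQ'] at t7 t8 tc
  have hK : Knows H τ := by
    rw [Knows, t7, t8]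
    exact ⟨fun v hv => hv.2, fun v hv => hv.2⟩
  have h0 : 0 < n := by
    obtain ⟨v⟩ := hG.nonempty
    exact v.pos
  let z₀ : Fin n := ⟨0, h0⟩
  have fp := Term.eval_first (G := G) (σ := τ) (i := 20) (e := .arr 7 (.var 20)) (τ.supp 7)
    (by simp)
  set ρ := (Code.assign 1 (.first 20 (.arr 7 (.var 20)))).run G H τ with hρ
  have fq := Term.eval_first (G := G) (σ := ρ) (i := 20) (e := .arr 8 (.var 20)) (τ.supp 8)
    (by simp [hρ])
  set π := (Code.assign 2 (.first 20 (.arr 8 (.var 20)))).run G H ρ with hπ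
  have p1 : π.vars 1 = (Term.first 20 (.arr 7 (.var 20))).eval G τ := by simp [hπ, hρ]
  have p2 : π.vars 2 = (Term.first 20 (.arr 8 (.var 20))).eval G ρ := by simp [hπ]
  have p7 : (π.supp 7 : Set (Fin n)) = τ.supp 7 := rfl
  have p8 : (π.supp 8 : Set (Fin n)) = τ.supp 8 := rfl
  have pc : π.cnt = τ.cnt := rfl
  have hmem0 : z₀ ∈ (τ.supp 7 : Set (Fin n)) ↔ z₀ ∈ H := by
    rw [t7]
    exact ⟨fun h => h.2, fun h => ⟨.inr rfl, h⟩⟩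
  -- the case in which only one label occurs: `Q` would meet both sides of a halfspace other than
  -- `∅` and the vertex set
  have hconst : (∀ v, v ∈ H ↔ z₀ ∈ H) → (¬ (.conj (.lt (.var 1) .card) (.lt (.var 2) .card) :
      Term).Holds G π) → ((Code.ite (.conj (.lt (.var 1) .card) (.lt (.var 2) .card))
      (.seq (.loop 12 .bisect) <| .seq (.loop 12 .refine) .deduce)
      (.setArr 0 20 (.arr 7 (.const 0)))).run G H π).supp 0 = (H : Set (Fin n)) ∧
      ((Code.ite (.conj (.lt (.var 1) .card) (.lt (.var 2) .card))
      (.seq (.loop 12 .bisect) <| .seq (.loop 12 .refine) .deduce)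
      (.setArr 0 20 (.arr 7 (.const 0)))).run G H π).cnt ≤ queryBound h δ w d := by
    intro hall hc
    rw [Code.run_ite_of_not_holds hc]
    refine ⟨?_, ?_⟩
    · ext v
      have h1 : π.arrs 7 0 = 0 ↔ z₀ ∉ (π.supp 7 : Set (Fin n)) :=
        Store.arrs_coe_eq_zero (v := z₀)
      simp [h1, p7, hmem0, hall v]
    · rw [Code.cnt_setArr, pc, queryBound]
      omega
  rcases fp with ⟨fp, fp'⟩ | ⟨a, ha, fp⟩
  · refine hconst (fun v => ?_) (by simp [p1, fp'])
    have hz : z₀ ∉ H := fun h => by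
      have := hmem0.2 h
      rw [fp] at this
      exact this
    refine iff_of_false (fun hv => ?_) hz
    obtain ⟨x, hxQ, hxH⟩ := hQ H hH ⟨v, hv⟩ fun h => hz (by
      have : z₀ ∈ (H : Set (Fin n)) := h ▸ trivial
      exact this)
    have : x ∈ (τ.supp 7 : Set (Fin n)) := by rw [t7]; exact ⟨.inl hxQ, hxH⟩
    rw [fp] at this
    exact this
  rcases fq with ⟨fq, fq'⟩ | ⟨b, hb, fq⟩
  · refine hconst (fun v => ?_) (by simp [p2, fq'])
    have hz : z₀ ∈ H := by
      by_contra h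
      have : z₀ ∈ (τ.supp 8 : Set (Fin n)) := by rw [t8]; exact ⟨.inr rfl, h⟩
      rw [fq] at this
      exact this
    refine iff_of_true ?_ hz
    by_contra hv
    obtain ⟨x, hxQ, hxH⟩ := hQ _ hH.compl ⟨v, hv⟩ fun h => by
      have : z₀ ∈ (H : Set (Fin n))ᶜ := h ▸ trivial
      exact this hz
    have : x ∈ (τ.supp 8 : Set (Fin n)) := by rw [t8]; exact ⟨.inl hxQ, hxH⟩
    rw [fq] at this
    exact this
  rw [Code.run_ite_of_holds (by simp [p1, p2, fp, fq])]
  simp only [Code.run_seq]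
  have hloc : Located H π a b := ⟨p1.trans fp, p2.trans fq, ha, hb, hK⟩
  obtain ⟨a', b', l1, hab, c1⟩ := run_loop_bisect hG hloc
  obtain ⟨l2, hX, c2⟩ := run_loop_refine hab l1 hd
  refine ⟨run_deduce hG hab l2 hH hX, ?_⟩
  have hsep : Separating G a' b' H := ⟨hH, l1.2.2.2.2.1 l1.2.2.1, l1.2.2.2.2.2 _ l1.2.2.2.1⟩
  have c3 := hsep.potential_le (P := ((Code.loop 12 .bisect).run G H π).supp 7)
    (N := ((Code.loop 12 .bisect).run G H π).supp 8) hab hw hd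
  have c4 := Nat.clog_mono_right 2 (hδ a b)
  rw [Code.run_cnt (c := .deduce) rfl, queryBound]
  omega

/-- The learning program as a query strategy. -/
noncomputable def learnStrategy (G : SimpleGraph (Fin n)) : Strategy (Fin n) :=
  Code.learn.strategy G Store.init fun σ => .output (Set.toFinite (σ.supp 0)).toFinset

/-- The queries of the strategy are those that the program counts. -/
theorem learnStrategy_spec (hG : G.Connected) (hH : IsHalfspace G (H : Set (Fin n)))
    {h δ w d : ℕ} (hb : ParameterBounds G h δ w d) :
    (learnStrategy G).result H = H ∧ (learnStrategy G).numQueries H ≤ queryBound h δ w d := by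
  obtain ⟨h1, h2⟩ := run_learn hG hH hb
  obtain ⟨h3, h4⟩ := Code.strategy_spec G H .learn Store.init fun σ =>
    .output (Set.toFinite (σ.supp 0)).toFinset
  refine ⟨h3.trans ?_, (Nat.le_add_right _ _).trans (h4.trans ?_)⟩
  · ext v
    simp [Strategy.result, h1]
  · rw [Strategy.numQueries, zero_add]
    exact h2

end Run

theorem queryComplexity_mHalfspaces_le {V : Type*} [Fintype V] {G : SimpleGraph V}
    (hG : G.Connected) {h δ w d : ℕ} (hb : ParameterBounds G h δ w d) :
    queryComplexity (mHalfspaces G) ≤ queryBound h δ w d := by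
  let e := G.overFinIso rfl
  have hG' : (G.overFin rfl).Connected := e.connected_iff.1 hG
  have key : ∀ H ∈ mHalfspaces G,
      ((learnStrategy (G.overFin rfl)).map e.symm.toEquiv).result H = H ∧
      ((learnStrategy (G.overFin rfl)).map e.symm.toEquiv).numQueries H ≤ queryBound h δ w d := by
    intro H hH
    have hH' : IsHalfspace (G.overFin rfl)
        (H.map e.symm.toEquiv.symm.toEmbedding : Set (Fin (Fintype.card V))) := by
      have := ((mem_mHalfspaces_iff hG).1 hH).preimage e.symm
      convert this using 1
      ext v
      simp
    obtain ⟨h1, h2⟩ := learnStrategy_spec hG' hH' (hb.of_iso hG e)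
    rw [Strategy.result_map, Strategy.numQueries_map, h1]
    refine ⟨?_, h2⟩
    ext v
    simp
  have hle : queryComplexity (mHalfspaces G) ≤
      ((learnStrategy (G.overFin rfl)).map e.symm.toEquiv).queryComplexity (mHalfspaces G) :=
    Nat.sInf_le ⟨_, fun H hH => (key H hH).1, rfl⟩
  exact hle.trans (Finset.sup_le fun H hH => (key H hH).2)

end MonophonicLearning

theorem mainTheorem10 :
    ∃ C : ℝ,
      (∀ (V : Type*) [Fintype V] [DecidableEq V] (G : SimpleGraph V), G.Connected →
        (MonophonicLearning.queryComplexity (MonophonicLearning.mHalfspaces G) : ℝ) ≤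
          C * ((MonophonicLearning.hullNumber G : ℝ) + Real.log G.diam + Real.log G.cliqueNum +
            (MonophonicLearning.mHalfspaces G).vcDim)) ∧
      ∃ (P : MonophonicLearning.Prog) (p : Polynomial ℕ),
        ∀ (n : ℕ) (G : SimpleGraph (Fin n)), G.Connected →
          ∀ H ∈ MonophonicLearning.mHalfspaces G, ∃ t q : ℕ,
            MonophonicLearning.Outputs G H P H t q ∧
            t ≤ p.eval n ∧
            (q : ℝ) ≤
              C * ((MonophonicLearning.hullNumber G : ℝ) + Real.log G.diam +
                Real.log G.cliqueNum + (MonophonicLearning.mHalfspaces G).vcDim) := by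
  refine ⟨9, fun V _ _ G hG => ?_, MonophonicLearning.Code.learn.toProg, ?_⟩
  · exact (Nat.cast_le.2 (MonophonicLearning.queryComplexity_mHalfspaces_le hG
      (MonophonicLearning.parameterBounds hG))).trans
      (MonophonicLearning.queryBound_le_of_connected hG)
  · obtain ⟨p, hp⟩ := MonophonicLearning.Code.learn.outputs_toProg
    refine ⟨p, fun n G hG H hH => ?_⟩
    obtain ⟨h1, h2⟩ := MonophonicLearning.run_learn hG
      ((MonophonicLearning.mem_mHalfspaces_iff hG).1 hH) (MonophonicLearning.parameterBounds hG)
    obtain ⟨t, ht, htp⟩ := hp n G H H fun v => by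
      have := Set.ext_iff.1 h1 v
      exact this.symm
    exact ⟨t, _, ht, htp, (Nat.cast_le.2 h2).trans
      (MonophonicLearning.queryBound_le_of_connected hG)⟩
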